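/- For $n\ge 1$ let $A_n=\mathbb Z[\tfrac1n,e^{2\pi i/n}]\subseteq\mathbb C$. Let $p\neq q$ be primes, $Q$ a commutative Noetherian $A_{pq}$-algebra (hence also an $A_p$- and an $A_q$-algebra via $A_p,A_q\subseteq A_{pq}$), and $Z\subseteq\operatorname{Spec}(Q)$ a closed subset. Let $\mathcal P^Z(Q)$ be the category of bounded complexes of finitely generated projective $Q$-modules with homology supported on $Z$, and let $K_0^Z(Q)$ be its Grothendieck group: the abelian group generated by the objects, modulo $[X]=[X']+[X'']$ for every short exact sequence $0\to X'\to X\to X''\to 0$ and $[X]=[Y]$ for every quasi-isomorphism $X\to Y$. For $n\ge1$ and $X\in\mathcal P^Z(Q)$ let $T^n(X)$ be the $n$-fold tensor power over $Q$ with the signed action $\sigma(x_1\otimes\cdots\otimes x_n)=\pm x_{\sigma(1)}\otimes\cdots\otimes x_{\sigma(n)}$ of permutations, where the sign (the Koszul sign) is the product of $(-1)^{|x_{\sigma(i)}||x_{\sigma(j)}|}$ over all pairs $i<j$ with $\sigma(j)<\sigma(i)$. If $Q$ is an $A_n$-algebra and $\zeta$ is an $n$-th root of unity, let $T^n(X)^{(\zeta)}\in\mathcal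 P^Z(Q)$ be the kernel of $\sigma-\zeta$ on $T^n(X)$, for the $n$-cycle $\sigma=(1\,2\,\cdots\,n)$ and the image of $\zeta$ in $Q$. View $K_0^Z(Q)$ as a subgroup of $K_0^Z(Q)\otimes_{\mathbb Z}\mathbb Z[e^{2\pi i/n}]$ via $a\mapsto a\otimes 1$. Then for $l\in\{p,q\}$ there is a unique map $\Psi^l\colon K_0^Z(Q)\to K_0^Z(Q)$ such that $\Psi^l([X])=\sum_{\zeta^l=1}\zeta\,[T^l(X)^{(\zeta)}]$ in $K_0^Z(Q)\otimes_{\mathbb Z}\mathbb Z[e^{2\pi i/l}]$ for all $X\in\mathcal P^Z(Q)$; it is a group endomorphism; the two endomorphisms commute, $$\Psi^p\circ\Psi^q=\Psi^q\circ\Psi^p ;$$ and for all $X\in\mathcal P^Z(Q)$ $$\Psi^p(\Psi^q([X]))=\Psi^q(\Psi^p([X]))=\sum_{\eta^{pq}=1}\eta\,[T^{pq}(X)^{(\eta)}]\quad\text{in } K_0^Z(Q)\otimes_{\mathbb Z}\mathbb Z[e^{2\pi i/pq}],$$ where $\eta$ runs over all $pq$-th roots of unity. -/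

import Mathlib

open CategoryTheory DirectSum TensorProduct

universe u

namespace CyclicAdams

section TensorPowers

variable {Q : Type u} [CommRing Q]

/-- The underlying module `⨁ i, X i` of a complex. -/
abbrev Tot (X : ChainComplex (ModuleCat.{u} Q) ℤ) : Type u := ⨁ i : ℤ, X.X i

/-- The inclusion of the degree `i` component. -/
noncomputable abbrev inc (X : ChainComplex (ModuleCat.{u} Q) ℤ) (i : ℤ) : X.X i →ₗ[Q] Tot X :=
  DirectSum.lof Q ℤ (fun i => X.X i) i

/-- The sign `(-1) ^ b` of a parity `b`. -/
def sgn (b : ZMod 2) : ℤ := (-1) ^ b.val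

/-- The differential, on the total module. -/
noncomputable def totD (X : ChainComplex (ModuleCat.{u} Q) ℤ) : Tot X →ₗ[Q] Tot X :=
  DirectSum.toModule Q ℤ _ (fun i => inc X (i - 1) ∘ₗ (X.d i (i - 1)).hom)

/-- The involution `x ↦ (-1) ^ |x| x`. -/
noncomputable def eps (X : ChainComplex (ModuleCat.{u} Q) ℤ) : Tot X →ₗ[Q] Tot X :=
  DirectSum.toModule Q ℤ _ (fun i => (sgn (i : ZMod 2) : Q) • inc X i)

/-- The projection onto the part of parity `b`. -/
noncomputable def parityProj (X : ChainComplex (ModuleCat.{u} Q) ℤ) (b : ZMod 2) :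
    Tot X →ₗ[Q] Tot X :=
  DirectSum.toModule Q ℤ _ (fun i => if (i : ZMod 2) = b then inc X i else 0)

/-- The `n`-fold tensor power (over `Q`) of the total module. -/
abbrev Pow (n : ℕ) (X : ChainComplex (ModuleCat.{u} Q) ℤ) : Type u := ⨂[Q] _ : Fin n, Tot X

/-- The degree `m` part of the tensor power: the span of the tensors `x₁ ⊗ ⋯ ⊗ xₙ` of homogeneous
elements with `|x₁| + ⋯ + |xₙ| = m`. -/
def powDeg (n : ℕ) (X : ChainComplex (ModuleCat.{u} Q) ℤ) (m : ℤ) : Submodule Q (Pow n X) :=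
  Submodule.span Q {t | ∃ (a : Fin n → ℤ) (x : ∀ i, X.X (a i)), ∑ i, a i = m ∧
    t = PiTensorProduct.tprod Q (fun i => inc X (a i) (x i))}

/-- The differential applied in the `i`-th tensor factor, with the Koszul sign:
`x₁ ⊗ ⋯ ⊗ xₙ ↦ (-1) ^ (|x₁| + ⋯ + |xᵢ₋₁|) x₁ ⊗ ⋯ ⊗ d xᵢ ⊗ ⋯ ⊗ xₙ`. -/
noncomputable def powDAt (n : ℕ) (X : ChainComplex (ModuleCat.{u} Q) ℤ) (i : Fin n) :
    Pow n X →ₗ[Q] Pow n X :=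
  PiTensorProduct.map (fun j => if j < i then eps X else if j = i then totD X else 1)

/-- The differential of the tensor power. -/
noncomputable def powD (n : ℕ) (X : ChainComplex (ModuleCat.{u} Q) ℤ) : Pow n X →ₗ[Q] Pow n X :=
  ∑ i, powDAt n X i

/-- The Koszul sign of `x₁ ⊗ ⋯ ⊗ xₙ ↦ ± x_{σ 1} ⊗ ⋯ ⊗ x_{σ n}`, where `s k` is the
parity of the degree of `xₖ`: a factor `(-1) ^ (|x_{σ i}| |x_{σ j}|)` for each pair `i < j`
with `σ j < σ i`. -/
def koszulSign {n : ℕ} (σ : Equiv.Perm (Fin n)) (s : Fin n → ZMod 2) : ℤ :=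
  sgn (∑ i, ∑ j, if i < j ∧ σ j < σ i then s (σ i) * s (σ j) else 0)

/-- The signed action of a permutation on the tensor power:
`x₁ ⊗ ⋯ ⊗ xₙ ↦ ± x_{σ 1} ⊗ ⋯ ⊗ x_{σ n}` for homogeneous elements. -/
noncomputable def permOp (n : ℕ) (X : ChainComplex (ModuleCat.{u} Q) ℤ) (σ : Equiv.Perm (Fin n)) :
    Pow n X →ₗ[Q] Pow n X :=
  ∑ s : Fin n → ZMod 2, (koszulSign σ s : Q) •
    ((PiTensorProduct.reindex Q (fun _ => Tot X) σ.symm).toLinearMap ∘ₗ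
      PiTensorProduct.map (fun i => parityProj X (s i)))

variable {X : ChainComplex (ModuleCat.{u} Q) ℤ} {n : ℕ}

lemma sgn_add (a b : ZMod 2) : sgn (a + b) = sgn a * sgn b := by
  revert a b; decide

lemma sgn_sum {ι : Type*} (t : Finset ι) (f : ι → ZMod 2) :
    sgn (∑ i ∈ t, f i) = ∏ i ∈ t, sgn (f i) := by
  classical
  induction t using Finset.induction_on with
  | empty => simp [sgn]
  | insert i t hi ih => rw [Finset.sum_insert hi, Finset.prod_insert hi, sgn_add, ih]

lemma sgn_mul_self (a : ZMod 2) : sgn a * sgn a = 1 := by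
  revert a; decide

lemma totD_inc (i : ℤ) (x : X.X i) : totD X (inc X i x) = inc X (i - 1) ((X.d i (i - 1)).hom x) := by
  simp [totD, inc]

lemma eps_inc (i : ℤ) (x : X.X i) : eps X (inc X i x) = (sgn (i : ZMod 2) : Q) • inc X i x := by
  simp [eps, inc]

lemma parityProj_inc (b : ZMod 2) (i : ℤ) (x : X.X i) :
    parityProj X b (inc X i x) = if (i : ZMod 2) = b then inc X i x else 0 := by
  simp only [parityProj, inc, DirectSum.toModule_lof]
  split_ifs <;> rfl

lemma totD_mul_totD : totD X * totD X = 0 := by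
  refine DirectSum.linearMap_ext Q fun i => LinearMap.ext fun x => ?_
  have h : (X.d (i - 1) (i - 1 - 1)).hom ((X.d i (i - 1)).hom x) = 0 := by
    rw [← LinearMap.comp_apply, ← ModuleCat.hom_comp, X.d_comp_d]; rfl
  simp only [LinearMap.comp_apply, Module.End.mul_apply, totD_inc, h, map_zero, LinearMap.zero_apply]

lemma eps_mul_totD : eps X * totD X = -(totD X * eps X) := by
  refine DirectSum.linearMap_ext Q fun i => LinearMap.ext fun x => ?_
  simp only [LinearMap.comp_apply, Module.End.mul_apply, totD_inc, eps_inc, LinearMap.neg_apply,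
    map_smul]
  rw [← neg_smul, ← Int.cast_neg]
  congr 2
  push_cast
  generalize (i : ZMod 2) = b
  revert b; decide

lemma pow_ext {N : Type*} [AddCommGroup N] [Module Q N] {f g : Pow n X →ₗ[Q] N}
    (h : ∀ (a : Fin n → ℤ) (x : ∀ i, X.X (a i)),
      f (PiTensorProduct.tprod Q (fun i => inc X (a i) (x i))) =
      g (PiTensorProduct.tprod Q (fun i => inc X (a i) (x i)))) : f = g := by
  refine PiTensorProduct.ext (MultilinearMap.directSum_ext fun a => ?_)
  ext x
  exact h a x

lemma map_add_map {f g : Fin n → (Tot X →ₗ[Q] Tot X)} (i : Fin n)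
    (h : ∀ j, j ≠ i → f j = g j) :
    PiTensorProduct.map f + PiTensorProduct.map g =
      PiTensorProduct.map (Function.update f i (f i + g i)) := by
  rw [PiTensorProduct.map_update_add, Function.update_eq_self]
  congr 2
  ext1 j
  by_cases hj : j = i
  · subst hj; simp
  · simp [hj, h j hj]

lemma map_eq_zero {f : Fin n → (Tot X →ₗ[Q] Tot X)} (i : Fin n) (h : f i = 0) :
    PiTensorProduct.map f = 0 :=
  (PiTensorProduct.mapMultilinear Q (fun _ : Fin n => Tot X) (fun _ => Tot X)).map_coord_zero i h

lemma powDAt_mul_self (i : Fin n) : powDAt n X i * powDAt n X i = 0 := by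
  rw [powDAt, ← PiTensorProduct.map_mul]
  exact map_eq_zero i (by simp [totD_mul_totD])

lemma powDAt_anticomm {i j : Fin n} (hij : i < j) :
    powDAt n X i * powDAt n X j + powDAt n X j * powDAt n X i = 0 := by
  rw [powDAt, powDAt, ← PiTensorProduct.map_mul, ← PiTensorProduct.map_mul, map_add_map i]
  · exact map_eq_zero i (by simp [hij, eps_mul_totD])
  · intro k hk
    rcases lt_trichotomy k i with h | h | h
    · simp [h, h.trans hij]
    · exact absurd h hk
    · simp [hk, h.not_gt]

lemma powD_mul_self : powD n X * powD n X = 0 := by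
  rw [powD, Finset.sum_mul_sum, ← Finset.sum_product']
  refine Finset.sum_involution (fun a _ => (a.2, a.1)) ?_ ?_ (by simp) (by simp)
  · rintro ⟨i, j⟩ -
    rcases lt_trichotomy i j with h | h | h
    · exact powDAt_anticomm h
    · subst h; simp [powDAt_mul_self]
    · rw [add_comm]; exact powDAt_anticomm h
  · rintro ⟨i, j⟩ - h0 h
    simp only [Prod.mk.injEq] at h
    rw [h.1] at h0
    exact h0 (powDAt_mul_self _)

/-- `y` consists of elements homogeneous of parities `s`. -/
def IsPar (s : Fin n → ZMod 2) (y : Fin n → Tot X) : Prop :=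
  ∀ k b, parityProj X b (y k) = if s k = b then y k else 0

lemma isPar_inc (a : Fin n → ℤ) (x : ∀ i, X.X (a i)) :
    IsPar (X := X) (fun i => (a i : ZMod 2)) (fun i => inc X (a i) (x i)) := by
  intro k b
  exact parityProj_inc b _ _

lemma permOp_tprod (σ : Equiv.Perm (Fin n)) {s : Fin n → ZMod 2} {y : Fin n → Tot X}
    (h : IsPar s y) : permOp n X σ (PiTensorProduct.tprod Q y) =
      (koszulSign σ s : Q) • PiTensorProduct.tprod Q (fun i => y (σ i)) := by
  rw [permOp, LinearMap.sum_apply, Finset.sum_eq_single s]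
  · rw [LinearMap.smul_apply, LinearMap.comp_apply, PiTensorProduct.map_tprod]
    congr 1
    have : (fun i => (parityProj X (s i)) (y i)) = y := by ext1 i; simp [h i]
    rw [this]
    exact PiTensorProduct.reindex_tprod σ.symm y
  · intro t _ hts
    obtain ⟨k, hk⟩ := Function.ne_iff.mp hts
    rw [LinearMap.smul_apply, LinearMap.comp_apply, PiTensorProduct.map_tprod,
      (PiTensorProduct.tprod Q).map_coord_zero k (by simp [h k, Ne.symm hk])]
    simp
  · simp

lemma permOp_mul (σ τ : Equiv.Perm (Fin n)) :
    permOp n X σ * permOp n X τ = permOp n X (τ * σ) := by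
  refine pow_ext fun a x => ?_
  have h := isPar_inc a x
  have h' : IsPar (fun i => (a (τ i) : ZMod 2)) (fun i => inc X (a (τ i)) (x (τ i))) :=
    fun k b => h (τ k) b
  rw [Module.End.mul_apply, permOp_tprod τ h, map_smul, permOp_tprod σ h', permOp_tprod _ h,
    smul_smul, ← Int.cast_mul]
  congr 2
  simp only [koszulSign, ← sgn_add]
  congr 1
  rw [← Equiv.sum_comp σ (fun i => ∑ j, if i < j ∧ τ j < τ i then _ else _)]
  simp_rw [← Equiv.sum_comp σ (fun j => if _ < j ∧ τ j < τ _ then _ else _)]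
  rw [← Finset.sum_add_distrib, ← sub_eq_zero, ← Finset.sum_sub_distrib]
  simp_rw [← Finset.sum_add_distrib, ← Finset.sum_sub_distrib]
  rw [← Finset.sum_product']
  have key : ∀ p q r : ZMod 2, p + q = r → p + q - r = 0 := fun p q r h => sub_eq_zero.2 h
  refine Finset.sum_involution (fun a _ => (a.2, a.1)) ?_ ?_ (by simp) (by simp)
  · rintro ⟨i, j⟩ -
    have e2 : ∀ z : ZMod 2, z + z = 0 := by decide
    have e3 : ∀ z : ZMod 2, -z = z := by decide
    by_cases hij : i = j
    · subst hij; simp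
    · have h1 : σ i ≠ σ j := fun h => hij (σ.injective h)
      have h2 : τ (σ i) ≠ τ (σ j) := fun h => h1 (τ.injective h)
      simp only [Equiv.Perm.mul_apply]
      rcases lt_or_gt_of_ne hij with a1 | a1 <;> rcases lt_or_gt_of_ne h1 with a2 | a2 <;>
      rcases lt_or_gt_of_ne h2 with a3 | a3 <;>
      simp [a1, a2, a3, a1.not_gt, a2.not_gt, a3.not_gt, sub_eq_add_neg, e3, e2, mul_comm]
  · rintro ⟨i, j⟩ - h0 h
    simp only [Prod.mk.injEq] at h
    rw [h.1] at h0
    simp at h0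

lemma permOp_one : permOp n X 1 = 1 := by
  refine pow_ext fun a x => ?_
  rw [permOp_tprod 1 (isPar_inc a x)]
  have : koszulSign (1 : Equiv.Perm (Fin n)) (fun i => (a i : ZMod 2)) = 1 := by
    have h : ∀ i j : Fin n, ¬ (i < j ∧ j < i) := fun i j h => lt_asymm h.1 h.2
    simp [koszulSign, h, sgn]
  simp only [this, Int.cast_one, one_smul]; rfl


lemma eps_eq : eps X = parityProj X 0 - parityProj X 1 := by
  refine DirectSum.linearMap_ext Q fun i => LinearMap.ext fun x => ?_
  simp only [LinearMap.comp_apply, LinearMap.sub_apply, eps_inc, parityProj_inc]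
  generalize (i : ZMod 2) = b
  have : b = 0 ∨ b = 1 := by revert b; decide
  rcases this with rfl | rfl <;> simp [sgn, ZMod.val_one]

lemma parityProj_totD (b : ZMod 2) : parityProj X b * totD X = totD X * parityProj X (b + 1) := by
  refine DirectSum.linearMap_ext Q fun i => LinearMap.ext fun x => ?_
  simp only [LinearMap.comp_apply, Module.End.mul_apply, totD_inc, parityProj_inc]
  push_cast
  have : ((i : ZMod 2) - 1 = b) ↔ ((i : ZMod 2) = b + 1) := sub_eq_iff_eq_add
  simp only [this]
  split_ifs
  · rw [totD_inc]
  · simp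

lemma IsPar.eps {s : Fin n → ZMod 2} {y : Fin n → Tot X} (h : IsPar s y) (k : Fin n) :
    eps X (y k) = (sgn (s k) : Q) • y k := by
  rw [eps_eq, LinearMap.sub_apply, h k, h k]
  generalize s k = b
  have : b = 0 ∨ b = 1 := by revert b; decide
  rcases this with rfl | rfl <;> simp [sgn, ZMod.val_one]

lemma IsPar.update {s : Fin n → ZMod 2} {y : Fin n → Tot X} (h : IsPar s y) (i : Fin n) :
    IsPar (s + Pi.single i 1) (Function.update y i (totD X (y i))) := by
  intro k b
  by_cases hk : k = i
  · subst hk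
    have := LinearMap.congr_fun (parityProj_totD (X := X) b) (y k)
    rw [Module.End.mul_apply, Module.End.mul_apply, h k] at this
    simp only [Function.update_self, this, Pi.add_apply, Pi.single_eq_same]
    have e : ∀ c b : ZMod 2, (c = b + 1) ↔ (c + 1 = b) := by decide
    simp only [e]
    split_ifs <;> simp
  · simp [hk, h k]

lemma powDAt_tprod (i : Fin n) {s : Fin n → ZMod 2} {y : Fin n → Tot X} (h : IsPar s y) :
    powDAt n X i (PiTensorProduct.tprod Q y) =
      (sgn (∑ j, if j < i then s j else 0) : Q) •
        PiTensorProduct.tprod Q (Function.update y i (totD X (y i))) := by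
  rw [powDAt, PiTensorProduct.map_tprod, sgn_sum, Int.cast_prod,
    ← (PiTensorProduct.tprod Q).map_smul_univ]
  congr 1
  ext1 j
  rcases lt_trichotomy j i with hj | hj | hj
  · simp [hj, hj.ne, h.eps]
  · subst hj; simp [sgn]
  · simp [hj.not_gt, hj.ne', sgn]

lemma koszul_identity (σ : Equiv.Perm (Fin n)) (s : Fin n → ZMod 2) (k : Fin n) :
    sgn (∑ j, if j < σ k then s j else 0) * koszulSign σ (s + Pi.single (σ k) 1) =
      koszulSign σ s * sgn (∑ j, if j < k then s (σ j) else 0) := by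
  have hsq : ∀ z : ZMod 2, z + z = 0 := by decide
  simp only [koszulSign, ← sgn_add]
  congr 1
  have e1 : ∀ i j : Fin n, (if i < j ∧ σ j < σ i then
      (s + Pi.single (σ k) 1 : Fin n → ZMod 2) (σ i) *
        (s + Pi.single (σ k) 1 : Fin n → ZMod 2) (σ j) else 0 : ZMod 2) =
      (if i < j ∧ σ j < σ i then s (σ i) * s (σ j) else 0) +
      ((if j = k then (if i < j ∧ σ j < σ i then s (σ i) else 0) else 0) +
       (if i = k then (if i < j ∧ σ j < σ i then s (σ j) else 0) else 0)) := by
    intro i j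
    by_cases hc : i < j ∧ σ j < σ i
    · have hij : i ≠ j := hc.1.ne
      simp only [hc, and_self, if_true, Pi.add_apply, Pi.single_apply, σ.injective.eq_iff]
      by_cases hi : i = k
      · have hj : ¬ j = k := fun h => hij (hi.trans h.symm)
        simp [hi, hj]; ring
      · by_cases hj : j = k <;> simp [hi, hj]; ring
    · simp [hc]
  simp only [e1, Finset.sum_add_distrib]
  have e2 : (∑ i, ∑ j, if j = k then (if i < j ∧ σ j < σ i then s (σ i) else 0) else 0) =
      ∑ i, if i < k ∧ σ k < σ i then s (σ i) else 0 := by simp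
  have e3 : (∑ i, ∑ j, if i = k then (if i < j ∧ σ j < σ i then s (σ j) else 0) else 0) =
      ∑ j, if k < j ∧ σ j < σ k then s (σ j) else 0 := by
    rw [Finset.sum_comm]; simp
  rw [e2, e3, ← Equiv.sum_comp σ (fun j => if j < σ k then s j else 0)]
  rw [add_left_comm, ← Finset.sum_add_distrib, ← Finset.sum_add_distrib]
  congr 1
  refine Finset.sum_congr rfl fun j _ => ?_
  rcases lt_trichotomy j k with h | h | h
  · have h' : σ j ≠ σ k := fun e => h.ne (σ.injective e)
    rcases lt_or_gt_of_ne h' with h' | h' <;> simp [h, h', h.not_gt, h'.not_gt]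
  · simp [h]
  · have h' : σ j ≠ σ k := fun e => h.ne' (σ.injective e)
    rcases lt_or_gt_of_ne h' with h' | h' <;> simp [h, h', h.not_gt, h'.not_gt, hsq]

lemma permOp_powDAt (σ : Equiv.Perm (Fin n)) (k : Fin n) :
    permOp n X σ * powDAt n X (σ k) = powDAt n X k * permOp n X σ := by
  refine pow_ext fun a x => ?_
  have h := isPar_inc a x
  have h' : IsPar (fun i => (a (σ i) : ZMod 2)) (fun i => inc X (a (σ i)) (x (σ i))) :=
    fun k b => h (σ k) b
  rw [Module.End.mul_apply, Module.End.mul_apply, powDAt_tprod _ h, map_smul, permOp_tprod σ h,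
    permOp_tprod σ (h.update _), map_smul, powDAt_tprod _ h', smul_smul, smul_smul,
    ← Int.cast_mul, ← Int.cast_mul, koszul_identity]
  congr 2
  ext1 i
  by_cases hi : i = k
  · subst hi; simp
  · simp [hi]

lemma permOp_powD (σ : Equiv.Perm (Fin n)) :
    permOp n X σ * powD n X = powD n X * permOp n X σ := by
  have : powD n X = ∑ k, powDAt n X (σ k) := (Equiv.sum_comp σ _).symm
  rw [this, Finset.mul_sum, ← this, powD, Finset.sum_mul]
  exact Finset.sum_congr rfl fun k _ => permOp_powDAt σ k

/-- `y` consists of homogeneous elements of degrees `a`. -/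
def IsHomog (a : Fin n → ℤ) (y : Fin n → Tot X) : Prop :=
  ∀ k, y k ∈ LinearMap.range (inc X (a k))

lemma tprod_mem_powDeg {a : Fin n → ℤ} {y : Fin n → Tot X} (h : IsHomog a y) {m : ℤ}
    (hm : ∑ i, a i = m) : PiTensorProduct.tprod Q y ∈ powDeg n X m := by
  choose x hx using h
  exact Submodule.subset_span ⟨a, x, hm, by congr 1; ext1 i; exact (hx i).symm⟩

lemma powDeg_induction {m : ℤ} {S : Submodule Q (Pow n X)} (f : Pow n X →ₗ[Q] Pow n X)
    (h : ∀ (a : Fin n → ℤ) (y : Fin n → Tot X), IsHomog a y → ∑ i, a i = m →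
      IsPar (fun i => (a i : ZMod 2)) y → f (PiTensorProduct.tprod Q y) ∈ S) :
    ∀ t ∈ powDeg n X m, f t ∈ S := by
  intro t ht
  have : powDeg n X m ≤ S.comap f := by
    refine Submodule.span_le.2 ?_
    rintro _ ⟨a, x, hm, rfl⟩
    exact h a _ (fun k => ⟨x k, rfl⟩) hm (isPar_inc a x)
  exact this ht

lemma permOp_mem {σ : Equiv.Perm (Fin n)} {m : ℤ} :
    ∀ t ∈ powDeg n X m, permOp n X σ t ∈ powDeg n X m := by
  refine powDeg_induction _ fun a y hy hm hp => ?_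
  rw [permOp_tprod σ hp]
  refine Submodule.smul_mem _ _ (tprod_mem_powDeg (a := fun i => a (σ i)) (fun k => hy (σ k)) ?_)
  rw [← hm, Equiv.sum_comp σ]

lemma IsHomog.update {a : Fin n → ℤ} {y : Fin n → Tot X} (h : IsHomog a y) (i : Fin n) (c : ℤ)
    (z : Tot X) (hz : z ∈ LinearMap.range (inc X (a i + c))) :
    IsHomog (Function.update a i (a i + c)) (Function.update y i z) := by
  intro k
  by_cases hk : k = i
  · subst hk; rw [Function.update_self, Function.update_self]; exact hz
  · rw [Function.update_of_ne hk, Function.update_of_ne hk]; exact h k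

lemma sum_update (a : Fin n → ℤ) (i : Fin n) (c : ℤ) :
    ∑ k, Function.update a i (a i + c) k = (∑ k, a k) + c := by
  rw [Finset.sum_update_of_mem (Finset.mem_univ i), ← Finset.add_sum_erase _ a (Finset.mem_univ i),
    Finset.sdiff_singleton_eq_erase]
  ring

lemma powD_mem {m : ℤ} : ∀ t ∈ powDeg n X m, powD n X t ∈ powDeg n X (m - 1) := by
  refine powDeg_induction _ fun a y hy hm hp => ?_
  rw [powD, LinearMap.sum_apply]
  refine Submodule.sum_mem _ fun i _ => ?_
  rw [powDAt_tprod i hp]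
  refine Submodule.smul_mem _ _ (tprod_mem_powDeg (hy.update i (-1) _ ?_) ?_)
  · obtain ⟨x, hx⟩ := hy i
    rw [← hx, totD_inc]
    exact ⟨_, rfl⟩
  · rw [sum_update, hm]; rfl

/-- The degree `m` part of the `c`-eigenspace of the `n`-cycle acting on the tensor power. -/
noncomputable def eigenDeg (n : ℕ) (X : ChainComplex (ModuleCat.{u} Q) ℤ) (c : Q) (m : ℤ) :
    Submodule Q (Pow n X) :=
  powDeg n X m ⊓ LinearMap.ker (permOp n X (finRotate n) - c • 1)

lemma mem_eigenDeg {c : Q} {m : ℤ} {t : Pow n X} :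
    t ∈ eigenDeg n X c m ↔ t ∈ powDeg n X m ∧ permOp n X (finRotate n) t = c • t := by
  simp [eigenDeg, sub_eq_zero]

lemma powD_mem_eigenDeg {c : Q} {m k : ℤ} (h : k + 1 = m) :
    ∀ t ∈ eigenDeg n X c m, powD n X t ∈ eigenDeg n X c k := by
  intro t ht
  obtain rfl : k = m - 1 := by omega
  rw [mem_eigenDeg] at ht ⊢
  refine ⟨powD_mem t ht.1, ?_⟩
  rw [← Module.End.mul_apply, permOp_powD, Module.End.mul_apply, ht.2, map_smul]

/-- The complex `T^n(X)^(c)`: the kernel of `σ - c` on the `n`-fold tensor power of `X`, where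
`σ` is the `n`-cycle `(1 2 ⋯ n)`. -/
noncomputable def eigenComplex (n : ℕ) (X : ChainComplex (ModuleCat.{u} Q) ℤ) (c : Q) :
    ChainComplex (ModuleCat.{u} Q) ℤ where
  X m := ModuleCat.of Q (eigenDeg n X c m)
  d m k := if h : k + 1 = m then
      ModuleCat.ofHom ((powD n X).restrict (powD_mem_eigenDeg h))
    else 0
  shape m k h := dif_neg h
  d_comp_d' m k l h h' := by
    have h1 : k + 1 = m := h
    have h2 : l + 1 = k := h'
    rw [dif_pos h1, dif_pos h2, ← ModuleCat.ofHom_comp]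
    refine ModuleCat.hom_ext (LinearMap.ext fun t => Subtype.ext ?_)
    exact LinearMap.congr_fun (powD_mul_self (X := X) (n := n)) t.1

end TensorPowers

section Perfect

variable {Q : Type u} [CommRing Q]

/-- Bounded complexes of finitely generated projective modules with homology supported on `Z`. -/
structure IsPerfectOn (Z : Set (PrimeSpectrum Q)) (X : ChainComplex (ModuleCat.{u} Q) ℤ) :
    Prop where
  finite : ∀ i, Module.Finite Q (X.X i)
  projective : ∀ i, Module.Projective Q (X.X i)
  bounded : ∃ a b : ℤ, ∀ i, (i < a ∨ b < i) → Subsingleton (X.X i)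
  support : ∀ i, Module.support Q (X.homology i) ⊆ Z

variable {X : ChainComplex (ModuleCat.{u} Q) ℤ} {n : ℕ}

lemma finRotate_pow_self : (finRotate n) ^ n = 1 := by
  rcases n with _ | n
  · rfl
  · ext1 i
    have : ∀ k : ℕ, ((finRotate (n + 1)) ^ k) i = i + k • (1 : Fin (n + 1)) := by
      intro k
      induction k with
      | zero => simp
      | succ k ih => rw [pow_succ', Equiv.Perm.mul_apply, ih, finRotate_apply, succ_nsmul, add_assoc]
    have h := card_nsmul_eq_zero (x := (1 : Fin (n + 1)))
    rw [Fintype.card_fin] at h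
    rw [this, h, add_zero]; rfl

lemma permOp_pow (σ : Equiv.Perm (Fin n)) (k : ℕ) : permOp n X σ ^ k = permOp n X (σ ^ k) := by
  induction k with
  | zero => simp [permOp_one]
  | succ k ih => rw [pow_succ, ih, permOp_mul, pow_succ']

/-- The projector onto the eigenspace. -/
noncomputable def eigenProj (n : ℕ) (X : ChainComplex (ModuleCat.{u} Q) ℤ) (c r : Q) :
    Pow n X →ₗ[Q] Pow n X :=
  r • ∑ k ∈ Finset.range n, (c ^ (n - 1) • permOp n X (finRotate n)) ^ k

lemma permOp_eigenProj [NeZero n] {c r : Q} (hc : c ^ n = 1) (t : Pow n X) :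
    permOp n X (finRotate n) (eigenProj n X c r t) = c • eigenProj n X c r t := by
  have hcc : c * c ^ (n - 1) = 1 := by rw [← pow_succ', Nat.sub_add_cancel NeZero.one_le, hc]
  have hA : (c ^ (n - 1) • permOp n X (finRotate n)) ^ n = 1 := by
    rw [smul_pow, permOp_pow, finRotate_pow_self, permOp_one, ← pow_mul, mul_comm, pow_mul, hc,
      one_pow, one_smul]
  have h1 : (c ^ (n - 1) • permOp n X (finRotate n)) *
      ∑ k ∈ Finset.range n, (c ^ (n - 1) • permOp n X (finRotate n)) ^ k =
      ∑ k ∈ Finset.range n, (c ^ (n - 1) • permOp n X (finRotate n)) ^ k := by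
    have := mul_geom_sum (R := Module.End Q (Pow n X)) (c ^ (n - 1) • permOp n X (finRotate n)) n
    rw [sub_mul (α := Module.End Q (Pow n X)), one_mul, hA, sub_self, sub_eq_zero] at this
    exact this
  have h2 : permOp n X (finRotate n) = c • (c ^ (n - 1) • permOp n X (finRotate n)) := by
    rw [smul_smul, hcc, one_smul]
  have h3 : permOp n X (finRotate n) * eigenProj n X c r = c • eigenProj n X c r := by
    rw [eigenProj, mul_smul_comm]
    nth_rewrite 1 [h2]
    rw [smul_mul_assoc, h1, smul_comm]
  exact LinearMap.congr_fun h3 t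

lemma eigenProj_mem [NeZero n] {c r : Q} (hc : c ^ n = 1) {m : ℤ} {t : Pow n X}
    (ht : t ∈ powDeg n X m) : eigenProj n X c r t ∈ eigenDeg n X c m := by
  refine mem_eigenDeg.2 ⟨?_, permOp_eigenProj hc t⟩
  rw [eigenProj, LinearMap.smul_apply, LinearMap.sum_apply]
  refine Submodule.smul_mem _ _ (Submodule.sum_mem _ fun k _ => ?_)
  rw [smul_pow, permOp_pow]
  exact Submodule.smul_mem _ _ (permOp_mem t ht)

lemma eigenProj_apply [NeZero n] {c r : Q} (hc : c ^ n = 1) (hr : r * n = 1) {m : ℤ} {t : Pow n X}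
    (ht : t ∈ eigenDeg n X c m) : eigenProj n X c r t = t := by
  have hcc : c ^ (n - 1) * c = 1 := by rw [← pow_succ, Nat.sub_add_cancel NeZero.one_le, hc]
  have h1 : (c ^ (n - 1) • permOp n X (finRotate n)) t = t := by
    rw [LinearMap.smul_apply, (mem_eigenDeg.1 ht).2, smul_smul, hcc, one_smul]
  have h2 : ∀ k : ℕ, ((c ^ (n - 1) • permOp n X (finRotate n)) ^ k) t = t := by
    intro k
    induction k with
    | zero => rfl
    | succ k ih => rw [pow_succ, Module.End.mul_apply, h1, ih]
  rw [eigenProj, LinearMap.smul_apply, LinearMap.sum_apply]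
  simp only [h2, Finset.sum_const, Finset.card_range]
  rw [← Nat.cast_smul_eq_nsmul Q, smul_smul, hr, one_smul]

lemma powD_eigenProj (c r : Q) : powD n X * eigenProj n X c r = eigenProj n X c r * powD n X := by
  rw [eigenProj, mul_smul_comm, smul_mul_assoc, Finset.mul_sum, Finset.sum_mul]
  congr 1
  refine Finset.sum_congr rfl fun k _ => ?_
  exact (((show Commute (powD n X) (permOp n X (finRotate n)) from
    (permOp_powD _).symm).smul_right _).pow_right k).eq

/-- The projection onto a homogeneous component. -/
noncomputable def degProj (X : ChainComplex (ModuleCat.{u} Q) ℤ) (i : ℤ) : Tot X →ₗ[Q] Tot X :=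
  inc X i ∘ₗ DirectSum.component Q ℤ (fun i => X.X i) i

lemma degProj_inc (i j : ℤ) (x : X.X j) :
    degProj X i (inc X j x) = if j = i then inc X j x else 0 := by
  simp only [degProj, inc, LinearMap.comp_apply, DirectSum.component.of]
  split_ifs with h
  · subst h; rfl
  · simp

/-- The projection onto a homogeneous component of the tensor power. -/
noncomputable def powDegProj (n : ℕ) (X : ChainComplex (ModuleCat.{u} Q) ℤ) (S : Finset ℤ) (m : ℤ) :
    Pow n X →ₗ[Q] Pow n X :=
  ∑ a ∈ Fintype.piFinset (fun _ : Fin n => S), if ∑ i, a i = m then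
    PiTensorProduct.map (fun i => degProj X (a i)) else 0

lemma powDegProj_tprod {S : Finset ℤ} (hS : ∀ i ∉ S, Subsingleton (X.X i)) (m : ℤ)
    (a : Fin n → ℤ) (x : ∀ i, X.X (a i)) :
    powDegProj n X S m (PiTensorProduct.tprod Q (fun i => inc X (a i) (x i))) =
      if ∑ i, a i = m then PiTensorProduct.tprod Q (fun i => inc X (a i) (x i)) else 0 := by
  rw [powDegProj, LinearMap.sum_apply]
  by_cases ha : ∀ i, a i ∈ S
  · rw [Finset.sum_eq_single a]
    · split_ifs
      · rw [PiTensorProduct.map_tprod]; simp only [degProj_inc, if_true]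
      · rfl
    · intro b _ hb
      obtain ⟨k, hk⟩ := Function.ne_iff.mp hb
      split_ifs
      · rw [PiTensorProduct.map_tprod]
        exact (PiTensorProduct.tprod Q).map_coord_zero k (by simp [degProj_inc, Ne.symm hk])
      · rfl
    · intro h; exact absurd (Fintype.mem_piFinset.2 ha) h
  · push Not at ha
    obtain ⟨k, hk⟩ := ha
    have := hS _ hk
    have h0 : PiTensorProduct.tprod Q (fun i => inc X (a i) (x i)) = 0 :=
      (PiTensorProduct.tprod Q).map_coord_zero k (by rw [Subsingleton.elim (x k) 0, map_zero])
    simp [h0]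

lemma powDegProj_mem {S : Finset ℤ} (hS : ∀ i ∉ S, Subsingleton (X.X i)) (m : ℤ) (t : Pow n X) :
    powDegProj n X S m t ∈ powDeg n X m := by
  have : (powDeg n X m).mkQ ∘ₗ powDegProj n X S m = 0 := by
    refine pow_ext fun a x => ?_
    rw [LinearMap.comp_apply, powDegProj_tprod hS, LinearMap.zero_apply, Submodule.mkQ_apply,
      Submodule.Quotient.mk_eq_zero]
    split_ifs with h
    · exact Submodule.subset_span ⟨a, x, h, rfl⟩
    · exact Submodule.zero_mem _
  have := LinearMap.congr_fun this t
  rwa [LinearMap.comp_apply, Submodule.mkQ_apply, LinearMap.zero_apply,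
    Submodule.Quotient.mk_eq_zero] at this

lemma powDegProj_apply {S : Finset ℤ} (hS : ∀ i ∉ S, Subsingleton (X.X i)) {m : ℤ} {t : Pow n X}
    (ht : t ∈ powDeg n X m) : powDegProj n X S m t = t := by
  have : powDeg n X m ≤ LinearMap.eqLocus (powDegProj n X S m) LinearMap.id := by
    refine Submodule.span_le.2 ?_
    rintro _ ⟨a, x, hm, rfl⟩
    simp [powDegProj_tprod hS, hm]
  exact this ht

lemma finite_tot {S : Finset ℤ} (hS : ∀ i ∉ S, Subsingleton (X.X i))
    (hf : ∀ i, Module.Finite Q (X.X i)) : Module.Finite Q (Tot X) := by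
  refine Module.Finite.of_surjective
    (∑ i : S, inc X i ∘ₗ LinearMap.proj (R := Q) (φ := fun i : S => X.X i) i) fun t => ?_
  refine ⟨fun i => t i, ?_⟩
  have h : ∑ i ∈ S, degProj X i = LinearMap.id := by
    refine DirectSum.linearMap_ext Q fun j => LinearMap.ext fun x => ?_
    rw [LinearMap.comp_apply, LinearMap.sum_apply]
    simp only [degProj_inc, Finset.sum_ite_eq, LinearMap.comp_apply, LinearMap.id_apply]
    split_ifs with hj
    · rfl
    · have := hS j hj
      rw [Subsingleton.elim x 0, map_zero]
  have h' := LinearMap.congr_fun h t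
  rw [LinearMap.sum_apply, ← Finset.sum_coe_sort] at h'
  rw [LinearMap.sum_apply]
  exact h'

lemma projective_pow (hp : Module.Projective Q (Tot X)) : Module.Projective Q (Pow n X) := by
  obtain ⟨s, hs⟩ := hp
  have : Module.Projective Q (⨂[Q] _ : Fin n, (Tot X →₀ Q)) :=
    Module.Projective.of_basis (Basis.piTensorProduct fun _ => Finsupp.basisSingleOne)
  refine Module.Projective.of_split (M := ⨂[Q] _ : Fin n, (Tot X →₀ Q))
    (PiTensorProduct.map fun _ => s)
    (PiTensorProduct.map fun _ => Finsupp.linearCombination Q id) ?_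
  rw [← PiTensorProduct.map_comp]
  have : Finsupp.linearCombination Q id ∘ₗ s = LinearMap.id := LinearMap.ext hs
  simp only [this, PiTensorProduct.map_id]

lemma exists_boundary {i : ℤ} {P : PrimeSpectrum Q} (hP : P ∉ Module.support Q (X.homology i))
    (z : X.X i) (hz : (X.d i (i - 1)).hom z = 0) :
    ∃ r ∉ P.asIdeal, ∃ w : X.X (i + 1), (X.d (i + 1) i).hom w = r • z := by
  let S := X.sc' (i + 1) i (i - 1)
  let e : X.homology i ≅ S.moduleCatLeftHomologyData.H :=
    X.homologyIsoSc' (i + 1) i (i - 1) (by simp) (by simp) ≪≫ S.moduleCatHomologyIso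
  have hP' : P ∉ Module.support Q S.moduleCatLeftHomologyData.H := by
    rwa [← (e.toLinearEquiv).support_eq]
  change P ∉ Module.support Q
      (LinearMap.ker S.g.hom ⧸ LinearMap.range S.moduleCatToCycles) at hP'
  rw [Module.mem_support_iff'] at hP'
  push Not at hP'
  obtain ⟨r, hr, h⟩ := hP' (Submodule.Quotient.mk ⟨z, hz⟩)
  rw [← Submodule.Quotient.mk_smul, Submodule.Quotient.mk_eq_zero] at h
  obtain ⟨w, hw⟩ := h
  exact ⟨r, hr, w, congrArg Subtype.val hw⟩

lemma totD_inc' {i j : ℤ} (h : j + 1 = i) (x : X.X i) :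
    totD X (inc X i x) = inc X j ((X.d i j).hom x) := by
  obtain rfl : j = i - 1 := by omega
  exact totD_inc i x

lemma inc_injective (i : ℤ) : Function.Injective (inc X i) :=
  DirectSum.of_injective (β := fun i => X.X i) i

lemma exists_partial_contraction (hf : ∀ i, Module.Finite Q (X.X i))
    (hp : ∀ i, Module.Projective Q (X.X i)) {a : ℤ} (ha : ∀ i < a, Subsingleton (X.X i))
    {P : PrimeSpectrum Q} (hP : ∀ i, P ∉ Module.support Q (X.homology i)) (N : ℕ) :
    ∃ r ∉ P.asIdeal, ∃ h : Tot X →ₗ[Q] Tot X,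
      (∀ i x, h (inc X i x) ∈ LinearMap.range (inc X (i + 1))) ∧
      ∀ i < a + N, ∀ x, totD X (h (inc X i x)) + h (totD X (inc X i x)) = r • inc X i x := by
  induction N with
  | zero =>
    refine ⟨1, P.2.one_notMem, 0, by simp, fun i hi x => ?_⟩
    have := ha i (by simpa using hi)
    rw [Subsingleton.elim x 0]; simp
  | succ N ih =>
    obtain ⟨r, hr, h, hh, H⟩ := ih
    obtain ⟨i, hi⟩ : ∃ i, i = a + N := ⟨_, rfl⟩
    rw [← hi] at H
    let φ : X.X i →ₗ[Q] X.X i := r • LinearMap.id -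
      DirectSum.component Q ℤ (fun i => X.X i) i ∘ₗ h ∘ₗ totD X ∘ₗ inc X i
    have hφ : ∀ x, inc X i (φ x) = r • inc X i x - h (totD X (inc X i x)) := by
      intro x
      rw [totD_inc' (sub_add_cancel i 1)]
      obtain ⟨y, hy⟩ := hh (i - 1) ((X.d i (i - 1)).hom x)
      have hy' : ∃ y', inc X i y' = h (inc X (i - 1) ((X.d i (i - 1)).hom x)) := by
        rw [← hy]
        generalize hk : i - 1 + 1 = k at y
        obtain rfl : k = i := by omega
        exact ⟨y, rfl⟩
      obtain ⟨y', hy'⟩ := hy'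
      rw [← hy']
      simp only [φ, LinearMap.sub_apply, LinearMap.comp_apply, map_sub, LinearMap.smul_apply,
        LinearMap.id_apply, map_smul]
      rw [totD_inc' (sub_add_cancel i 1), ← hy', DirectSum.component.lof_self]
    have hd : ∀ x, (X.d i (i - 1)).hom (φ x) = 0 := by
      intro x
      apply inc_injective (i - 1)
      rw [← totD_inc, hφ, map_sub, map_smul, map_zero, totD_inc]
      have h1 := H (i - 1) (by omega) ((X.d i (i - 1)).hom x)
      have h2 := LinearMap.congr_fun (totD_mul_totD (X := X)) (inc X i x)
      rw [Module.End.mul_apply, totD_inc, LinearMap.zero_apply] at h2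
      rw [h2, map_zero, add_zero] at h1
      rw [h1, sub_self]
    obtain ⟨s, hs, hsφ⟩ : ∃ s ∉ P.asIdeal, ∀ x, s • φ x ∈ LinearMap.range (X.d (i + 1) i).hom := by
      choose c hc w hw using fun x => exists_boundary (hP i) (φ x) (hd x)
      obtain ⟨T, hT⟩ := (hf i).fg_top
      refine ⟨∏ x ∈ T, c x, fun h => ?_, fun x => ?_⟩
      · obtain ⟨x, _, hx⟩ := P.2.prod_mem_iff.1 h
        exact hc x hx
      · have : Submodule.span Q (T : Set (X.X i)) ≤
            (LinearMap.range (X.d (i + 1) i).hom).comap ((∏ x ∈ T, c x) • φ) := by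
          refine Submodule.span_le.2 fun x hx => ?_
          obtain ⟨c', hc'⟩ := Finset.dvd_prod_of_mem c hx
          refine ⟨c' • w x, ?_⟩
          rw [map_smul, hw, smul_smul, mul_comm, ← hc']; rfl
        rw [hT] at this
        exact this (Submodule.mem_top (x := x))
    obtain ⟨g, hg⟩ := Module.projective_lifting_property (X.d (i + 1) i).hom.rangeRestrict
      ((s • φ).codRestrict _ hsφ) (LinearMap.surjective_rangeRestrict _)
    have hg' : ∀ x, (X.d (i + 1) i).hom (g x) = s • φ x := fun x =>
      congrArg Subtype.val (LinearMap.congr_fun hg x)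
    let h' : Tot X →ₗ[Q] Tot X := s • (h ∘ₗ (LinearMap.id - degProj X i)) +
      inc X (i + 1) ∘ₗ g ∘ₗ DirectSum.component Q ℤ (fun i => X.X i) i
    have hne : ∀ j ≠ i, ∀ x, h' (inc X j x) = s • h (inc X j x) := by
      intro j hj x
      simp [h', degProj_inc, hj, inc, DirectSum.component.of]
    have heq : ∀ x, h' (inc X i x) = inc X (i + 1) (g x) := by
      intro x
      simp [h', degProj_inc, inc, DirectSum.component.lof_self]
    refine ⟨s * r, fun hsr => (P.2.mem_or_mem hsr).elim hs hr, h', fun j x => ?_, fun j hj x => ?_⟩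
    · by_cases hji : j = i
      · subst hji; rw [heq]; exact ⟨_, rfl⟩
      · rw [hne j hji]; exact Submodule.smul_mem _ _ (hh j x)
    · have e1 : h' (totD X (inc X j x)) = s • h (totD X (inc X j x)) := by
        rw [totD_inc, hne _ (by push_cast at hj; omega)]
      rw [e1]
      by_cases hji : j = i
      · subst hji
        rw [heq, totD_inc' rfl, hg', map_smul, hφ, ← smul_add, sub_add_cancel, smul_smul]
      · rw [hne j hji, map_smul, ← smul_add, H j (by push_cast at hj; omega), smul_smul]

lemma exists_contraction {Z : Set (PrimeSpectrum Q)} (hX : IsPerfectOn Z X) {P : PrimeSpectrum Q}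
    (hP : P ∉ Z) :
    ∃ r ∉ P.asIdeal, ∃ h : Tot X →ₗ[Q] Tot X,
      (∀ i x, h (inc X i x) ∈ LinearMap.range (inc X (i + 1))) ∧
      totD X * h + h * totD X = r • 1 := by
  obtain ⟨a, b, hab⟩ := hX.bounded
  obtain ⟨r, hr, h, hh, H⟩ := exists_partial_contraction hX.finite hX.projective
    (fun i hi => hab i (.inl hi)) (fun i hi => hP (hX.support i hi)) (b + 1 - a).toNat
  refine ⟨r, hr, h, hh, DirectSum.linearMap_ext Q fun i => LinearMap.ext fun x => ?_⟩
  by_cases hi : b < i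
  · have := hab i (.inr hi)
    rw [Subsingleton.elim x 0]; simp
  · exact H i (by omega) x

/-- A contraction of `X`, applied in the first tensor factor. -/
noncomputable def powH (n : ℕ) [NeZero n] (h : Tot X →ₗ[Q] Tot X) : Pow n X →ₗ[Q] Pow n X :=
  PiTensorProduct.map (Function.update 1 0 h)

lemma powH_mem [NeZero n] {h : Tot X →ₗ[Q] Tot X}
    (hh : ∀ i x, h (inc X i x) ∈ LinearMap.range (inc X (i + 1))) {m : ℤ} :
    ∀ t ∈ powDeg n X m, powH n h t ∈ powDeg n X (m + 1) := by
  refine powDeg_induction _ fun a y hy hm _ => ?_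
  have : (fun i => (Function.update (1 : Fin n → (Tot X →ₗ[Q] Tot X)) 0 h i) (y i)) =
      Function.update y 0 (h (y 0)) := by
    ext1 i
    by_cases hi : i = 0
    · subst hi; simp
    · simp [hi]
  rw [powH, PiTensorProduct.map_tprod, this]
  refine tprod_mem_powDeg (hy.update 0 1 _ ?_) ?_
  · obtain ⟨x, hx⟩ := hy 0
    rw [← hx]; exact hh _ _
  · rw [sum_update, hm]

lemma eps_mul_of_degree_one {h : Tot X →ₗ[Q] Tot X}
    (hh : ∀ i x, h (inc X i x) ∈ LinearMap.range (inc X (i + 1))) :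
    eps X * h = -(h * eps X) := by
  refine DirectSum.linearMap_ext Q fun i => LinearMap.ext fun x => ?_
  obtain ⟨y, hy⟩ := hh i x
  simp only [LinearMap.comp_apply, Module.End.mul_apply, eps_inc, LinearMap.neg_apply, map_smul,
    ← hy]
  rw [← neg_smul, ← Int.cast_neg]
  congr 2
  push_cast
  generalize (i : ZMod 2) = b
  revert b; decide

lemma powD_powH [NeZero n] {h : Tot X →ₗ[Q] Tot X} {r : Q}
    (hh : ∀ i x, h (inc X i x) ∈ LinearMap.range (inc X (i + 1)))
    (H : totD X * h + h * totD X = r • 1) :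
    powD n X * powH n h + powH n h * powD n X = r • 1 := by
  rw [powD, Finset.sum_mul, Finset.mul_sum, ← Finset.sum_add_distrib, Finset.sum_eq_single 0]
  · rw [powDAt, powH, ← PiTensorProduct.map_mul, ← PiTensorProduct.map_mul, map_add_map 0]
    · simp only [Fin.not_lt_zero, if_false, if_true, Function.update_self, H]
      rw [PiTensorProduct.map_update_smul]
      congr 1
      rw [← PiTensorProduct.map_one]
      congr 1
      ext1 j
      by_cases hj : j = 0
      · subst hj; simp
      · simp [hj]
    · intro j hj
      simp [hj]
  · intro i _ hi
    have hi' : 0 < i := Nat.pos_of_ne_zero fun h => hi (Fin.ext h)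
    rw [powDAt, powH, ← PiTensorProduct.map_mul, ← PiTensorProduct.map_mul, map_add_map 0]
    · exact map_eq_zero 0 (by simp [hi', eps_mul_of_degree_one hh])
    · intro j hj
      simp [hj]
  · simp

lemma support_subset_of_homotopy {Z : Set (PrimeSpectrum Q)}
    {K : ChainComplex (ModuleCat.{u} Q) ℤ}
    (h : ∀ P ∉ Z, ∃ r ∉ P.asIdeal, Nonempty (Homotopy (r • 𝟙 K) 0)) (i : ℤ) :
    Module.support Q (K.homology i) ⊆ Z := by
  intro P hP
  by_contra hPZ
  obtain ⟨r, hr, ⟨H⟩⟩ := h P hPZ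
  obtain ⟨m, hm⟩ := Module.mem_support_iff'.1 hP
  refine hm r hr ?_
  have h1 := H.homologyMap_eq i
  have h2 : HomologicalComplex.homologyMap (r • 𝟙 K) i = r • 𝟙 (K.homology i) := by
    have := ShortComplex.homologyMap_smul (𝟙 (K.sc i)) r
    rw [ShortComplex.homologyMap_id] at this
    exact this
  rw [h2, HomologicalComplex.homologyMap_zero] at h1
  exact congrArg (fun f => f.hom m) h1

lemma isPerfectOn_eigenComplex [NeZero n] {Z : Set (PrimeSpectrum Q)} (hX : IsPerfectOn Z X)
    {c : Q} (hc : c ^ n = 1) (hn : IsUnit (n : Q)) : IsPerfectOn Z (eigenComplex n X c) := by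
  obtain ⟨r, hr⟩ := hn.exists_left_inv
  obtain ⟨a, b, hab⟩ := hX.bounded
  have hS : ∀ i ∉ Finset.Icc a b, Subsingleton (X.X i) := by
    intro i hi
    refine hab i ?_
    rw [Finset.mem_Icc] at hi
    omega
  have := finite_tot hS hX.finite
  have hpr := hX.projective
  have := projective_pow (n := n) (X := X) inferInstance
  let pr (m : ℤ) : Pow n X →ₗ[Q] eigenDeg n X c m :=
    (eigenProj n X c r ∘ₗ powDegProj n X (Finset.Icc a b) m).codRestrict _
      fun t => eigenProj_mem hc (powDegProj_mem hS m t)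
  have hpr : ∀ m, pr m ∘ₗ (eigenDeg n X c m).subtype = LinearMap.id := by
    intro m
    refine LinearMap.ext fun t => Subtype.ext ?_
    change eigenProj n X c r (powDegProj n X (Finset.Icc a b) m t.1) = t.1
    rw [powDegProj_apply hS t.2.1, eigenProj_apply hc hr t.2]
  refine ⟨fun m => ?_, fun m => ?_, ⟨n * a, n * b, fun m hm => ?_⟩, support_subset_of_homotopy ?_⟩
  · change Module.Finite Q (eigenDeg n X c m)
    exact Module.Finite.of_surjective (pr m) (LinearMap.surjective_of_comp_eq_id _ _ (hpr m))
  · change Module.Projective Q (eigenDeg n X c m)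
    exact Module.Projective.of_split _ _ (hpr m)
  · have h0 : powDeg n X m = ⊥ := by
      refine Submodule.span_eq_bot.2 ?_
      rintro _ ⟨d, x, hd, rfl⟩
      by_cases hk : ∃ k, d k < a ∨ b < d k
      · obtain ⟨k, hk⟩ := hk
        have := hab _ hk
        exact (PiTensorProduct.tprod Q).map_coord_zero k (by rw [Subsingleton.elim (x k) 0, map_zero])
      · push Not at hk
        have h1 := Finset.card_nsmul_le_sum Finset.univ d a (fun k _ => (hk k).1)
        have h2 := Finset.sum_le_card_nsmul Finset.univ d b (fun k _ => (hk k).2)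
        simp only [Finset.card_univ, Fintype.card_fin, nsmul_eq_mul, hd] at h1 h2
        omega
    have : eigenDeg n X c m = ⊥ := by rw [eigenDeg, h0, bot_inf_eq]
    change Subsingleton (eigenDeg n X c m)
    rw [this]
    infer_instance
  · intro P hP
    obtain ⟨s, hs, h, hh, H⟩ := exists_contraction hX hP
    have HH := powD_powH (n := n) hh H
    refine ⟨s, hs, ⟨?_⟩⟩
    have hmem : ∀ m : ℤ, ∀ t ∈ eigenDeg n X c m,
        eigenProj n X c r (powH n h t) ∈ eigenDeg n X c (m + 1) := fun m t ht =>
      eigenProj_mem hc (powH_mem hh t ht.1)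
    let hom : ∀ i j : ℤ, (eigenComplex n X c).X i ⟶ (eigenComplex n X c).X j := fun i j =>
      if hij : i + 1 = j then ModuleCat.ofHom
        ((eigenProj n X c r ∘ₗ powH n h).restrict (fun t ht => by subst hij; exact hmem i t ht))
      else 0
    refine { hom := hom, zero := fun i j hij => dif_neg hij, comm := fun i => ?_ }
    rw [dNext_eq hom (show (ComplexShape.down ℤ).Rel i (i - 1) by simp),
      prevD_eq hom (show (ComplexShape.down ℤ).Rel (i + 1) i by simp)]
    refine ModuleCat.hom_ext (LinearMap.ext fun t => Subtype.ext ?_)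
    have e1 : hom (i - 1) i = ModuleCat.ofHom ((eigenProj n X c r ∘ₗ powH n h).restrict
        (fun t ht => by simpa using hmem (i - 1) t ht)) := dif_pos (by ring)
    have e2 : hom i (i + 1) = ModuleCat.ofHom ((eigenProj n X c r ∘ₗ powH n h).restrict
        (hmem i)) := dif_pos rfl
    have e3 : (eigenComplex n X c).d i (i - 1) = ModuleCat.ofHom
        ((powD n X).restrict (powD_mem_eigenDeg (by ring))) := dif_pos (by ring)
    have e4 : (eigenComplex n X c).d (i + 1) i = ModuleCat.ofHom
        ((powD n X).restrict (powD_mem_eigenDeg (by ring))) := dif_pos (by ring)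
    rw [e1, e2, e3, e4]
    change s • t.1 = eigenProj n X c r (powH n h (powD n X t.1)) +
      powD n X (eigenProj n X c r (powH n h t.1)) + 0
    have h1 := LinearMap.congr_fun (powD_eigenProj (X := X) (n := n) c r) (powH n h t.1)
    have h2 := LinearMap.congr_fun HH t.1
    simp only [Module.End.mul_apply, LinearMap.add_apply, LinearMap.smul_apply,
      Module.End.one_apply] at h1 h2
    rw [h1, ← map_add, add_comm (powH n h _), h2, map_smul, eigenProj_apply hc hr t.2, add_zero]

end Perfect
section CyclotomicRings

/-- The subring `ℤ[e^(2πi/n)]` of `ℂ`. -/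
noncomputable def cycloInt (n : ℕ) : Subalgebra ℤ ℂ :=
  Algebra.adjoin ℤ {Complex.exp (2 * Real.pi * Complex.I / n)}

/-- The subring `A_n = ℤ[1/n, e^(2πi/n)]` of `ℂ`. -/
noncomputable def cycloRing (n : ℕ) : Subalgebra ℤ ℂ :=
  Algebra.adjoin ℤ {(n : ℂ)⁻¹, Complex.exp (2 * Real.pi * Complex.I / n)}

/-- The root of unity `e^(2πi/n)` in `ℤ[e^(2πi/n)]`. -/
noncomputable def zetaInt (n : ℕ) : cycloInt n :=
  ⟨Complex.exp (2 * Real.pi * Complex.I / n), Algebra.subset_adjoin (by simp)⟩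

/-- The root of unity `e^(2πi/n)` in `A_n`. -/
noncomputable def zeta (n : ℕ) : cycloRing n :=
  ⟨Complex.exp (2 * Real.pi * Complex.I / n), Algebra.subset_adjoin (by simp)⟩

/-- The element `1/n` of `A_n`. -/
noncomputable def invNat (n : ℕ) : cycloRing n := ⟨(n : ℂ)⁻¹, Algebra.subset_adjoin (by simp)⟩

lemma zeta_pow (n : ℕ) [NeZero n] : zeta n ^ n = 1 :=
  Subtype.ext (Complex.isPrimitiveRoot_exp n (NeZero.ne n)).pow_eq_one

lemma invNat_mul (n : ℕ) [NeZero n] : invNat n * n = 1 := by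
  refine Subtype.ext ?_
  have : (n : ℂ) ≠ 0 := Nat.cast_ne_zero.2 (NeZero.ne n)
  simp [invNat, this]

lemma cycloRing_le {m n : ℕ} [NeZero n] (h : m ∣ n) : cycloRing m ≤ cycloRing n := by
  obtain ⟨k, hk⟩ := h
  have hn : (n : ℂ) ≠ 0 := Nat.cast_ne_zero.2 (NeZero.ne n)
  have hk' : (n : ℂ) = m * k := by rw [hk]; push_cast; rfl
  have hm : (m : ℂ) ≠ 0 := fun h => hn (by rw [hk', h, zero_mul])
  have hk0 : (k : ℂ) ≠ 0 := fun h => hn (by rw [hk', h, mul_zero])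
  refine Algebra.adjoin_le ?_
  rintro x (rfl | rfl)
  · have : (m : ℂ)⁻¹ = ((k : cycloRing n) * invNat n : cycloRing n) := by
      simp only [invNat, MulMemClass.coe_mul, SubringClass.coe_natCast, hk']
      field_simp
    rw [this]
    exact Subtype.property _
  · have : Complex.exp (2 * Real.pi * Complex.I / m) = (zeta n ^ k : cycloRing n) := by
      simp only [zeta, SubmonoidClass.coe_pow, ← Complex.exp_nat_mul, hk']
      congr 1
      field_simp
    rw [this]
    exact Subtype.property _

/-- An `A_n`-algebra is an `A_m`-algebra for each divisor `m` of `n`, through the inclusion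
`A_m ⊆ A_n`. -/
noncomputable def restrictCyclo (Q : Type u) [CommRing Q] {m n : ℕ} [NeZero n]
    [Algebra (cycloRing n) Q] (h : m ∣ n) : cycloRing m →+* Q :=
  (algebraMap (cycloRing n) Q).comp (Subalgebra.inclusion (cycloRing_le h)).toRingHom

end CyclotomicRings

section AdamsOperations

variable {Q : Type u} [CommRing Q]

/-- The objects of `𝒫^Z(Q)`. -/
abbrev PerfComplex (Z : Set (PrimeSpectrum Q)) : Type (u + 1) :=
  {X : ChainComplex (ModuleCat.{u} Q) ℤ // IsPerfectOn Z X}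

/-- The relations defining `K₀^Z(Q)`: `[X] = [X'] + [X'']` for each short exact sequence
`0 → X' → X → X'' → 0`, and `[X] = [Y]` for each quasi-isomorphism `X → Y`. -/
def k0Relations (Z : Set (PrimeSpectrum Q)) : Set (FreeAbelianGroup (PerfComplex Z)) :=
  {r | ∃ (X' X X'' : PerfComplex Z) (f : X'.1 ⟶ X.1) (g : X.1 ⟶ X''.1) (w : f ≫ g = 0),
      (ShortComplex.mk f g w).ShortExact ∧
      r = FreeAbelianGroup.of X - (FreeAbelianGroup.of X' + FreeAbelianGroup.of X'')} ∪
  {r | ∃ (X Y : PerfComplex Z) (f : X.1 ⟶ Y.1), QuasiIso f ∧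
      r = FreeAbelianGroup.of X - FreeAbelianGroup.of Y}

/-- The Grothendieck group `K₀^Z(Q)`. -/
abbrev K0 (Z : Set (PrimeSpectrum Q)) : Type (u + 1) :=
  FreeAbelianGroup (PerfComplex Z) ⧸ AddSubgroup.closure (k0Relations Z)

/-- The class `[X]` in `K₀^Z(Q)`. -/
def K0.cls {Z : Set (PrimeSpectrum Q)} (X : PerfComplex Z) : K0 Z :=
  QuotientAddGroup.mk (FreeAbelianGroup.of X)

/-- The object `T^n(X)^(ζ)` of `𝒫^Z(Q)`, for `ζ` the image in `Q` of `e^(2πik/n)`. -/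
noncomputable def eigenObj {n : ℕ} [NeZero n] (ρ : cycloRing n →+* Q)
    {Z : Set (PrimeSpectrum Q)} (k : ℕ) (X : PerfComplex Z) : PerfComplex Z :=
  ⟨eigenComplex n X.1 (ρ (zeta n) ^ k), isPerfectOn_eigenComplex X.2
    (by rw [← pow_mul, mul_comm, pow_mul, ← map_pow, zeta_pow, map_one, one_pow])
    (IsUnit.of_mul_eq_one_right (ρ (invNat n)) (by
      rw [← map_natCast ρ, ← map_mul, invNat_mul, map_one]))⟩

/-- The sum `∑ ζ, ζ [T^n(X)^(ζ)]` in `K₀^Z(Q) ⊗ ℤ[e^(2πi/n)]`, over all `n`-th roots of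
unity `ζ = e^(2πik/n)`, for an `A_n`-algebra `Q` with structure map `ρ`. -/
noncomputable def cyclicSum {n : ℕ} [NeZero n] (ρ : cycloRing n →+* Q)
    {Z : Set (PrimeSpectrum Q)} (X : PerfComplex Z) : K0 Z ⊗[ℤ] cycloInt n :=
  ∑ k ∈ Finset.range n, K0.cls (eigenObj ρ k X) ⊗ₜ[ℤ] (zetaInt n ^ k)

/-- The property that characterizes the cyclic Adams operation:
`Ψ([X]) = ∑ ζ, ζ [T^n(X)^(ζ)]` for all objects `X`, with `K₀^Z(Q)` viewed inside
`K₀^Z(Q) ⊗ ℤ[e^(2πi/n)]` through `a ↦ a ⊗ 1`. -/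
def IsCyclicAdams {n : ℕ} [NeZero n] (ρ : cycloRing n →+* Q) (Z : Set (PrimeSpectrum Q))
    (Ψ : K0 Z → K0 Z) : Prop :=
  ∀ X : PerfComplex Z, Ψ (K0.cls X) ⊗ₜ[ℤ] (1 : cycloInt n) = cyclicSum ρ X

/-- The cyclic Adams operation `Ψ^n` on `K₀^Z(Q)`: its value at `a` is the element `b` such that
`b = ∑ ζ, ζ [T^n(X)^(ζ)]` for every object `X` that represents `a`. -/
noncomputable def cyclicAdams {n : ℕ} [NeZero n] (ρ : cycloRing n →+* Q)
    (Z : Set (PrimeSpectrum Q)) (a : K0 Z) : K0 Z :=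
  Classical.epsilon fun b => ∀ X : PerfComplex Z, K0.cls X = a →
    b ⊗ₜ[ℤ] (1 : cycloInt n) = cyclicSum ρ X

end AdamsOperations

end CyclicAdams

/-! Write `T^n(X)^(c)` for the eigencomplexes. Three facts about their classes carry the proof.

Free orbits cancel. Suppose the graded module of a complex is a direct sum indexed by `J`. Its
`p`-th tensor power is then a sum over functions `f : Fin p → J`, and the `p`-cycle permutes the
summands by rotating `f`. For `p` prime, a rotation fixes only constant functions. On the
nonconstant part, multiplying the summand `f` by a suitable power of `c` identifies the eigenspace
for `1` with that for `c` (`dgClass_weightDeg_nonconst`). This part thus contributes a class `N`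
that does not depend on `c`, and `∑ ζ ⊗ N = 0` removes it. For a short exact sequence, the middle
complex is degreewise a direct sum with a triangular differential. Filtering its tensor power by the
number of factors from the quotient gives `dgClass_eigenDeg_shortExact`, so the sum `∑ ζ
[T^p(X)^(ζ)]` is additive. It vanishes on acyclic complexes, because eigencomplexes of these are
acyclic. By mapping cones this suffices to descend to `K₀` (`K0.exists_lift`).

Galois symmetry. Multiplication by `j` prime to `n` on `ℤ/n` conjugates the `n`-cycle to its `j`-th
power, so `T^n(X)^(c)` and `T^n(X)^(c^j)` have the same class (`dgClass_eigenDeg_pow`). For prime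
`p` the sum therefore collapses to `[T^p(X)^(1)] - [T^p(X)^(ζ)]`, an element of `K₀`
(`cyclicSum_eq_tmul_one`). Uniqueness holds because `a ↦ a ⊗ 1` is injective and because every
element of `K₀` is the class of an object, negatives being given by shifts.

Composition. By the Chinese remainder theorem the `pq`-cycle is conjugate to the product of the
rotation of `p` blocks and the simultaneous rotation of the `q` letters in every block. Identify
`T^{pq}(X)` with `T^p(T^q(X))` and decompose `T^q(X)` into eigencomplexes for the powers of a `q`-th
root of unity `ξ`. The joint eigenspace with letter eigenvalue `ξ^{pj}` is the sum over the
functions `f` with `∑ f = pj` in `ℤ/q`. Its only constant `f` is `j`, since `p` is invertible modulo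
`q`. Hence its class is that of `T^p(T^q(X)^(ξ^j))^(c)` up to a term independent of `c`
(`exists_dgClass_pairDeg`). Summing over `c` gives `Ψ^p` of `[T^q(X)^(ξ^j)]`, which equals
`[T^q(X)^(ξ^{pj})]` by Galois symmetry, and summing over `j` gives `Ψ^p Ψ^q` (`cyclicSum_eq_comp`).
The sum over `pq`-th roots of unity is symmetric in `p` and `q`, so the operations commute. -/

namespace CyclicAdams

/-! ### Perfect complexes, and classes of complexes cut out of a module with a differential -/

section DG

variable {Q : Type u} [CommRing Q]

lemma shortExact_of_elements {A B C : ChainComplex (ModuleCat.{u} Q) ℤ} (f : A ⟶ B) (g : B ⟶ C)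
    (w : f ≫ g = 0) (hinj : ∀ i x, (f.f i).hom x = 0 → x = 0)
    (hsurj : ∀ i y, ∃ x, (g.f i).hom x = y)
    (hex : ∀ i y, (g.f i).hom y = 0 → ∃ x, (f.f i).hom x = y) :
    (ShortComplex.mk f g w).ShortExact := by
  refine HomologicalComplex.shortExact_of_degreewise_shortExact _ fun i => ?_
  exact
    { mono_f := (ModuleCat.mono_iff_injective (f.f i)).2
        ((injective_iff_map_eq_zero (f.f i).hom).2 (hinj i))
      epi_g := (ModuleCat.epi_iff_surjective (g.f i)).2 (hsurj i)
      exact := (ShortComplex.moduleCat_exact_iff _).2 (hex i) }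

section ShortExactElements

variable {A B C : ChainComplex (ModuleCat.{u} Q) ℤ} {f : A ⟶ B} {g : B ⟶ C} {w : f ≫ g = 0}

lemma degree_injective (h : (ShortComplex.mk f g w).ShortExact) (i : ℤ) :
    Function.Injective (f.f i).hom :=
  ((HomologicalComplex.shortExact_iff_degreewise_shortExact _).1 h i).moduleCat_injective_f

lemma degree_surjective (h : (ShortComplex.mk f g w).ShortExact) (i : ℤ) :
    Function.Surjective (g.f i).hom :=
  ((HomologicalComplex.shortExact_iff_degreewise_shortExact _).1 h i).moduleCat_surjective_g

lemma degree_exact (h : (ShortComplex.mk f g w).ShortExact) (i : ℤ) :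
    Function.Exact (f.f i).hom (g.f i).hom :=
  (ShortComplex.ShortExact.moduleCat_exact_iff_function_exact _).1
    ((HomologicalComplex.shortExact_iff_degreewise_shortExact _).1 h i).exact

end ShortExactElements

/-- Since `C` is degreewise projective the sequence splits in each degree, which settles everything
but the support. For that, exactness of homology in the middle is enough: a class killed by `r` in
the homology of `C` comes, after multiplication by `r`, from that of `A`, where some `s` outside the
prime kills it. -/
lemma IsPerfectOn.of_shortExact {Z : Set (PrimeSpectrum Q)}
    {A B C : ChainComplex (ModuleCat.{u} Q) ℤ} {f : A ⟶ B} {g : B ⟶ C} {w : f ≫ g = 0}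
    (h : (ShortComplex.mk f g w).ShortExact) (hA : IsPerfectOn Z A) (hC : IsPerfectOn Z C) :
    IsPerfectOn Z B := by
  have hsplit : ∀ i, Nonempty ((A.X i × C.X i) ≃ₗ[Q] B.X i) := by
    intro i
    have := hC.projective i
    obtain ⟨s, hs⟩ := Module.projective_lifting_property (g.f i).hom LinearMap.id
      (degree_surjective h i)
    obtain ⟨e, -⟩ := (degree_exact h i).splitSurjectiveEquiv (degree_injective h i) ⟨s, hs⟩
    exact ⟨e.symm⟩
  refine ⟨fun i => ?_, fun i => ?_, ?_, fun i => ?_⟩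
  · have := hA.finite i
    have := hC.finite i
    exact Module.Finite.equiv (hsplit i).some
  · have := hA.projective i
    have := hC.projective i
    exact Module.Projective.of_equiv (hsplit i).some
  · obtain ⟨a, b, hab⟩ := hA.bounded
    obtain ⟨c, d, hcd⟩ := hC.bounded
    refine ⟨min a c, max b d, fun i hi => ?_⟩
    have := hab i (by omega)
    have := hcd i (by omega)
    exact (hsplit i).some.symm.toEquiv.subsingleton
  · intro P hP
    by_contra hPZ
    have h1 : P ∉ Module.support Q (A.homology i) := fun hh => hPZ (hA.support i hh)
    have h2 : P ∉ Module.support Q (C.homology i) := fun hh => hPZ (hC.support i hh)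
    have hex := (ShortComplex.moduleCat_exact_iff _).1 (h.homology_exact₂ i)
    rw [Module.mem_support_iff'] at hP h1 h2
    push Not at h1 h2
    obtain ⟨m, hm⟩ := hP
    obtain ⟨r, hr, hrm⟩ := h2 ((HomologicalComplex.homologyMap g i).hom m)
    obtain ⟨x, hx⟩ := hex (r • m) (by
      change (HomologicalComplex.homologyMap g i).hom (r • m) = 0
      rw [map_smul, hrm])
    obtain ⟨s, hs, hsx⟩ := h1 x
    refine hm (s * r) (fun hh => (P.2.mem_or_mem hh).elim hs hr) ?_
    rw [mul_smul, ← hx]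
    change s • (HomologicalComplex.homologyMap f i).hom x = 0
    rw [← map_smul, hsx, map_zero]

lemma hom_sum_apply {J : Type*} (s : Finset J) {M N : ModuleCat.{u} Q} (φ : J → (M ⟶ N)) (x : M) :
    (∑ j ∈ s, φ j).hom x = ∑ j ∈ s, (φ j).hom x := by
  rw [ModuleCat.hom_sum, LinearMap.sum_apply]

/-- A finite family of complexes summing up to the identity of `B`: perfectness of all the terms
gives that of `B`. -/
lemma IsPerfectOn.of_sum_eq_id {Z : Set (PrimeSpectrum Q)} {J : Type*} [Fintype J]
    {A : J → ChainComplex (ModuleCat.{u} Q) ℤ} {B : ChainComplex (ModuleCat.{u} Q) ℤ}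
    (hA : ∀ j, IsPerfectOn Z (A j)) (ι : ∀ j, A j ⟶ B) (r : ∀ j, B ⟶ A j)
    (h : ∑ j, r j ≫ ι j = 𝟙 B) : IsPerfectOn Z B := by
  classical
  have hsum : ∀ i x, ∑ j, ((ι j).f i).hom (((r j).f i).hom x) = x := by
    intro i x
    have h1 := congrArg (HomologicalComplex.eval (ModuleCat.{u} Q) (ComplexShape.down ℤ) i).map h
    rw [Functor.map_sum, CategoryTheory.Functor.map_id] at h1
    have h2 := congrArg (fun φ => φ.hom x) h1
    exact (hom_sum_apply _ _ x).symm.trans h2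
  let s (i : ℤ) : B.X i →ₗ[Q] (∀ j, (A j).X i) := LinearMap.pi fun j => ((r j).f i).hom
  let t (i : ℤ) : (∀ j, (A j).X i) →ₗ[Q] B.X i :=
    ∑ j, ((ι j).f i).hom ∘ₗ LinearMap.proj j
  have hts : ∀ i, t i ∘ₗ s i = LinearMap.id := by
    intro i
    refine LinearMap.ext fun x => ?_
    simpa [t, s] using hsum i x
  refine ⟨fun i => ?_, fun i => ?_, ?_, fun i P hP => ?_⟩
  · have := fun j => (hA j).finite i
    exact Module.Finite.of_surjective (t i) (LinearMap.surjective_of_comp_eq_id _ _ (hts i))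
  · have : ∀ j, Module.Projective Q ((A j).X i) := fun j => (hA j).projective i
    have : Module.Projective Q (∀ j, (A j).X i) :=
      Module.Projective.of_equiv (DirectSum.linearEquivFunOnFintype Q J fun j => (A j).X i)
    exact Module.Projective.of_split (s i) (t i) (hts i)
  · choose a b hab using fun j => (hA j).bounded
    -- One pair of bounds that works for every `A j`, and also when `J` is empty.
    refine ⟨-∑ j, |a j|, ∑ j, |b j|, fun i hi => ⟨fun x y => ?_⟩⟩
    have h1 : ∀ j, Subsingleton ((A j).X i) := by
      intro j
      have e1 : |a j| ≤ ∑ j, |a j| :=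
        Finset.single_le_sum (f := fun j => |a j|) (fun j _ => abs_nonneg (a j))
        (Finset.mem_univ j)
      have e2 : |b j| ≤ ∑ j, |b j| :=
        Finset.single_le_sum (f := fun j => |b j|) (fun j _ => abs_nonneg (b j))
        (Finset.mem_univ j)
      have e3 := neg_abs_le (a j)
      have e4 := le_abs_self (b j)
      refine hab j i ?_
      omega
    rw [← hsum i x, ← hsum i y]
    exact Finset.sum_congr rfl fun j _ => by rw [Subsingleton.elim (((r j).f i).hom x)]
  · by_contra hPZ
    obtain ⟨m, hm⟩ := Module.mem_support_iff'.1 hP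
    have h1 : ∀ j, ∃ c ∉ P.asIdeal, c • (HomologicalComplex.homologyMap (r j) i).hom m = 0 := by
      intro j
      have h1 : P ∉ Module.support Q ((A j).homology i) := fun hh => hPZ ((hA j).support i hh)
      rw [Module.mem_support_iff'] at h1
      push Not at h1
      exact h1 _
    choose c hc hcm using h1
    refine hm (∏ j, c j) (fun hh => ?_) ?_
    · obtain ⟨j, _, hj⟩ := P.2.prod_mem_iff.1 hh
      exact hc j hj
    · have h1 := congrArg
        (HomologicalComplex.homologyFunctor (ModuleCat.{u} Q) (ComplexShape.down ℤ) i).map h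
      rw [Functor.map_sum, CategoryTheory.Functor.map_id] at h1
      have h2 : ∑ j, (HomologicalComplex.homologyMap (r j ≫ ι j) i).hom m = m :=
        (hom_sum_apply _ _ m).symm.trans (congrArg (fun φ => φ.hom m) h1)
      simp only [HomologicalComplex.homologyMap_comp, ModuleCat.hom_comp,
        LinearMap.comp_apply] at h2
      rw [← h2, Finset.smul_sum]
      refine Finset.sum_eq_zero fun j _ => ?_
      obtain ⟨c', hc'⟩ := Finset.dvd_prod_of_mem c (Finset.mem_univ j)
      rw [hc', mul_comm, mul_smul, ← map_smul, hcm, map_zero, smul_zero]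

lemma IsPerfectOn.of_retract {Z : Set (PrimeSpectrum Q)}
    {A B : ChainComplex (ModuleCat.{u} Q) ℤ} (hB : IsPerfectOn Z B) (ι : A ⟶ B) (r : B ⟶ A)
    (h : ι ≫ r = 𝟙 A) : IsPerfectOn Z A :=
  IsPerfectOn.of_sum_eq_id (J := Unit) (fun _ => hB) (fun _ => r) (fun _ => ι) (by simpa using h)

/-- The empty family already sums up to the identity of a zero complex. -/
lemma IsPerfectOn.of_subsingleton {Z : Set (PrimeSpectrum Q)}
    {A : ChainComplex (ModuleCat.{u} Q) ℤ} (h : ∀ i, Subsingleton (A.X i)) : IsPerfectOn Z A :=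
  IsPerfectOn.of_sum_eq_id (J := Empty) (A := Empty.elim) (fun j => j.elim) (fun j => j.elim)
    (fun j => j.elim) (by
      ext i x
      exact (h i).elim _ _)

/-! ### Complexes cut out of a module with an endomorphism -/

/-- The submodules `W m` of `V` form a complex under the endomorphism `D`. -/
structure IsDG {V : Type u} [AddCommGroup V] [Module Q V] (D : V →ₗ[Q] V)
    (W : ℤ → Submodule Q V) : Prop where
  mem : ∀ {m k : ℤ}, k + 1 = m → ∀ t ∈ W m, D t ∈ W k
  sq : ∀ m, ∀ t ∈ W m, D (D t) = 0

variable {V : Type u} [AddCommGroup V] [Module Q V] {D : V →ₗ[Q] V} {W : ℤ → Submodule Q V}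
variable {V' : Type u} [AddCommGroup V'] [Module Q V'] {D' : V' →ₗ[Q] V'} {W' : ℤ → Submodule Q V'}
variable {V'' : Type u} [AddCommGroup V''] [Module Q V''] {D'' : V'' →ₗ[Q] V''}
  {W'' : ℤ → Submodule Q V''}

/-- The complex with terms `W m` and differential `D`. -/
noncomputable def subCx (D : V →ₗ[Q] V) (W : ℤ → Submodule Q V) (h : IsDG D W) :
    ChainComplex (ModuleCat.{u} Q) ℤ where
  X m := ModuleCat.of Q (W m)
  d m k := if hk : k + 1 = m then ModuleCat.ofHom (D.restrict (h.mem hk)) else 0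
  shape m k hk := dif_neg hk
  d_comp_d' m k l hk hl := by
    have h1 : k + 1 = m := hk
    have h2 : l + 1 = k := hl
    rw [dif_pos h1, dif_pos h2, ← ModuleCat.ofHom_comp]
    exact ModuleCat.hom_ext (LinearMap.ext fun t => Subtype.ext (h.sq m t.1 t.2))

lemma subCx_d (h : IsDG D W) {m k : ℤ} (hk : k + 1 = m) :
    (subCx D W h).d m k = ModuleCat.ofHom (D.restrict (h.mem hk)) := dif_pos hk

/-- The chain map given by a linear map. -/
noncomputable def subCxMap (h : IsDG D W) (h' : IsDG D' W') (φ : V →ₗ[Q] V')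
    (hφ : ∀ m, ∀ t ∈ W m, φ t ∈ W' m) (hc : ∀ m, ∀ t ∈ W m, φ (D t) = D' (φ t)) :
    subCx D W h ⟶ subCx D' W' h' where
  f m := ModuleCat.ofHom (φ.restrict (hφ m))
  comm' m k hk := by
    have h1 : k + 1 = m := hk
    rw [subCx_d h h1, subCx_d h' h1]
    exact ModuleCat.hom_ext (LinearMap.ext fun t => Subtype.ext (hc m t.1 t.2).symm)

variable (Z : Set (PrimeSpectrum Q))

/-- The complex `W` is an object of `𝒫^Z(Q)`. -/
def PerfDG (D : V →ₗ[Q] V) (W : ℤ → Submodule Q V) : Prop :=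
  ∃ h : IsDG D W, IsPerfectOn Z (subCx D W h)

open Classical in
/-- The class in `K₀^Z(Q)` of a complex cut out of a module, or zero if it is not an object of
`𝒫^Z(Q)`. -/
noncomputable def dgClass (D : V →ₗ[Q] V) (W : ℤ → Submodule Q V) : K0 Z :=
  if h : PerfDG Z D W then K0.cls ⟨subCx D W h.1, h.2⟩ else 0

variable {Z}

lemma dgClass_eq (h : IsDG D W) (h' : IsPerfectOn Z (subCx D W h)) :
    dgClass Z D W = K0.cls ⟨subCx D W h, h'⟩ := dif_pos ⟨h, h'⟩

lemma K0.cls_shortExact {X' X X'' : PerfComplex Z} {f : X'.1 ⟶ X.1} {g : X.1 ⟶ X''.1}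
    {w : f ≫ g = 0} (h : (ShortComplex.mk f g w).ShortExact) :
    K0.cls X = K0.cls X' + K0.cls X'' := by
  refine (QuotientAddGroup.eq_iff_sub_mem).2 (AddSubgroup.subset_closure (Or.inl ?_))
  exact ⟨X', X, X'', f, g, w, h, rfl⟩

lemma K0.cls_quasiIso {X Y : PerfComplex Z} (f : X.1 ⟶ Y.1) (h : QuasiIso f) :
    K0.cls X = K0.cls Y := by
  refine (QuotientAddGroup.eq_iff_sub_mem).2 (AddSubgroup.subset_closure (Or.inr ?_))
  exact ⟨X, Y, f, h, rfl⟩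

lemma K0.cls_iso {X Y : PerfComplex Z} (e : X.1 ≅ Y.1) : K0.cls X = K0.cls Y :=
  K0.cls_quasiIso e.hom inferInstance

/-- The sequence `0 → X → X → X → 0` with zero maps is exact, whence `[X] = [X] + [X]`. -/
lemma K0.cls_eq_zero_of_subsingleton {X : PerfComplex Z} (h : ∀ i, Subsingleton (X.1.X i)) :
    K0.cls X = 0 := by
  have : (ShortComplex.mk (0 : X.1 ⟶ X.1) (0 : X.1 ⟶ X.1) (by simp)).ShortExact :=
    shortExact_of_elements _ _ _ (fun i x _ => (h i).elim _ _) (fun i y => ⟨0, (h i).elim _ _⟩)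
      (fun i y _ => ⟨0, (h i).elim _ _⟩)
  simpa using K0.cls_shortExact this

/-- Mutually inverse isomorphisms between complexes cut out of modules. -/
structure DGIso (D : V →ₗ[Q] V) (W : ℤ → Submodule Q V) (D' : V' →ₗ[Q] V')
    (W' : ℤ → Submodule Q V') (φ : V →ₗ[Q] V') (ψ : V' →ₗ[Q] V) : Prop where
  map_mem : ∀ m, ∀ t ∈ W m, φ t ∈ W' m
  inv_mem : ∀ m, ∀ t ∈ W' m, ψ t ∈ W m
  left_inv : ∀ m, ∀ t ∈ W m, ψ (φ t) = t
  right_inv : ∀ m, ∀ t ∈ W' m, φ (ψ t) = t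
  comm : ∀ m, ∀ t ∈ W m, φ (D t) = D' (φ t)

variable {φ : V →ₗ[Q] V'} {ψ : V' →ₗ[Q] V}

lemma DGIso.comm_inv (e : DGIso D W D' W' φ ψ) (h : IsDG D W) (m : ℤ) (t : V') (ht : t ∈ W' m) :
    ψ (D' t) = D (ψ t) := by
  have h1 := e.inv_mem m t ht
  have h2 := h.mem (sub_add_cancel m 1) _ h1
  rw [← e.left_inv _ _ h2, e.comm m _ h1, e.right_inv m t ht]

lemma DGIso.isDG (e : DGIso D W D' W' φ ψ) (h : IsDG D W) : IsDG D' W' where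
  mem := by
    intro m k hk t ht
    have h1 := e.inv_mem m t ht
    rw [← e.right_inv m t ht, ← e.comm m _ h1]
    exact e.map_mem k _ (h.mem hk _ h1)
  sq := by
    intro m t ht
    have h1 := e.inv_mem m t ht
    rw [← e.right_inv m t ht, ← e.comm m _ h1,
      ← e.comm (m - 1) _ (h.mem (sub_add_cancel m 1) _ h1), h.sq m _ h1, map_zero]

lemma DGIso.symm (e : DGIso D W D' W' φ ψ) (h : IsDG D W) : DGIso D' W' D W ψ φ :=
  ⟨e.inv_mem, e.map_mem, e.right_inv, e.left_inv, e.comm_inv h⟩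

/-- The isomorphism of complexes. -/
noncomputable def DGIso.iso (e : DGIso D W D' W' φ ψ) (h : IsDG D W) (h' : IsDG D' W') :
    subCx D W h ≅ subCx D' W' h' where
  hom := subCxMap h h' φ e.map_mem e.comm
  inv := subCxMap h' h ψ e.inv_mem (e.comm_inv h)
  hom_inv_id := by
    ext m t
    exact Subtype.ext (e.left_inv m t.1 t.2)
  inv_hom_id := by
    ext m t
    exact Subtype.ext (e.right_inv m t.1 t.2)

lemma DGIso.perf (e : DGIso D W D' W' φ ψ) (h : PerfDG Z D W) : PerfDG Z D' W' :=
  ⟨e.isDG h.1, h.2.of_retract (e.iso h.1 (e.isDG h.1)).inv (e.iso h.1 (e.isDG h.1)).hom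
    (by simp)⟩

lemma DGIso.class_eq (e : DGIso D W D' W' φ ψ) (h : IsDG D W) :
    dgClass Z D W = dgClass Z D' W' := by
  by_cases hp : PerfDG Z D W
  · have hp' := e.perf hp
    rw [dgClass_eq hp.1 hp.2, dgClass_eq hp'.1 hp'.2]
    exact K0.cls_iso (e.iso hp.1 hp'.1)
  -- If one side is not perfect then neither is the other, and both classes take the default value
  -- zero. So no perfectness hypothesis is needed.
  · have hp' : ¬ PerfDG Z D' W' := fun hp' => hp ((e.symm h).perf hp')
    rw [dgClass, dgClass, dif_neg hp, dif_neg hp']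

/-- Short exact sequences of complexes cut out of modules. -/
structure DGExact (D : V →ₗ[Q] V) (W : ℤ → Submodule Q V) (D' : V' →ₗ[Q] V')
    (W' : ℤ → Submodule Q V') (D'' : V'' →ₗ[Q] V'') (W'' : ℤ → Submodule Q V'')
    (φ : V →ₗ[Q] V') (ψ : V' →ₗ[Q] V'') : Prop where
  map_mem : ∀ m, ∀ t ∈ W m, φ t ∈ W' m
  map_mem' : ∀ m, ∀ t ∈ W' m, ψ t ∈ W'' m
  comm : ∀ m, ∀ t ∈ W m, φ (D t) = D' (φ t)
  comm' : ∀ m, ∀ t ∈ W' m, ψ (D' t) = D'' (ψ t)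
  zero : ∀ m, ∀ t ∈ W m, ψ (φ t) = 0
  inj : ∀ m, ∀ t ∈ W m, φ t = 0 → t = 0
  surj : ∀ m, ∀ t ∈ W'' m, ∃ s ∈ W' m, ψ s = t
  exact : ∀ m, ∀ t ∈ W' m, ψ t = 0 → ∃ s ∈ W m, φ s = t

lemma DGExact.shortExact {ψ : V' →ₗ[Q] V''} (e : DGExact D W D' W' D'' W'' φ ψ) (h : IsDG D W)
    (h' : IsDG D' W') (h'' : IsDG D'' W'') : ∃ w,
    (ShortComplex.mk (subCxMap h h' φ e.map_mem e.comm) (subCxMap h' h'' ψ e.map_mem' e.comm')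
      w).ShortExact := by
  refine ⟨by ext m t; exact Subtype.ext (e.zero m t.1 t.2), shortExact_of_elements _ _ _ ?_ ?_ ?_⟩
  · intro m t ht
    exact Subtype.ext (e.inj m t.1 t.2 (congrArg Subtype.val ht))
  · intro m t
    obtain ⟨s, hs, hst⟩ := e.surj m t.1 t.2
    exact ⟨⟨s, hs⟩, Subtype.ext hst⟩
  · intro m t ht
    obtain ⟨s, hs, hst⟩ := e.exact m t.1 t.2 (congrArg Subtype.val ht)
    exact ⟨⟨s, hs⟩, Subtype.ext hst⟩

lemma DGExact.perf {ψ : V' →ₗ[Q] V''} (e : DGExact D W D' W' D'' W'' φ ψ) (h : PerfDG Z D W)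
    (h' : IsDG D' W') (h'' : PerfDG Z D'' W'') : PerfDG Z D' W' :=
  ⟨h', IsPerfectOn.of_shortExact (e.shortExact h.1 h' h''.1).2 h.2 h''.2⟩

lemma DGExact.class_eq {ψ : V' →ₗ[Q] V''} (e : DGExact D W D' W' D'' W'' φ ψ) (h : PerfDG Z D W)
    (h' : IsDG D' W') (h'' : PerfDG Z D'' W'') :
    dgClass Z D' W' = dgClass Z D W + dgClass Z D'' W'' := by
  have hp := e.perf h h' h''
  rw [dgClass_eq h.1 h.2, dgClass_eq hp.1 hp.2, dgClass_eq h''.1 h''.2]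
  exact K0.cls_shortExact (X' := ⟨_, h.2⟩) (X := ⟨_, hp.2⟩) (X'' := ⟨_, h''.2⟩)
    (e.shortExact h.1 h' h''.1).2

lemma PerfDG.of_retract (h' : PerfDG Z D' W') (h : IsDG D W)
    (hφ : ∀ m, ∀ t ∈ W m, φ t ∈ W' m) (hc : ∀ m, ∀ t ∈ W m, φ (D t) = D' (φ t))
    (hψ : ∀ m, ∀ t ∈ W' m, ψ t ∈ W m) (hc' : ∀ m, ∀ t ∈ W' m, ψ (D' t) = D (ψ t))
    (hi : ∀ m, ∀ t ∈ W m, ψ (φ t) = t) : PerfDG Z D W :=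
  ⟨h, h'.2.of_retract (subCxMap h h'.1 φ hφ hc) (subCxMap h'.1 h ψ hψ hc') (by
    ext m t
    exact Subtype.ext (hi m t.1 t.2))⟩

lemma perfDG_of_eq_bot (h : ∀ m, W m = ⊥) : PerfDG Z D W :=
  ⟨⟨fun _ t ht => by rw [h] at ht ⊢; rw [(Submodule.mem_bot Q).1 ht, map_zero]; exact zero_mem _,
    fun m t ht => by rw [h] at ht; rw [(Submodule.mem_bot Q).1 ht, map_zero, map_zero]⟩,
    IsPerfectOn.of_subsingleton fun m => by
      change Subsingleton (W m)
      rw [h]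
      infer_instance⟩

lemma dgClass_of_eq_bot (h : ∀ m, W m = ⊥) : dgClass Z D W = 0 := by
  have hp : PerfDG Z D W := perfDG_of_eq_bot h
  rw [dgClass_eq hp.1 hp.2]
  refine K0.cls_eq_zero_of_subsingleton fun m => ?_
  change Subsingleton (W m)
  rw [h]
  infer_instance

/-- The terms of a complex, as submodules of the total module. -/
noncomputable def totDeg (X : ChainComplex (ModuleCat.{u} Q) ℤ) (m : ℤ) : Submodule Q (Tot X) :=
  LinearMap.range (inc X m)

lemma isDG_tot (X : ChainComplex (ModuleCat.{u} Q) ℤ) : IsDG (totD X) (totDeg X) where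
  mem := by
    rintro m k hk _ ⟨x, rfl⟩
    rw [totD_inc' hk]
    exact ⟨_, rfl⟩
  sq m t _ := LinearMap.congr_fun (totD_mul_totD (X := X)) t

/-- A complex is isomorphic to the one cut out of its total module. -/
noncomputable def isoSubCxTot (X : ChainComplex (ModuleCat.{u} Q) ℤ) :
    X ≅ subCx (totD X) (totDeg X) (isDG_tot X) :=
  HomologicalComplex.Hom.isoOfComponents
    (fun m => (LinearEquiv.ofInjective (inc X m) (inc_injective m)).toModuleIso) (by
      intro m k hk
      have h1 : k + 1 = m := hk
      rw [subCx_d _ h1]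
      ext x
      exact Subtype.ext (totD_inc' h1 x))

lemma perfDG_tot (X : PerfComplex Z) : PerfDG Z (totD X.1) (totDeg X.1) :=
  ⟨isDG_tot X.1, X.2.of_retract (isoSubCxTot X.1).inv (isoSubCxTot X.1).hom (by simp)⟩

lemma dgClass_tot (X : PerfComplex Z) : dgClass Z (totD X.1) (totDeg X.1) = K0.cls X := by
  have h := perfDG_tot X
  rw [dgClass_eq h.1 h.2]
  exact (K0.cls_iso (Y := ⟨_, h.2⟩) (isoSubCxTot X.1)).symm

end DG

set_option linter.unusedSectionVars false

/-! ### Functoriality of signed tensor powers in degree-preserving maps -/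

section Functoriality

variable {Q : Type u} [CommRing Q] {X Y Y' : ChainComplex (ModuleCat.{u} Q) ℤ} {n : ℕ}

/-- Degree-preserving linear maps of total modules. -/
def IsDeg (θ : Tot X →ₗ[Q] Tot Y) : Prop := ∀ i x, θ (inc X i x) ∈ totDeg Y i

lemma IsDeg.parityProj {θ : Tot X →ₗ[Q] Tot Y} (h : IsDeg θ) (b : ZMod 2) :
    parityProj Y b ∘ₗ θ = θ ∘ₗ parityProj X b := by
  refine DirectSum.linearMap_ext Q fun i => LinearMap.ext fun x => ?_
  obtain ⟨y, hy⟩ := h i x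
  simp only [LinearMap.comp_apply, parityProj_inc]
  rw [← hy, parityProj_inc, hy]
  split_ifs <;> simp

lemma IsDeg.eps {θ : Tot X →ₗ[Q] Tot Y} (h : IsDeg θ) : eps Y ∘ₗ θ = θ ∘ₗ eps X := by
  rw [eps_eq, eps_eq, LinearMap.sub_comp, LinearMap.comp_sub, h.parityProj, h.parityProj]

lemma IsDeg.isPar {θ : Fin n → (Tot X →ₗ[Q] Tot Y)} (h : ∀ i, IsDeg (θ i)) {s : Fin n → ZMod 2}
    {y : Fin n → Tot X} (hy : IsPar s y) : IsPar s (fun i => θ i (y i)) := by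
  intro k b
  have := LinearMap.congr_fun ((h k).parityProj b) (y k)
  rw [LinearMap.comp_apply, LinearMap.comp_apply, hy k b] at this
  rw [this]
  split_ifs <;> simp

lemma map_mem_powDeg {θ : Fin n → (Tot X →ₗ[Q] Tot Y)} (h : ∀ i, IsDeg (θ i)) {m : ℤ} :
    ∀ t ∈ powDeg n X m, PiTensorProduct.map θ t ∈ powDeg n Y m := by
  have : powDeg n X m ≤ (powDeg n Y m).comap (PiTensorProduct.map θ) := by
    refine Submodule.span_le.2 ?_
    rintro _ ⟨a, x, hm, rfl⟩
    rw [SetLike.mem_coe, Submodule.mem_comap, PiTensorProduct.map_tprod]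
    exact tprod_mem_powDeg (fun i => h i (a i) (x i)) hm
  exact this

/-- Degree-preserving maps keep parities, hence the Koszul sign. The maps may differ from factor to
factor, and they are carried along with the factors; this is how the rotation permutes the summands
of a decomposed tensor power. -/
lemma permOp_map {θ : Fin n → (Tot X →ₗ[Q] Tot Y)} (h : ∀ i, IsDeg (θ i))
    (σ : Equiv.Perm (Fin n)) :
    permOp n Y σ ∘ₗ PiTensorProduct.map θ =
      PiTensorProduct.map (fun i => θ (σ i)) ∘ₗ permOp n X σ := by
  refine pow_ext fun a x => ?_
  have hx := isPar_inc a x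
  rw [LinearMap.comp_apply, LinearMap.comp_apply, PiTensorProduct.map_tprod,
    permOp_tprod σ hx, permOp_tprod σ (IsDeg.isPar h hx), map_smul, PiTensorProduct.map_tprod]

/-- The derivation of the tensor power induced by an endomorphism of odd degree. -/
noncomputable def powDer (n : ℕ) (X : ChainComplex (ModuleCat.{u} Q) ℤ)
    (d : Tot X →ₗ[Q] Tot X) : Pow n X →ₗ[Q] Pow n X :=
  ∑ i, PiTensorProduct.map (fun j => if j < i then eps X else if j = i then d else 1)

lemma powD_eq_powDer : powD n X = powDer n X (totD X) := rfl

lemma powDer_add (d d' : Tot X →ₗ[Q] Tot X) :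
    powDer n X (d + d') = powDer n X d + powDer n X d' := by
  rw [powDer, powDer, powDer, ← Finset.sum_add_distrib]
  refine Finset.sum_congr rfl fun i _ => ?_
  rw [map_add_map i]
  · congr 1
    ext1 j
    by_cases hj : j = i
    · subst hj; simp
    · simp [hj]
  · intro j hj
    simp [hj]

/-- No chain map is required: `d` and `d'` are arbitrary, which permits transporting a differential
along an isomorphism of graded modules only. -/
lemma powDer_map {θ : Fin n → (Tot X →ₗ[Q] Tot Y)} (h : ∀ i, IsDeg (θ i))
    {d : Tot X →ₗ[Q] Tot X} {d' : Tot Y →ₗ[Q] Tot Y} (hd : ∀ i, d' ∘ₗ θ i = θ i ∘ₗ d) :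
    powDer n Y d' ∘ₗ PiTensorProduct.map θ = PiTensorProduct.map θ ∘ₗ powDer n X d := by
  refine LinearMap.ext fun t => ?_
  simp only [powDer, LinearMap.comp_apply, LinearMap.sum_apply, map_sum]
  refine Finset.sum_congr rfl fun i _ => ?_
  rw [← LinearMap.comp_apply, ← LinearMap.comp_apply]
  congr 1
  rw [← PiTensorProduct.map_comp, ← PiTensorProduct.map_comp]
  congr 1
  ext1 j
  split_ifs
  · exact (h j).eps
  · exact hd j
  · rfl

/-- The linear map of total modules induced by a chain map. -/
noncomputable def totMap (f : X ⟶ Y) : Tot X →ₗ[Q] Tot Y :=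
  DirectSum.toModule Q ℤ _ fun i => inc Y i ∘ₗ (f.f i).hom

lemma totMap_inc (f : X ⟶ Y) (i : ℤ) (x : X.X i) :
    totMap f (inc X i x) = inc Y i ((f.f i).hom x) := by
  simp [totMap, inc]

lemma totMap_comp (f : X ⟶ Y) (g : Y ⟶ Y') : totMap (f ≫ g) = totMap g ∘ₗ totMap f := by
  refine DirectSum.linearMap_ext Q fun i => LinearMap.ext fun x => ?_
  simp only [LinearMap.comp_apply, totMap_inc]
  rfl

lemma totMap_id : totMap (𝟙 X) = LinearMap.id := by
  refine DirectSum.linearMap_ext Q fun i => LinearMap.ext fun x => ?_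
  simp only [LinearMap.comp_apply, totMap_inc]
  rfl

lemma totMap_zero : totMap (0 : X ⟶ Y) = 0 := by
  refine DirectSum.linearMap_ext Q fun i => LinearMap.ext fun x => ?_
  simp only [LinearMap.comp_apply, totMap_inc]
  exact map_zero _

lemma totMap_add (f g : X ⟶ Y) : totMap (f + g) = totMap f + totMap g := by
  refine DirectSum.linearMap_ext Q fun i => LinearMap.ext fun x => ?_
  simp only [LinearMap.comp_apply, totMap_inc, LinearMap.add_apply, ← map_add]
  rfl

lemma totMap_sum {J : Type*} (s : Finset J) (f : J → (X ⟶ Y)) :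
    totMap (∑ j ∈ s, f j) = ∑ j ∈ s, totMap (f j) :=
  map_sum (AddMonoidHom.mk' (totMap (X := X) (Y := Y)) totMap_add) f s

lemma isDeg_totMap (f : X ⟶ Y) : IsDeg (totMap f) := by
  intro i x
  rw [totMap_inc]
  exact ⟨_, rfl⟩

lemma totD_totMap (f : X ⟶ Y) : totD Y ∘ₗ totMap f = totMap f ∘ₗ totD X := by
  refine DirectSum.linearMap_ext Q fun i => LinearMap.ext fun x => ?_
  simp only [LinearMap.comp_apply, totMap_inc, totD_inc]
  congr 1
  exact congrArg (fun φ => φ.hom x) (f.comm i (i - 1))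

end Functoriality

/-! ### Eigenspaces in the tensor power of a direct sum, by sets of index functions -/

section WeightSpaces

variable {Q : Type u} [CommRing Q] {X Y : ChainComplex (ModuleCat.{u} Q) ℤ} {n : ℕ}
variable {Z : Set (PrimeSpectrum Q)}
variable {J : Type*} [Fintype J] [DecidableEq J]

/-- A decomposition of a complex into a direct sum, through projectors. -/
structure IsDecomp (e : J → (Tot Y →ₗ[Q] Tot Y)) : Prop where
  deg : ∀ j, IsDeg (e j)
  comm : ∀ j, totD Y * e j = e j * totD Y
  orth : ∀ i j, e i * e j = if i = j then e i else 0
  sum : ∑ j, e j = 1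

/-- The projector onto the summand `f 1 ⊗ ⋯ ⊗ f n` of the tensor power. -/
noncomputable def powIdem (e : J → (Tot Y →ₗ[Q] Tot Y)) (f : Fin n → J) : Pow n Y →ₗ[Q] Pow n Y :=
  PiTensorProduct.map fun i => e (f i)

/-- The projector onto the sum of the summands with index in `A`. -/
noncomputable def setIdem (e : J → (Tot Y →ₗ[Q] Tot Y)) (A : Finset (Fin n → J)) :
    Pow n Y →ₗ[Q] Pow n Y :=
  ∑ f ∈ A, powIdem e f

variable {e : J → (Tot Y →ₗ[Q] Tot Y)}

lemma powIdem_mul (he : IsDecomp e) (f g : Fin n → J) :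
    powIdem e f * powIdem e g = if f = g then powIdem e f else 0 := by
  rw [powIdem, powIdem, ← PiTensorProduct.map_mul]
  split_ifs with h
  · subst h
    simp [he.orth]
  · obtain ⟨i, hi⟩ := Function.ne_iff.mp h
    exact map_eq_zero i (by simp [he.orth, hi])

lemma setIdem_mul (he : IsDecomp e) (A B : Finset (Fin n → J)) :
    setIdem e A * setIdem e B = setIdem e (A ∩ B) := by
  simp only [setIdem, Finset.sum_mul_sum, powIdem_mul he, Finset.sum_ite_eq]
  rw [Finset.sum_ite_mem]

lemma setIdem_union {A B : Finset (Fin n → J)} (h : Disjoint A B) :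
    setIdem e (A ∪ B) = setIdem e A + setIdem e B := Finset.sum_union h

/-- Expand the tensor power of `∑ j, e j = 1` by multilinearity. -/
lemma setIdem_univ (he : IsDecomp e) : setIdem e (Finset.univ : Finset (Fin n → J)) = 1 := by
  rw [← PiTensorProduct.map_one]
  have := (PiTensorProduct.mapMultilinear Q (fun _ : Fin n => Tot Y) (fun _ => Tot Y)).map_sum
    (fun _ j => e j)
  rw [he.sum] at this
  exact this.symm

lemma setIdem_empty : setIdem e (∅ : Finset (Fin n → J)) = 0 := Finset.sum_empty

lemma permOp_powIdem (he : IsDecomp e) (σ : Equiv.Perm (Fin n)) (f : Fin n → J) :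
    permOp n Y σ * powIdem e f = powIdem e (f ∘ σ) * permOp n Y σ :=
  permOp_map (fun i => he.deg (f i)) σ

lemma permOp_setIdem (he : IsDecomp e) {σ : Equiv.Perm (Fin n)} {A : Finset (Fin n → J)}
    (hA : ∀ f, f ∘ σ ∈ A ↔ f ∈ A) :
    permOp n Y σ * setIdem e A = setIdem e A * permOp n Y σ := by
  rw [setIdem, Finset.mul_sum, Finset.sum_mul]
  refine Finset.sum_bij' (fun f _ => f ∘ σ) (fun f _ => f ∘ σ.symm) ?_ ?_ ?_ ?_ ?_
  · exact fun f hf => (hA f).2 hf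
  · intro f hf
    rw [← hA]
    simpa [Function.comp_assoc] using hf
  · intro f _
    simp [Function.comp_assoc]
  · intro f _
    simp [Function.comp_assoc]
  · exact fun f _ => permOp_powIdem he σ f

lemma powD_powIdem (he : IsDecomp e) (f : Fin n → J) :
    powD n Y * powIdem e f = powIdem e f * powD n Y :=
  powDer_map (fun i => he.deg (f i)) fun i => he.comm (f i)

lemma powD_setIdem (he : IsDecomp e) (A : Finset (Fin n → J)) :
    powD n Y * setIdem e A = setIdem e A * powD n Y := by
  rw [setIdem, Finset.mul_sum, Finset.sum_mul]
  exact Finset.sum_congr rfl fun f _ => powD_powIdem he f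

lemma powIdem_mem (he : IsDecomp e) (f : Fin n → J) {m : ℤ} :
    ∀ t ∈ powDeg n Y m, powIdem e f t ∈ powDeg n Y m :=
  map_mem_powDeg fun i => he.deg (f i)

lemma setIdem_mem (he : IsDecomp e) (A : Finset (Fin n → J)) {m : ℤ} {t : Pow n Y}
    (ht : t ∈ powDeg n Y m) : setIdem e A t ∈ powDeg n Y m := by
  rw [setIdem, LinearMap.sum_apply]
  exact Submodule.sum_mem _ fun f _ => powIdem_mem he f t ht

/-- The part with indices in `A` of the `c`-eigenspace of a permutation. -/
noncomputable def weightDeg (e : J → (Tot Y →ₗ[Q] Tot Y)) (σ : Equiv.Perm (Fin n))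
    (A : Finset (Fin n → J)) (c : Q) (m : ℤ) : Submodule Q (Pow n Y) :=
  (powDeg n Y m ⊓ LinearMap.ker (permOp n Y σ - c • 1)) ⊓ LinearMap.ker (setIdem e A - 1)

variable {σ : Equiv.Perm (Fin n)} {A B : Finset (Fin n → J)} {c : Q} {m : ℤ} {t : Pow n Y}

lemma mem_weightDeg : t ∈ weightDeg e σ A c m ↔
    t ∈ powDeg n Y m ∧ permOp n Y σ t = c • t ∧ setIdem e A t = t := by
  simp [weightDeg, sub_eq_zero, and_assoc]

lemma powD_powD (t : Pow n Y) : powD n Y (powD n Y t) = 0 :=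
  LinearMap.congr_fun (powD_mul_self (X := Y) (n := n)) t

lemma permOp_powD_apply (σ : Equiv.Perm (Fin n)) (t : Pow n Y) :
    permOp n Y σ (powD n Y t) = powD n Y (permOp n Y σ t) :=
  LinearMap.congr_fun (permOp_powD (X := Y) σ) t

lemma powD_setIdem_apply (he : IsDecomp e) (A : Finset (Fin n → J)) (t : Pow n Y) :
    powD n Y (setIdem e A t) = setIdem e A (powD n Y t) :=
  LinearMap.congr_fun (powD_setIdem he A) t

lemma setIdem_setIdem_apply (he : IsDecomp e) (A B : Finset (Fin n → J)) (t : Pow n Y) :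
    setIdem e A (setIdem e B t) = setIdem e (A ∩ B) t :=
  LinearMap.congr_fun (setIdem_mul he A B) t

lemma permOp_setIdem_apply (he : IsDecomp e) (hA : ∀ f, f ∘ σ ∈ A ↔ f ∈ A) (t : Pow n Y) :
    permOp n Y σ (setIdem e A t) = setIdem e A (permOp n Y σ t) :=
  LinearMap.congr_fun (permOp_setIdem he hA) t

lemma isDG_weightDeg (he : IsDecomp e) : IsDG (powD n Y) (weightDeg e σ A c) where
  mem := by
    intro m k hk t ht
    obtain rfl : k = m - 1 := by omega
    rw [mem_weightDeg] at ht ⊢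
    refine ⟨powD_mem t ht.1, ?_, ?_⟩
    · rw [permOp_powD_apply, ht.2.1, map_smul]
    · rw [← powD_setIdem_apply he, ht.2.2]
  sq m t _ := powD_powD t

lemma isDG_eigenDeg (c : Q) : IsDG (powD n Y) (eigenDeg n Y c) :=
  ⟨powD_mem_eigenDeg, fun _ t _ => powD_powD t⟩

lemma perfDG_eigenDeg [NeZero n] (hY : IsPerfectOn Z Y) (hc : c ^ n = 1) (hn : IsUnit (n : Q)) :
    PerfDG Z (powD n Y) (eigenDeg n Y c) :=
  ⟨isDG_eigenDeg c, isPerfectOn_eigenComplex hY hc hn⟩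

lemma dgClass_eigenDeg [NeZero n] (hY : IsPerfectOn Z Y) (hc : c ^ n = 1) (hn : IsUnit (n : Q)) :
    dgClass Z (powD n Y) (eigenDeg n Y c) =
      K0.cls ⟨eigenComplex n Y c, isPerfectOn_eigenComplex hY hc hn⟩ :=
  dgClass_eq (isDG_eigenDeg c) (isPerfectOn_eigenComplex hY hc hn)

/-- For a rotation-stable `A` the projector `setIdem e A` preserves eigenspaces and makes this part
a retract of the whole eigencomplex. -/
lemma perfDG_weightDeg [NeZero n] (he : IsDecomp e) (hY : IsPerfectOn Z Y) (hc : c ^ n = 1)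
    (hn : IsUnit (n : Q)) {A : Finset (Fin n → J)} (hA : ∀ f, f ∘ finRotate n ∈ A ↔ f ∈ A) :
    PerfDG Z (powD n Y) (weightDeg e (finRotate n) A c) := by
  refine (perfDG_eigenDeg hY hc hn).of_retract (φ := LinearMap.id) (ψ := setIdem e A)
    (isDG_weightDeg he) ?_ (fun _ _ _ => rfl) ?_ ?_ ?_
  · intro m t ht
    rw [mem_weightDeg] at ht
    exact mem_eigenDeg.2 ⟨ht.1, ht.2.1⟩
  · intro m t ht
    rw [mem_eigenDeg] at ht
    refine mem_weightDeg.2 ⟨setIdem_mem he A ht.1, ?_, ?_⟩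
    · rw [permOp_setIdem_apply he hA, ht.2, map_smul]
    · rw [setIdem_setIdem_apply he, Finset.inter_self]
  · exact fun m t _ => (powD_setIdem_apply he A t).symm
  · exact fun m t ht => (mem_weightDeg.1 ht).2.2

lemma weightDeg_univ (he : IsDecomp e) :
    weightDeg e (finRotate n) Finset.univ c = eigenDeg n Y c := by
  ext m t
  rw [mem_weightDeg, mem_eigenDeg, setIdem_univ he]
  simp

/-- The direct sum decomposition is presented as the short exact sequence with inclusion of the `A`
part and projection to the `B` part. -/
lemma dgClass_weightDeg_union [NeZero n] (he : IsDecomp e) (hY : IsPerfectOn Z Y) (hc : c ^ n = 1)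
    (hn : IsUnit (n : Q)) {A B : Finset (Fin n → J)} (hA : ∀ f, f ∘ finRotate n ∈ A ↔ f ∈ A)
    (hB : ∀ f, f ∘ finRotate n ∈ B ↔ f ∈ B) (hAB : Disjoint A B) :
    dgClass Z (powD n Y) (weightDeg e (finRotate n) (A ∪ B) c) =
      dgClass Z (powD n Y) (weightDeg e (finRotate n) A c) +
      dgClass Z (powD n Y) (weightDeg e (finRotate n) B c) := by
  have h0 : B ∩ A = ∅ := Finset.disjoint_iff_inter_eq_empty.1 hAB.symm
  have h1 : (A ∪ B) ∩ A = A := by ext; simp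
  have h2 : (A ∪ B) ∩ B = B := by ext; simp
  refine DGExact.class_eq (φ := LinearMap.id) (ψ := setIdem e B) ?_
    (perfDG_weightDeg he hY hc hn hA) (isDG_weightDeg he) (perfDG_weightDeg he hY hc hn hB)
  refine ⟨fun m t ht => ?_, fun m t ht => ?_, fun _ _ _ => rfl,
    fun m t _ => (powD_setIdem_apply he B t).symm, fun m t ht => ?_, fun _ _ _ h => h,
    fun m t ht => ⟨t, ?_, (mem_weightDeg.1 ht).2.2⟩, fun m t ht h => ⟨t, ?_, rfl⟩⟩
  · rw [mem_weightDeg] at ht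
    refine mem_weightDeg.2 ⟨ht.1, ht.2.1, ?_⟩
    change setIdem e (A ∪ B) t = t
    rw [← ht.2.2, setIdem_setIdem_apply he, h1]
  · rw [mem_weightDeg] at ht
    refine mem_weightDeg.2 ⟨setIdem_mem he B ht.1, ?_, ?_⟩
    · rw [permOp_setIdem_apply he hB, ht.2.1, map_smul]
    · rw [setIdem_setIdem_apply he, Finset.inter_self]
  · change setIdem e B t = 0
    rw [← (mem_weightDeg.1 ht).2.2, setIdem_setIdem_apply he, h0, setIdem_empty]
    rfl
  · rw [mem_weightDeg] at ht
    refine mem_weightDeg.2 ⟨ht.1, ht.2.1, ?_⟩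
    rw [← ht.2.2, setIdem_setIdem_apply he, h2]
  · rw [mem_weightDeg] at ht
    refine mem_weightDeg.2 ⟨ht.1, ht.2.1, ?_⟩
    have h3 := ht.2.2
    rw [setIdem_union hAB, LinearMap.add_apply, h, add_zero] at h3
    exact h3

/-- The operator acting by the scalar `χ f` on the summand with index `f`. -/
noncomputable def scaleOp (e : J → (Tot Y →ₗ[Q] Tot Y)) (A : Finset (Fin n → J))
    (χ : (Fin n → J) → Q) : Pow n Y →ₗ[Q] Pow n Y :=
  ∑ f ∈ A, χ f • powIdem e f

lemma scaleOp_mul (he : IsDecomp e) (χ χ' : (Fin n → J) → Q) :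
    scaleOp e A χ * scaleOp e A χ' = scaleOp e A fun f => χ f * χ' f := by
  simp only [scaleOp, Finset.sum_mul_sum, smul_mul_smul_comm, powIdem_mul he, smul_ite, smul_zero,
    Finset.sum_ite_eq]
  exact Finset.sum_congr rfl fun f hf => by simp [hf]

lemma setIdem_mul_scaleOp (he : IsDecomp e) (χ : (Fin n → J) → Q) :
    setIdem e A * scaleOp e A χ = scaleOp e A χ := by
  have : setIdem e A = scaleOp e A fun _ => 1 := by simp [setIdem, scaleOp]
  rw [this, scaleOp_mul he]
  simp

lemma powD_scaleOp (he : IsDecomp e) (χ : (Fin n → J) → Q) :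
    powD n Y * scaleOp e A χ = scaleOp e A χ * powD n Y := by
  rw [scaleOp, Finset.mul_sum, Finset.sum_mul]
  refine Finset.sum_congr rfl fun f _ => ?_
  rw [mul_smul_comm, smul_mul_assoc, powD_powIdem he]

/-- The permutation carries the summand `f` to the summand `f ∘ σ`. The condition on `χ` says
exactly that rescaling the summands turns the eigenvalue `c` into `c'`. -/
lemma scaleOp_mem (he : IsDecomp e) (hA : ∀ f, f ∘ σ ∈ A ↔ f ∈ A) {χ : (Fin n → J) → Q} {c' : Q}
    (hχ : ∀ f ∈ A, χ f * c = c' * χ (f ∘ σ)) (ht : t ∈ weightDeg e σ A c m) :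
    scaleOp e A χ t ∈ weightDeg e σ A c' m := by
  rw [mem_weightDeg] at ht
  refine mem_weightDeg.2 ⟨?_, ?_, LinearMap.congr_fun (setIdem_mul_scaleOp he χ) t⟩
  · rw [scaleOp, LinearMap.sum_apply]
    exact Submodule.sum_mem _ fun f _ => Submodule.smul_mem _ _ (powIdem_mem he f t ht.1)
  · rw [scaleOp, LinearMap.sum_apply, map_sum, Finset.smul_sum]
    refine Finset.sum_bij' (fun f _ => f ∘ σ) (fun f _ => f ∘ σ.symm) ?_ ?_ ?_ ?_ ?_
    · exact fun f hf => (hA f).2 hf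
    · intro f hf
      rw [← hA]
      simpa [Function.comp_assoc] using hf
    · intro f _
      simp [Function.comp_assoc]
    · intro f _
      simp [Function.comp_assoc]
    · intro f hf
      have := LinearMap.congr_fun (permOp_powIdem he σ f) t
      rw [Module.End.mul_apply, Module.End.mul_apply, ht.2.1] at this
      rw [LinearMap.smul_apply, LinearMap.smul_apply, map_smul, this, map_smul, smul_smul,
        smul_smul, hχ f hf]

lemma dgClass_weightDeg_scale (he : IsDecomp e) (hA : ∀ f, f ∘ σ ∈ A ↔ f ∈ A)
    {χ χ' : (Fin n → J) → Q} {c' : Q} (hχ : ∀ f ∈ A, χ f * c = c' * χ (f ∘ σ))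
    (hχ' : ∀ f ∈ A, χ' f * c' = c * χ' (f ∘ σ)) (h : ∀ f ∈ A, χ f * χ' f = 1) :
    dgClass Z (powD n Y) (weightDeg e σ A c) = dgClass Z (powD n Y) (weightDeg e σ A c') := by
  have h1 : scaleOp e A (fun f => χ f * χ' f) = setIdem e A := by
    rw [scaleOp, setIdem]
    exact Finset.sum_congr rfl fun f hf => by rw [h f hf, one_smul]
  have h2 : scaleOp e A (fun f => χ' f * χ f) = setIdem e A := by
    simp_rw [mul_comm]; exact h1
  refine DGIso.class_eq (φ := scaleOp e A χ) (ψ := scaleOp e A χ') ⟨?_, ?_, ?_, ?_, ?_⟩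
    (isDG_weightDeg he)
  · exact fun m t ht => scaleOp_mem he hA hχ ht
  · exact fun m t ht => scaleOp_mem he hA hχ' ht
  · intro m t ht
    rw [← Module.End.mul_apply, scaleOp_mul he, h2, (mem_weightDeg.1 ht).2.2]
  · intro m t ht
    rw [← Module.End.mul_apply, scaleOp_mul he, h1, (mem_weightDeg.1 ht).2.2]
  · exact fun m t _ => (LinearMap.congr_fun (powD_scaleOp he χ) t).symm

lemma pow_val_eq {n : ℕ} [NeZero n] {c : Q} (hc : c ^ n = 1) (k : ℕ) :
    c ^ (k : ZMod n).val = c ^ k := by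
  rw [ZMod.val_natCast, ← pow_eq_pow_mod k hc]

lemma pow_val_add {n : ℕ} [NeZero n] {c : Q} (hc : c ^ n = 1) (a b : ZMod n) :
    c ^ (a + b).val = c ^ a.val * c ^ b.val := by
  rw [← pow_add, ← pow_val_eq hc (a.val + b.val)]
  simp

lemma cast_finRotate {n : ℕ} [NeZero n] (i : Fin n) :
    ((finRotate n i : ℕ) : ZMod n) = (i : ℕ) + 1 := by
  obtain ⟨n, rfl⟩ := Nat.exists_eq_succ_of_ne_zero (NeZero.ne n)
  rw [finRotate_apply, Fin.val_add, ZMod.natCast_mod]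
  rcases n with _ | n
  · exact Subsingleton.elim _ _
  · simp

/-- An index that measures the position of a nonconstant function up to rotation. -/
lemma exists_rotation_index {p : ℕ} [Fact p.Prime] :
    ∃ k : (Fin p → J) → ZMod p, ∀ f, (∀ j, f ≠ Function.const _ j) →
      k (f ∘ finRotate p) = k f - 1 := by
  classical
  have hp : p.Prime := Fact.out
  -- Modulo `p`, `N f j` is the number of places where `f` takes the value `j` and `S f j` is the
  -- sum of these places. Rotation lowers each place by one, so it fixes `N` and lowers `S` by `N`;
  -- the quotient `S / N` then drops by one.
  let N (f : Fin p → J) (j : J) : ZMod p := ∑ i, if f i = j then 1 else 0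
  let S (f : Fin p → J) (j : J) : ZMod p := ∑ i : Fin p, if f i = j then ((i : ℕ) : ZMod p) else 0
  have hN : ∀ f, N (f ∘ finRotate p) = N f := by
    intro f
    ext1 j
    exact Equiv.sum_comp (finRotate p) fun i => if f i = j then (1 : ZMod p) else 0
  have hS : ∀ f j, S (f ∘ finRotate p) j = S f j - N f j := by
    intro f j
    have h1 : S (f ∘ finRotate p) j = ∑ i : Fin p, if f (finRotate p i) = j then
        (((finRotate p i : Fin p) : ℕ) : ZMod p) - 1 else 0 := by
      refine Finset.sum_congr rfl fun i _ => ?_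
      rw [cast_finRotate, add_sub_cancel_right]
      rfl
    rw [h1, Equiv.sum_comp (finRotate p) fun i => if f i = j then ((i : ℕ) : ZMod p) - 1 else 0]
    simp only [S, N, ← Finset.sum_sub_distrib]
    refine Finset.sum_congr rfl fun i _ => ?_
    split_ifs <;> simp
  rcases isEmpty_or_nonempty J with hJ | hJ
  · exact ⟨fun _ => 0, fun f => (hJ.false (f ⟨0, hp.pos⟩)).elim⟩
  -- The value `j` is selected through `N f` alone, so the same `j` is selected for `f` and for its
  -- rotation.
  refine ⟨fun f => S f (Classical.epsilon fun j => N f j ≠ 0) /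
    N f (Classical.epsilon fun j => N f j ≠ 0), fun f hf => ?_⟩
  -- Otherwise the value of `f` at the first place is taken a positive multiple of `p` times, hence
  -- everywhere.
  have hex : ∃ j, N f j ≠ 0 := by
    by_contra! h
    refine hf (f ⟨0, hp.pos⟩) (funext fun i => ?_)
    have h1 := h (f ⟨0, hp.pos⟩)
    simp only [N, Finset.sum_boole] at h1
    rw [ZMod.natCast_eq_zero_iff] at h1
    have h2 : 0 < (Finset.univ.filter fun i => f i = f ⟨0, hp.pos⟩).card :=
      Finset.card_pos.2 ⟨⟨0, hp.pos⟩, Finset.mem_filter.2 ⟨Finset.mem_univ _, rfl⟩⟩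
    have h3 := Nat.le_of_dvd h2 h1
    have h4 : (Finset.univ.filter fun i => f i = f ⟨0, hp.pos⟩) = Finset.univ :=
      Finset.eq_univ_of_card _ (le_antisymm (Finset.card_le_univ _) (by simpa using h3))
    have h5 := Finset.mem_univ i
    rw [← h4, Finset.mem_filter] at h5
    exact h5.2
  have h0 := Classical.epsilon_spec hex
  simp only [hN, hS, sub_div]
  rw [div_self h0]

/-- The group of order `p` acts freely on nonconstant functions, so the summands are permuted as in
an induced representation, in which all eigenvalues occur alike. Explicitly, scaling the summand `f`
by `c ^ k f`, with `k` the rotation index, shifts the eigenvalue from `1` to `c`. -/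
lemma dgClass_weightDeg_nonconst {p : ℕ} [Fact p.Prime] (he : IsDecomp e)
    {A : Finset (Fin p → J)} (hA : ∀ f, f ∘ finRotate p ∈ A ↔ f ∈ A)
    (hA' : ∀ j, Function.const _ j ∉ A) (hc : c ^ p = 1) :
    dgClass Z (powD p Y) (weightDeg e (finRotate p) A c) =
      dgClass Z (powD p Y) (weightDeg e (finRotate p) A 1) := by
  obtain ⟨k, hk⟩ := exists_rotation_index (J := J) (p := p)
  have hk' : ∀ f ∈ A, k (f ∘ finRotate p) = k f - 1 :=
    fun f hf => hk f fun j hj => hA' j (hj ▸ hf)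
  have h1 : c ^ (1 : ZMod p).val = c := by simpa using pow_val_eq hc 1
  symm
  refine dgClass_weightDeg_scale he hA (χ := fun f => c ^ (k f).val)
    (χ' := fun f => c ^ (-k f).val) ?_ ?_ ?_
  · intro f hf
    nth_rw 2 [← h1]
    rw [← pow_val_add hc, hk' f hf, mul_one]
    congr 2
    ring
  · intro f hf
    nth_rw 2 [← h1]
    rw [← pow_val_add hc, hk' f hf, one_mul]
    congr 2
    ring
  · intro f _
    rw [← pow_val_add hc]
    simp

/-- A constant index function selects the tensor power of a single summand, here the retract `Y'` of
`Y` with projector `e j`. -/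
lemma dgClass_weightDeg_const {Y' : ChainComplex (ModuleCat.{u} Q) ℤ} (j : J)
    (ι : Y' ⟶ Y) (r : Y ⟶ Y') (h : ι ≫ r = 𝟙 Y') (h' : totMap (r ≫ ι) = e j) (c : Q) :
    dgClass Z (powD n Y) (weightDeg e (finRotate n) {Function.const _ j} c) =
      dgClass Z (powD n Y') (eigenDeg n Y' c) := by
  have h1 : PiTensorProduct.map (fun _ : Fin n => totMap r) ∘ₗ
      PiTensorProduct.map (fun _ => totMap ι) = LinearMap.id := by
    rw [← PiTensorProduct.map_comp, ← totMap_comp, h, totMap_id, PiTensorProduct.map_id]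
  have h2 : PiTensorProduct.map (fun _ : Fin n => totMap ι) ∘ₗ
      PiTensorProduct.map (fun _ => totMap r) = setIdem e {Function.const _ j} := by
    rw [← PiTensorProduct.map_comp, ← totMap_comp, h', setIdem, Finset.sum_singleton]
    rfl
  symm
  refine DGIso.class_eq (φ := PiTensorProduct.map fun _ => totMap ι)
    (ψ := PiTensorProduct.map fun _ => totMap r) ⟨?_, ?_, ?_, ?_, ?_⟩ (isDG_eigenDeg c)
  · intro m t ht
    rw [mem_eigenDeg] at ht
    refine mem_weightDeg.2 ⟨map_mem_powDeg (fun _ => isDeg_totMap ι) t ht.1, ?_, ?_⟩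
    · rw [← LinearMap.comp_apply, permOp_map (fun _ => isDeg_totMap ι), LinearMap.comp_apply, ht.2,
        map_smul]
    · rw [← h2, LinearMap.comp_apply]
      congr 1
      exact LinearMap.congr_fun h1 t
  · intro m t ht
    rw [mem_weightDeg] at ht
    refine mem_eigenDeg.2 ⟨map_mem_powDeg (fun _ => isDeg_totMap r) t ht.1, ?_⟩
    rw [← LinearMap.comp_apply, permOp_map (fun _ => isDeg_totMap r), LinearMap.comp_apply, ht.2.1,
        map_smul]
  · exact fun m t _ => LinearMap.congr_fun h1 t
  · exact fun m t ht => (LinearMap.congr_fun h2 t).trans (mem_weightDeg.1 ht).2.2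
  · intro m t _
    exact (LinearMap.congr_fun (powDer_map (n := n) (fun _ => isDeg_totMap ι)
      fun _ => totD_totMap ι) t).symm

end WeightSpaces

/-! ### The filtration of a tensor power by the number of factors in the second summand -/

section Filtration

variable {Q : Type u} [CommRing Q] {X Y : ChainComplex (ModuleCat.{u} Q) ℤ} {n : ℕ}
variable {Z : Set (PrimeSpectrum Q)} {e : Bool → (Tot Y →ₗ[Q] Tot Y)}

/-- The number of factors in the second summand. -/
def trueCount (f : Fin n → Bool) : ℕ := ∑ i, (f i).toNat

lemma trueCount_comp (f : Fin n → Bool) (σ : Equiv.Perm (Fin n)) :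
    trueCount (f ∘ σ) = trueCount f := Equiv.sum_comp σ fun i => (f i).toNat

lemma trueCount_le (f : Fin n → Bool) : trueCount f ≤ n := by
  have := Finset.sum_le_card_nsmul Finset.univ (fun i => (f i).toNat) 1 fun i _ => Bool.toNat_le _
  simpa [trueCount] using this

lemma trueCount_eq_zero {f : Fin n → Bool} : trueCount f = 0 ↔ f = Function.const _ false := by
  simp [trueCount, funext_iff]

lemma trueCount_eq {f : Fin n → Bool} : trueCount f = n ↔ f = Function.const _ true := by
  constructor
  · intro h
    by_contra hf
    obtain ⟨i, hi⟩ := Function.ne_iff.mp hf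
    have h1 : trueCount f < ∑ i : Fin n, 1 := by
      refine Finset.sum_lt_sum (fun i _ => Bool.toNat_le _) ⟨i, Finset.mem_univ i, ?_⟩
      simp only [Function.const_apply, ne_eq, Bool.not_eq_true] at hi
      simp [hi]
    simp [h] at h1
  · rintro rfl
    simp [trueCount]

lemma eps_mul_comm (he : IsDecomp e) (b : Bool) : eps Y * e b = e b * eps Y := (he.deg b).eps

/-- A nilpotent perturbation of the differential lowers the number of factors in the second
summand. -/
lemma setIdem_powDer (he : IsDecomp e) {ν : Tot Y →ₗ[Q] Tot Y} (h1 : e true * ν = 0)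
    (h2 : ν * e false = 0) {A B : Finset (Fin n → Bool)}
    (hAB : ∀ f ∈ A, ∀ g ∈ B, trueCount g ≤ trueCount f) :
    setIdem e A * powDer n Y ν * setIdem e B = 0 := by
  rw [powDer, setIdem, setIdem, Finset.sum_mul_sum, Finset.sum_mul]
  refine Finset.sum_eq_zero fun f hf => ?_
  rw [Finset.sum_mul]
  refine Finset.sum_eq_zero fun i _ => ?_
  rw [Finset.mul_sum]
  refine Finset.sum_eq_zero fun g hg => ?_
  rw [powIdem, powIdem, ← PiTensorProduct.map_mul, ← PiTensorProduct.map_mul]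
  -- A term survives only if `f i = false`, `g i = true` and `f`, `g` agree away from `i`. Then `g`
  -- has one more `true` than `f`, which `hAB` excludes.
  by_cases hfi : f i = true
  · exact map_eq_zero i (by simp [hfi, h1])
  by_cases hgi : g i = false
  · exact map_eq_zero i (by simp [hgi, h2, mul_assoc])
  by_cases hfg : ∃ k, k ≠ i ∧ f k ≠ g k
  · obtain ⟨k, hk, hfg⟩ := hfg
    refine map_eq_zero k ?_
    by_cases hki : k < i
    · simp only [hki, if_true]
      rw [← eps_mul_comm he, mul_assoc, he.orth, if_neg hfg, mul_zero]
    · simp [hki, hk, he.orth, hfg]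
  · push Not at hfg
    refine absurd (hAB f hf g hg) (not_le.2 ?_)
    refine Finset.sum_lt_sum (fun k _ => ?_) ⟨i, Finset.mem_univ i, ?_⟩
    · by_cases hk : k = i
      · subst hk
        simp only [Bool.not_eq_true] at hfi
        simp [hfi]
      · rw [hfg k hk]
    · simp only [Bool.not_eq_true] at hfi
      simp only [Bool.not_eq_false] at hgi
      simp [hfi, hgi]

/-- The functions with value `true` at exactly `j` places. -/
def countEq (n j : ℕ) : Finset (Fin n → Bool) := Finset.univ.filter fun f => trueCount f = j

/-- The functions with value `true` at less than `j` places. -/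
def countLt (n j : ℕ) : Finset (Fin n → Bool) := Finset.univ.filter fun f => trueCount f < j

lemma mem_countEq {j : ℕ} {f : Fin n → Bool} : f ∈ countEq n j ↔ trueCount f = j := by
  simp [countEq]

lemma mem_countLt {j : ℕ} {f : Fin n → Bool} : f ∈ countLt n j ↔ trueCount f < j := by
  simp [countLt]

variable {θ : Tot X →ₗ[Q] Tot Y} {θ' : Tot Y →ₗ[Q] Tot X} {c : Q}

/-- The class of an eigenspace of the tensor power of `X`, for a complex `X` whose underlying graded
module is that of a direct sum of complexes, with a differential that is triangular. -/
lemma dgClass_eigenDeg_of_triangular [NeZero n] (he : IsDecomp e) (hY : IsPerfectOn Z Y)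
    (hθ : IsDeg θ) (hθ' : IsDeg θ') (h : θ ∘ₗ θ' = LinearMap.id) (h' : θ' ∘ₗ θ = LinearMap.id)
    (h1 : e true * (θ ∘ₗ totD X ∘ₗ θ') = totD Y * e true)
    (h2 : (θ ∘ₗ totD X ∘ₗ θ') * e false = totD Y * e false) (hc : c ^ n = 1)
    (hn : IsUnit (n : Q)) :
    dgClass Z (powD n X) (eigenDeg n X c) =
      ∑ j ∈ Finset.range (n + 1),
        dgClass Z (powD n Y) (weightDeg e (finRotate n) (countEq n j) c) := by
  -- The differential of `X` transported to the graded module of `Y`; it differs from that of `Y` by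
  -- `ν`, which maps the second summand to the first and kills the first.
  set d' : Tot Y →ₗ[Q] Tot Y := θ ∘ₗ totD X ∘ₗ θ' with hd'
  set ν := d' - totD Y with hν
  have hν1 : e true * ν = 0 := by rw [hν, mul_sub, h1, he.comm, sub_self]
  have hν2 : ν * e false = 0 := by rw [hν, sub_mul, h2, sub_self]
  set Θ : Pow n X →ₗ[Q] Pow n Y := PiTensorProduct.map fun _ => θ
  set Θ' : Pow n Y →ₗ[Q] Pow n X := PiTensorProduct.map fun _ => θ'
  have hΘ : ∀ t, Θ (Θ' t) = t := by
    intro t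
    rw [← LinearMap.comp_apply, ← PiTensorProduct.map_comp, h, PiTensorProduct.map_id]
    rfl
  have hΘ' : ∀ t, Θ' (Θ t) = t := by
    intro t
    rw [← LinearMap.comp_apply, ← PiTensorProduct.map_comp, h', PiTensorProduct.map_id]
    rfl
  have hD : ∀ t, powDer n Y d' (Θ t) = Θ (powD n X t) := by
    have : d' ∘ₗ θ = θ ∘ₗ totD X := by
      rw [hd', LinearMap.comp_assoc, LinearMap.comp_assoc, h', LinearMap.comp_id]
    exact LinearMap.congr_fun (powDer_map (n := n) (fun _ => hθ) fun _ => this)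
  have hP : ∀ σ t, permOp n Y σ (Θ t) = Θ (permOp n X σ t) := fun σ =>
    LinearMap.congr_fun (permOp_map (n := n) (fun _ => hθ) σ)
  have hP' : ∀ σ t, permOp n X σ (Θ' t) = Θ' (permOp n Y σ t) := fun σ =>
    LinearMap.congr_fun (permOp_map (n := n) (fun _ => hθ') σ)
  have hDP : ∀ σ t, permOp n Y σ (powDer n Y d' t) = powDer n Y d' (permOp n Y σ t) := by
    intro σ t
    rw [← hΘ t, hD, hP, hP, hD, permOp_powD_apply]
  have hsplit : ∀ t, powDer n Y d' t = powD n Y t + powDer n Y ν t := by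
    intro t
    rw [powD_eq_powDer, ← LinearMap.add_apply, ← powDer_add, hν, add_sub_cancel]
  -- Starting from the `B` part, the perturbation reaches only strictly smaller counts, so it is
  -- invisible in components `A` whose counts are not below those of `B`.
  have hlow : ∀ (A B : Finset (Fin n → Bool)) (t : Pow n Y), setIdem e B t = t →
      (∀ f ∈ A, ∀ g ∈ B, trueCount g ≤ trueCount f) →
      setIdem e A (powDer n Y d' t) = powD n Y (setIdem e A t) := by
    intro A B t ht hAB
    have := LinearMap.congr_fun (setIdem_powDer he hν1 hν2 hAB) t
    rw [Module.End.mul_apply, Module.End.mul_apply, ht, LinearMap.zero_apply] at this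
    rw [hsplit, map_add, this, add_zero, powD_setIdem_apply he]
  have hrot : ∀ j (f : Fin n → Bool), f ∘ finRotate n ∈ countEq n j ↔ f ∈ countEq n j := by
    intro j f
    rw [mem_countEq, mem_countEq, trueCount_comp]
  have hdg : ∀ j, IsDG (powDer n Y d') (weightDeg e (finRotate n) (countLt n j) c) := by
    intro j
    refine ⟨fun {m k} hk t ht => ?_, fun m t _ => ?_⟩
    · rw [mem_weightDeg] at ht
      refine mem_weightDeg.2 ⟨?_, ?_, ?_⟩
      · obtain rfl : k = m - 1 := by omega
        rw [← hΘ t, hD]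
        exact map_mem_powDeg (fun _ => hθ) _ (powD_mem _ (map_mem_powDeg (fun _ => hθ') t ht.1))
      · rw [hDP, ht.2.1, map_smul]
      · have h3 := hlow (countLt n j)ᶜ (countLt n j) t ht.2.2 (by
          intro f hf g hg
          rw [Finset.mem_compl, mem_countLt] at hf
          rw [mem_countLt] at hg
          omega)
        rw [← ht.2.2, setIdem_setIdem_apply he, Finset.inter_comm, Finset.inter_compl,
          setIdem_empty, LinearMap.zero_apply, map_zero, ht.2.2] at h3
        have h4 := setIdem_union (e := e) (disjoint_compl_right (a := countLt n j))
        rw [Finset.union_compl, setIdem_univ he] at h4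
        have h5 := LinearMap.congr_fun h4 (powDer n Y d' t)
        rw [LinearMap.add_apply, h3, add_zero] at h5
        exact h5.symm
    · rw [← hΘ t, hD, hD, powD_powD, map_zero]
  -- Perfectness and class are proved together up the filtration. The subcomplexes carry the
  -- transported differential, while the graded piece of count `j` carries the unperturbed one.
  have hind : ∀ j, PerfDG Z (powDer n Y d') (weightDeg e (finRotate n) (countLt n j) c) ∧
      dgClass Z (powDer n Y d') (weightDeg e (finRotate n) (countLt n j) c) =
        ∑ i ∈ Finset.range j,
          dgClass Z (powD n Y) (weightDeg e (finRotate n) (countEq n i) c) := by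
    intro j
    induction j with
    | zero =>
      have h0 : ∀ m, weightDeg e (finRotate n) (countLt n 0) c m = ⊥ := by
        intro m
        refine (Submodule.eq_bot_iff _).2 fun t ht => ?_
        have h3 : countLt n 0 = ∅ := by ext; simp [countLt]
        rw [← (mem_weightDeg.1 ht).2.2, h3, setIdem_empty, LinearMap.zero_apply]
      exact ⟨perfDG_of_eq_bot h0, dgClass_of_eq_bot h0⟩
    | succ j ih =>
      have hex : DGExact (powDer n Y d') (weightDeg e (finRotate n) (countLt n j) c)
          (powDer n Y d') (weightDeg e (finRotate n) (countLt n (j + 1)) c)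
          (powD n Y) (weightDeg e (finRotate n) (countEq n j) c) LinearMap.id
          (setIdem e (countEq n j)) := by
        have hdisj : Disjoint (countLt n j) (countEq n j) := by
          rw [Finset.disjoint_left]
          intro f hf
          rw [mem_countLt] at hf
          rw [mem_countEq]
          omega
        have hun : countLt n (j + 1) = countLt n j ∪ countEq n j := by
          ext f
          rw [Finset.mem_union, mem_countLt, mem_countLt, mem_countEq]
          omega
        refine ⟨?_, ?_, fun _ _ _ => rfl, ?_, ?_, fun _ _ _ h => h, ?_, ?_⟩
        · intro m t ht
          rw [mem_weightDeg] at ht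
          refine mem_weightDeg.2 ⟨ht.1, ht.2.1, ?_⟩
          change setIdem e (countLt n (j + 1)) t = t
          rw [← ht.2.2, setIdem_setIdem_apply he, hun, Finset.union_inter_cancel_left]
        · intro m t ht
          rw [mem_weightDeg] at ht
          refine mem_weightDeg.2 ⟨setIdem_mem he _ ht.1, ?_, ?_⟩
          · rw [permOp_setIdem_apply he (hrot j), ht.2.1, map_smul]
          · rw [setIdem_setIdem_apply he, Finset.inter_self]
        · intro m t ht
          refine hlow _ _ t (mem_weightDeg.1 ht).2.2 fun f hf g hg => ?_
          rw [mem_countEq] at hf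
          rw [mem_countLt] at hg
          omega
        · intro m t ht
          change setIdem e (countEq n j) t = 0
          rw [← (mem_weightDeg.1 ht).2.2, setIdem_setIdem_apply he,
            Finset.disjoint_iff_inter_eq_empty.1 hdisj.symm, setIdem_empty, LinearMap.zero_apply]
        · intro m t ht
          refine ⟨t, ?_, (mem_weightDeg.1 ht).2.2⟩
          rw [mem_weightDeg] at ht
          refine mem_weightDeg.2 ⟨ht.1, ht.2.1, ?_⟩
          rw [← ht.2.2, setIdem_setIdem_apply he, hun, Finset.union_inter_cancel_right]
        · intro m t ht h3
          refine ⟨t, ?_, rfl⟩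
          rw [mem_weightDeg] at ht
          refine mem_weightDeg.2 ⟨ht.1, ht.2.1, ?_⟩
          have h4 := ht.2.2
          rw [hun, setIdem_union hdisj, LinearMap.add_apply, h3, add_zero] at h4
          exact h4
      have hp := perfDG_weightDeg he hY hc hn (hrot j)
      exact ⟨hex.perf ih.1 (hdg _) hp, by
        rw [hex.class_eq ih.1 (hdg _) hp, ih.2, Finset.sum_range_succ]⟩
  have huniv : countLt n (n + 1) = Finset.univ := by
    ext f
    simp [mem_countLt, trueCount_le]
  rw [← (hind (n + 1)).2, huniv, weightDeg_univ he]
  refine DGIso.class_eq (φ := Θ) (ψ := Θ') ⟨?_, ?_, fun _ t _ => hΘ' t, fun _ t _ => hΘ t,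
    fun _ t _ => (hD t).symm⟩ (isDG_eigenDeg c)
  · intro m t ht
    rw [mem_eigenDeg] at ht ⊢
    refine ⟨map_mem_powDeg (fun _ => hθ) t ht.1, ?_⟩
    rw [hP, ht.2, map_smul]
  · intro m t ht
    rw [mem_eigenDeg] at ht ⊢
    refine ⟨map_mem_powDeg (fun _ => hθ') t ht.1, ?_⟩
    rw [hP', ht.2, map_smul]

end Filtration

/-! ### Eigencomplexes of the middle term of a short exact sequence -/

section ShortExactSequences

variable {Q : Type u} [CommRing Q] {Z : Set (PrimeSpectrum Q)}

/-- The direct sum of two objects of `𝒫^Z(Q)`. -/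
noncomputable def PerfComplex.biprod (X X' : PerfComplex Z) : PerfComplex Z :=
  ⟨X.1 ⊞ X'.1, IsPerfectOn.of_shortExact
    (ShortComplex.Splitting.ofHasBinaryBiproduct X.1 X'.1).shortExact X.2 X'.2⟩

lemma K0.cls_biprod (X X' : PerfComplex Z) :
    K0.cls (X.biprod X') = K0.cls X + K0.cls X' :=
  K0.cls_shortExact (X := X.biprod X')
    (ShortComplex.Splitting.ofHasBinaryBiproduct X.1 X'.1).shortExact

lemma isDecomp_of_biproduct {X X' Y : ChainComplex (ModuleCat.{u} Q) ℤ} {inl : X ⟶ Y} {inr : X' ⟶ Y}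
    {fst : Y ⟶ X} {snd : Y ⟶ X'} (h1 : inl ≫ fst = 𝟙 X) (h2 : inr ≫ snd = 𝟙 X')
    (h3 : inl ≫ snd = 0) (h4 : inr ≫ fst = 0) (h5 : fst ≫ inl + snd ≫ inr = 𝟙 Y) :
    IsDecomp fun b : Bool => if b then totMap (snd ≫ inr) else totMap (fst ≫ inl) where
  deg := by
    intro b
    cases b <;> exact isDeg_totMap _
  comm := by
    intro b
    cases b <;> exact totD_totMap _
  orth := by
    intro b b'
    cases b <;> cases b' <;>
    simp [Module.End.mul_eq_comp, ← totMap_comp, totMap_zero, reassoc_of% h1, reassoc_of% h2,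
      reassoc_of% h3, reassoc_of% h4]
  sum := by
    rw [Fintype.sum_bool]
    simp only [if_true, Bool.false_eq_true, if_false]
    rw [← totMap_add, add_comm, h5, totMap_id]
    rfl

/-- In the filtration by the number of factors from `X''`, the counts `0` and `p` give the tensor
powers of `X'` and `X''`. The counts in between involve only nonconstant functions, so their total
`N` serves all eigenvalues at once. -/
lemma dgClass_eigenDeg_shortExact {p : ℕ} [Fact p.Prime] {X' X X'' : PerfComplex Z}
    {f : X'.1 ⟶ X.1} {g : X.1 ⟶ X''.1} {w : f ≫ g = 0}
    (h : (ShortComplex.mk f g w).ShortExact) (hp : IsUnit (p : Q)) :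
    ∃ N : K0 Z, ∀ c : Q, c ^ p = 1 → dgClass Z (powD p X.1) (eigenDeg p X.1 c) =
      dgClass Z (powD p X'.1) (eigenDeg p X'.1 c) +
      dgClass Z (powD p X''.1) (eigenDeg p X''.1 c) + N := by
  have hp0 : p.Prime := Fact.out
  have : NeZero p := ⟨hp0.ne_zero⟩
  -- The splittings are chosen degree by degree and need not commute with the differentials.
  have hsplit : ∀ i, ∃ (r : X.1.X i →ₗ[Q] X'.1.X i) (s : X''.1.X i →ₗ[Q] X.1.X i),
      (∀ x, r ((f.f i).hom x) = x) ∧ (∀ x, (g.f i).hom (s x) = x) ∧ (∀ x, r (s x) = 0) ∧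
      ∀ x, (f.f i).hom (r x) + s ((g.f i).hom x) = x := by
    intro i
    have := X''.2.projective i
    obtain ⟨s, hs⟩ := Module.projective_lifting_property (g.f i).hom LinearMap.id
      (degree_surjective h i)
    obtain ⟨e, he1, he2⟩ :=
      (degree_exact h i).splitSurjectiveEquiv (degree_injective h i) ⟨s, hs⟩
    have he1 : ∀ x, (f.f i).hom x = e.symm (x, 0) := fun x => LinearMap.congr_fun he1 x
    have he2 : ∀ x, (g.f i).hom x = (e x).2 := fun x => LinearMap.congr_fun he2 x
    refine ⟨LinearMap.fst Q _ _ ∘ₗ e.toLinearMap, e.symm.toLinearMap ∘ₗ LinearMap.inr Q _ _,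
      fun x => ?_, fun x => ?_, fun x => ?_, fun x => ?_⟩
    · simp [he1]
    · simp [he2]
    · simp
    · apply e.injective
      simp [he1, he2]
  choose r s hrf hgs hrs hfs using hsplit
  have hgf : ∀ i x, (g.f i).hom ((f.f i).hom x) = 0 := fun i x =>
    (degree_exact h i).apply_apply_eq_zero x
  obtain ⟨Y, hY, inl, inr, fst, snd, h1, h2, h3, h4, h5⟩ :
      ∃ (Y : ChainComplex (ModuleCat.{u} Q) ℤ) (_ : IsPerfectOn Z Y) (inl : X'.1 ⟶ Y)
        (inr : X''.1 ⟶ Y) (fst : Y ⟶ X'.1) (snd : Y ⟶ X''.1), inl ≫ fst = 𝟙 _ ∧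
        inr ≫ snd = 𝟙 _ ∧ inl ≫ snd = 0 ∧ inr ≫ fst = 0 ∧ fst ≫ inl + snd ≫ inr = 𝟙 _ :=
    ⟨X'.1 ⊞ X''.1, (X'.biprod X'').2, Limits.biprod.inl, Limits.biprod.inr, Limits.biprod.fst,
      Limits.biprod.snd, by simp, by simp, by simp, by simp, Limits.biprod.total⟩
  have k1 : ∀ i x, (fst.f i).hom ((inl.f i).hom x) = x := fun i x =>
    congrArg (fun φ : X'.1 ⟶ X'.1 => (φ.f i).hom x) h1
  have k2 : ∀ i x, (snd.f i).hom ((inr.f i).hom x) = x := fun i x =>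
    congrArg (fun φ : X''.1 ⟶ X''.1 => (φ.f i).hom x) h2
  have k3 : ∀ i x, (snd.f i).hom ((inl.f i).hom x) = 0 := fun i x =>
    congrArg (fun φ : X'.1 ⟶ X''.1 => (φ.f i).hom x) h3
  have k4 : ∀ i x, (fst.f i).hom ((inr.f i).hom x) = 0 := fun i x =>
    congrArg (fun φ : X''.1 ⟶ X'.1 => (φ.f i).hom x) h4
  have k5 : ∀ i x, (inl.f i).hom ((fst.f i).hom x) + (inr.f i).hom ((snd.f i).hom x) = x :=
    fun i x => congrArg (fun φ : Y ⟶ Y => (φ.f i).hom x) h5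
  have he := isDecomp_of_biproduct h1 h2 h3 h4 h5
  set e : Bool → (Tot Y →ₗ[Q] Tot Y) := fun b =>
    if b then totMap (snd ≫ inr) else totMap (fst ≫ inl)
  -- An isomorphism of graded modules from `X` to the direct sum, in general not a chain map.
  let θ : Tot X.1 →ₗ[Q] Tot Y := DirectSum.toModule Q ℤ _ fun i =>
    inc Y i ∘ₗ ((inl.f i).hom ∘ₗ r i + (inr.f i).hom ∘ₗ (g.f i).hom)
  let θ' : Tot Y →ₗ[Q] Tot X.1 := DirectSum.toModule Q ℤ _ fun i =>
    inc X.1 i ∘ₗ ((f.f i).hom ∘ₗ (fst.f i).hom + s i ∘ₗ (snd.f i).hom)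
  have hθ : ∀ i x, θ (inc X.1 i x) =
      inc Y i ((inl.f i).hom (r i x) + (inr.f i).hom ((g.f i).hom x)) := by
    intro i x
    simp [θ, inc]
  have hθ' : ∀ i x, θ' (inc Y i x) =
      inc X.1 i ((f.f i).hom ((fst.f i).hom x) + s i ((snd.f i).hom x)) := by
    intro i x
    simp [θ', inc]
  have e1 : θ ∘ₗ θ' = LinearMap.id := by
    refine DirectSum.linearMap_ext Q fun i => LinearMap.ext fun x => ?_
    rw [LinearMap.comp_apply, LinearMap.comp_apply, hθ', hθ, map_add (r i), map_add (g.f i).hom,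
      hrf, hrs,
      hgs, hgf, add_zero, zero_add, k5]
    rfl
  have e2 : θ' ∘ₗ θ = LinearMap.id := by
    refine DirectSum.linearMap_ext Q fun i => LinearMap.ext fun x => ?_
    rw [LinearMap.comp_apply, LinearMap.comp_apply, hθ, hθ', map_add (fst.f i).hom,
      map_add (snd.f i).hom, k1, k2, k3, k4, add_zero, zero_add, hfs]
    rfl
  -- The component of `θ` in the second summand, and the restriction of `θ'` to the first (`e4`), do
  -- come from chain maps. These are the two triangularity conditions.
  have e3 : e true ∘ₗ θ = totMap (g ≫ inr) := by
    refine DirectSum.linearMap_ext Q fun i => LinearMap.ext fun x => ?_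
    rw [LinearMap.comp_apply, LinearMap.comp_apply, hθ, LinearMap.comp_apply, totMap_inc]
    refine (totMap_inc (snd ≫ inr) i _).trans ?_
    change inc Y i ((inr.f i).hom ((snd.f i).hom _)) = inc Y i ((inr.f i).hom ((g.f i).hom x))
    rw [map_add, k2, k3, zero_add]
  have e4 : θ' ∘ₗ e false = totMap (fst ≫ f) := by
    refine DirectSum.linearMap_ext Q fun i => LinearMap.ext fun x => ?_
    have : e false (inc Y i x) = inc Y i ((inl.f i).hom ((fst.f i).hom x)) :=
      totMap_inc (fst ≫ inl) i x
    rw [LinearMap.comp_apply, LinearMap.comp_apply, this, hθ', k1, k3, map_zero, add_zero,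
      LinearMap.comp_apply, totMap_inc]
    rfl
  have key := fun c hc => dgClass_eigenDeg_of_triangular (Z := Z) (n := p) (c := c) he hY
    (θ := θ) (θ' := θ') (X := X.1) (fun i x => by rw [hθ]; exact ⟨_, rfl⟩)
    (fun i x => by rw [hθ']; exact ⟨_, rfl⟩) e1 e2 (by
      rw [Module.End.mul_eq_comp, ← LinearMap.comp_assoc, ← LinearMap.comp_assoc, e3, ← totD_totMap,
        ← e3, LinearMap.comp_assoc, LinearMap.comp_assoc, e1, LinearMap.comp_id]
      rfl) (by
      rw [Module.End.mul_eq_comp, LinearMap.comp_assoc, LinearMap.comp_assoc, e4, totD_totMap,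
        ← e4, ← LinearMap.comp_assoc, ← LinearMap.comp_assoc, e1, LinearMap.id_comp]
      exact (he.comm false).symm) hc hp
  refine ⟨∑ j ∈ Finset.Ico 1 p, dgClass Z (powD p Y)
    (weightDeg e (finRotate p) (countEq p j) 1), fun c hc => ?_⟩
  have g0 : countEq p 0 = {Function.const _ false} := by
    ext f
    rw [mem_countEq, trueCount_eq_zero, Finset.mem_singleton]
  have g1 : countEq p p = {Function.const _ true} := by
    ext f
    rw [mem_countEq, trueCount_eq, Finset.mem_singleton]
  rw [key c hc, Finset.sum_range_succ, Finset.range_eq_Ico, Finset.sum_eq_sum_Ico_succ_bot hp0.pos,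
    g0, g1, dgClass_weightDeg_const false inl fst h1 rfl,
    dgClass_weightDeg_const true inr snd h2 rfl, add_right_comm]
  congr 1
  refine Finset.sum_congr rfl fun j hj => ?_
  rw [Finset.mem_Ico] at hj
  refine dgClass_weightDeg_nonconst he (fun f => ?_) (fun b hb => ?_) hc
  · rw [mem_countEq, mem_countEq, trueCount_comp]
  · rw [mem_countEq] at hb
    cases b
    · rw [trueCount_eq_zero.2 rfl] at hb
      omega
    · rw [trueCount_eq.2 rfl] at hb
      omega

end ShortExactSequences

/-! ### Homology and quasi-isomorphisms in terms of elements -/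

section Homology

variable {Q : Type u} [CommRing Q] {X Y : ChainComplex (ModuleCat.{u} Q) ℤ}

lemma exists_cycles (K : ChainComplex (ModuleCat.{u} Q) ℤ) {i j : ℤ} (h : j + 1 = i) (z : K.X i)
    (hz : (K.d i j).hom z = 0) : ∃ c : K.cycles i, (K.iCycles i).hom c = z := by
  have hk := K.cyclesIsKernel i j (by
    rw [← (ComplexShape.down ℤ).next_eq' (show (ComplexShape.down ℤ).Rel i j from h)])
  exact (ShortComplex.moduleCat_exact_iff _).1
    (ShortComplex.exact_of_f_is_kernel (ShortComplex.mk (K.iCycles i) (K.d i j) (by simp)) hk) z hz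

lemma iCycles_injective (K : ChainComplex (ModuleCat.{u} Q) ℤ) (i : ℤ) :
    Function.Injective (K.iCycles i).hom :=
  (ModuleCat.mono_iff_injective _).1 inferInstance

lemma homologyπ_surjective (K : ChainComplex (ModuleCat.{u} Q) ℤ) (i : ℤ) :
    Function.Surjective (K.homologyπ i).hom :=
  (ModuleCat.epi_iff_surjective _).1 inferInstance

lemma d_iCycles_apply (K : ChainComplex (ModuleCat.{u} Q) ℤ) (i j : ℤ) (c : K.cycles i) :
    (K.d i j).hom ((K.iCycles i).hom c) = 0 :=
  congrArg (fun φ => φ.hom c) (K.iCycles_d i j)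

lemma homologyπ_eq_zero (K : ChainComplex (ModuleCat.{u} Q) ℤ) {i j : ℤ} (h : j + 1 = i)
    (c : K.cycles j) : (K.homologyπ j).hom c = 0 ↔
      ∃ w : K.X i, (K.d i j).hom w = (K.iCycles j).hom c := by
  have hk := K.homologyIsCokernel i j (by
    rw [← (ComplexShape.down ℤ).prev_eq' (show (ComplexShape.down ℤ).Rel i j from h)])
  have htoc : ∀ w : K.X i, (K.iCycles j).hom ((K.toCycles i j).hom w) = (K.d i j).hom w :=
    fun w => congrArg (fun φ => φ.hom w) (K.toCycles_i i j)
  have hex := (ShortComplex.moduleCat_exact_iff _).1 (ShortComplex.exact_of_g_is_cokernel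
    (ShortComplex.mk (K.toCycles i j) (K.homologyπ j) (by simp)) hk)
  constructor
  · intro hc
    obtain ⟨w, hw⟩ := hex c hc
    refine ⟨w, ?_⟩
    rw [← htoc]
    exact congrArg _ hw
  · rintro ⟨w, hw⟩
    obtain rfl : (K.toCycles i j).hom w = c := iCycles_injective K j ((htoc w).trans hw)
    exact congrArg (fun φ => φ.hom w) (K.toCycles_comp_homologyπ i j)

lemma homologyMap_π_apply (f : X ⟶ Y) (i : ℤ) (c : X.cycles i) :
    (HomologicalComplex.homologyMap f i).hom ((X.homologyπ i).hom c) =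
      (Y.homologyπ i).hom ((HomologicalComplex.cyclesMap f i).hom c) :=
  congrArg (fun φ => φ.hom c) (HomologicalComplex.homologyπ_naturality f i)

lemma iCycles_cyclesMap_apply (f : X ⟶ Y) (i : ℤ) (c : X.cycles i) :
    (Y.iCycles i).hom ((HomologicalComplex.cyclesMap f i).hom c) =
      (f.f i).hom ((X.iCycles i).hom c) :=
  congrArg (fun φ => φ.hom c) (HomologicalComplex.cyclesMap_i f i)

/-- Injectivity on homology, in the form used for the mapping cone. -/
lemma exists_boundary_of_quasiIso (f : X ⟶ Y) [QuasiIso f] {i j k : ℤ} (h : j + 1 = i)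
    (hk : k + 1 = j) (z : X.X j)
    (hz : (X.d j k).hom z = 0) (y : Y.X i) (hy : (Y.d i j).hom y = (f.f j).hom z) :
    ∃ x : X.X i, (X.d i j).hom x = z := by
  obtain ⟨c, rfl⟩ := exists_cycles X hk z hz
  refine (homologyπ_eq_zero X h c).1 ?_
  have hinj : Function.Injective (HomologicalComplex.homologyMap f j).hom :=
    (ModuleCat.mono_iff_injective _).1 inferInstance
  refine hinj ?_
  rw [homologyMap_π_apply, map_zero, homologyπ_eq_zero Y h]
  exact ⟨y, by rw [iCycles_cyclesMap_apply, hy]⟩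

/-- Surjectivity on homology, with the bounding element made explicit. -/
lemma exists_cycle_of_quasiIso (f : X ⟶ Y) [QuasiIso f] {i j k : ℤ} (h : j + 1 = i)
    (hk : k + 1 = j) (y : Y.X j) (hy : (Y.d j k).hom y = 0) :
    ∃ (z : X.X j) (w : Y.X i), (X.d j k).hom z = 0 ∧
      (Y.d i j).hom w = (f.f j).hom z - y := by
  obtain ⟨c, rfl⟩ := exists_cycles Y hk y hy
  have hsurj : Function.Surjective (HomologicalComplex.homologyMap f j).hom :=
    (ModuleCat.epi_iff_surjective _).1 inferInstance
  obtain ⟨a, ha⟩ := hsurj ((Y.homologyπ j).hom c)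
  obtain ⟨b, rfl⟩ := homologyπ_surjective X j a
  rw [homologyMap_π_apply, ← sub_eq_zero, ← map_sub, homologyπ_eq_zero Y h] at ha
  obtain ⟨w, hw⟩ := ha
  exact ⟨_, w, d_iCycles_apply X j k b, by rw [hw, map_sub, iCycles_cyclesMap_apply]⟩

end Homology

/-! ### Shifts, mapping cones and maps out of the Grothendieck group -/

section Cones

variable {Q : Type u} [CommRing Q] {X Y : ChainComplex (ModuleCat.{u} Q) ℤ}
variable {V : Type u} [AddCommGroup V] [Module Q V] {D : V →ₗ[Q] V} {W : ℤ → Submodule Q V}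

/-- The map `s` is a null-homotopy of multiplication by `r`, so `r` kills the homology and the prime
is outside its support. -/
lemma support_subset_of_contraction {Z : Set (PrimeSpectrum Q)} (hD : IsDG D W)
    (h : ∀ P ∉ Z, ∃ r ∉ P.asIdeal, ∃ s : V →ₗ[Q] V,
      (∀ {m k : ℤ}, m + 1 = k → ∀ t ∈ W m, s t ∈ W k) ∧
      ∀ m, ∀ t ∈ W m, D (s t) + s (D t) = r • t) (i : ℤ) :
    Module.support Q ((subCx D W hD).homology i) ⊆ Z := by
  refine support_subset_of_homotopy (fun P hP => ?_) i
  obtain ⟨r, hr, s, hs, H⟩ := h P hP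
  refine ⟨r, hr, ⟨?_⟩⟩
  let hom : ∀ i j : ℤ, (subCx D W hD).X i ⟶ (subCx D W hD).X j := fun i j =>
    if hij : i + 1 = j then ModuleCat.ofHom (s.restrict (hs hij)) else 0
  refine { hom := hom, zero := fun i j hij => dif_neg hij, comm := fun i => ?_ }
  rw [dNext_eq hom (show (ComplexShape.down ℤ).Rel i (i - 1) by simp),
    prevD_eq hom (show (ComplexShape.down ℤ).Rel (i + 1) i by simp)]
  refine ModuleCat.hom_ext (LinearMap.ext fun t => Subtype.ext ?_)
  have e1 : hom (i - 1) i = ModuleCat.ofHom (s.restrict (hs (by ring))) := dif_pos (by ring)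
  have e2 : hom i (i + 1) = ModuleCat.ofHom (s.restrict (hs rfl)) := dif_pos rfl
  rw [e1, e2, subCx_d hD (show i - 1 + 1 = i by ring), subCx_d hD (rfl : i + 1 = i + 1)]
  change r • t.1 = s (D t.1) + D (s t.1) + 0
  rw [add_zero, add_comm, H i t.1 t.2]

/-- Zero homology is supported anywhere. Below, `IsPerfectOn ∅` is the way to say that a perfect
complex is acyclic; in this form, acyclicity passes to eigencomplexes by `isPerfectOn_eigenComplex`
for the empty set. -/
lemma isPerfectOn_of_acyclic {Z : Set (PrimeSpectrum Q)} {Z' : Set (PrimeSpectrum Q)}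
    {K : ChainComplex (ModuleCat.{u} Q) ℤ} (hK : IsPerfectOn Z K)
    (h : ∀ i, ∀ z : K.X i, (K.d i (i - 1)).hom z = 0 → ∃ w, (K.d (i + 1) i).hom w = z) :
    IsPerfectOn Z' K := by
  refine ⟨hK.finite, hK.projective, hK.bounded, fun i => ?_⟩
  have : Subsingleton (K.homology i) := by
    refine ⟨fun a b => ?_⟩
    have h0 : ∀ a : K.homology i, a = 0 := by
      intro a
      obtain ⟨c, rfl⟩ := homologyπ_surjective K i a
      exact (homologyπ_eq_zero K rfl c).2 (h i _ (d_iCycles_apply K i (i - 1) c))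
    rw [h0 a, h0 b]
  rw [Module.support_eq_empty]
  exact Set.empty_subset _

/-- The terms of the shifted complex. -/
noncomputable def shiftDeg (X : ChainComplex (ModuleCat.{u} Q) ℤ) (m : ℤ) : Submodule Q (Tot X) :=
  totDeg X (m - 1)

lemma totD_totD_apply (x : Tot X) : totD X (totD X x) = 0 :=
  LinearMap.congr_fun (totD_mul_totD (X := X)) x

lemma totD_totMap_apply (f : X ⟶ Y) (x : Tot X) : totD Y (totMap f x) = totMap f (totD X x) :=
  LinearMap.congr_fun (totD_totMap f) x

lemma totMap_mem (f : X ⟶ Y) {m : ℤ} {x : Tot X} (hx : x ∈ totDeg X m) :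
    totMap f x ∈ totDeg Y m := by
  obtain ⟨x, rfl⟩ := hx
  exact isDeg_totMap f m x

lemma isDG_shift (X : ChainComplex (ModuleCat.{u} Q) ℤ) : IsDG (-totD X) (shiftDeg X) where
  mem hk t ht := neg_mem ((isDG_tot X).mem (by omega) t ht)
  sq m t _ := by simp [totD_totD_apply]

lemma perfDG_shift {Z : Set (PrimeSpectrum Q)} (hX : IsPerfectOn Z X) :
    PerfDG Z (-totD X) (shiftDeg X) := by
  have e (m : ℤ) : X.X (m - 1) ≃ₗ[Q] shiftDeg X m := LinearEquiv.ofInjective _ (inc_injective _)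
  refine ⟨isDG_shift X, fun m => ?_, fun m => ?_, ?_,
    support_subset_of_contraction _ fun P hP => ?_⟩
  · have := hX.finite (m - 1)
    exact Module.Finite.equiv (e m)
  · have := hX.projective (m - 1)
    exact Module.Projective.of_equiv (e m)
  · obtain ⟨a, b, hab⟩ := hX.bounded
    refine ⟨a + 1, b + 1, fun m hm => ?_⟩
    have := hab (m - 1) (by omega)
    exact (e m).symm.toEquiv.subsingleton
  · obtain ⟨r, hr, h, hh, H⟩ := exists_contraction hX hP
    refine ⟨r, hr, -h, ?_, fun m t _ => ?_⟩
    · rintro m k rfl _ ⟨x, rfl⟩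
      have := hh (m - 1) x
      rw [sub_add_cancel] at this
      refine neg_mem ?_
      rw [shiftDeg, add_sub_cancel_right]
      exact this
    · have := LinearMap.congr_fun H t
      simpa using this

/-- The differential of the mapping cone. -/
noncomputable def coneD (f : X ⟶ Y) : (Tot Y × Tot X) →ₗ[Q] (Tot Y × Tot X) :=
  LinearMap.prod (totD Y ∘ₗ LinearMap.fst Q _ _ + totMap f ∘ₗ LinearMap.snd Q _ _)
    (-(totD X ∘ₗ LinearMap.snd Q _ _))

/-- The terms of the mapping cone. -/
noncomputable def coneDeg (X Y : ChainComplex (ModuleCat.{u} Q) ℤ) (m : ℤ) :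
    Submodule Q (Tot Y × Tot X) :=
  (totDeg Y m).prod (shiftDeg X m)

lemma coneD_apply (f : X ⟶ Y) (y : Tot Y) (x : Tot X) :
    coneD f (y, x) = (totD Y y + totMap f x, -totD X x) := rfl

lemma isDG_cone (f : X ⟶ Y) : IsDG (coneD f) (coneDeg X Y) where
  mem := by
    rintro m k hk ⟨y, x⟩ ⟨hy, hx⟩
    refine ⟨add_mem ((isDG_tot Y).mem hk y hy) (totMap_mem f ?_), (isDG_shift X).mem hk x hx⟩
    obtain rfl : k = m - 1 := by omega
    exact hx
  sq := by
    rintro m ⟨y, x⟩ -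
    simp [coneD_apply, totD_totD_apply, totD_totMap_apply]

lemma dgExact_cone (f : X ⟶ Y) : DGExact (totD Y) (totDeg Y) (coneD f) (coneDeg X Y) (-totD X)
    (shiftDeg X) (LinearMap.inl Q (Tot Y) (Tot X)) (LinearMap.snd Q (Tot Y) (Tot X)) where
  map_mem m t ht := ⟨ht, zero_mem _⟩
  map_mem' m t ht := ht.2
  comm m t _ := by simp [coneD_apply]
  comm' m t _ := rfl
  zero m t _ := rfl
  inj m t _ h := congrArg Prod.fst h
  surj m t ht := ⟨(0, t), ⟨zero_mem _, ht⟩, rfl⟩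
  exact := by
    rintro m ⟨y, x⟩ ⟨hy, hx⟩ h
    exact ⟨y, hy, Prod.ext rfl h.symm⟩

variable {Z : Set (PrimeSpectrum Q)}

lemma perfDG_cone {X Y : PerfComplex Z} (f : X.1 ⟶ Y.1) : PerfDG Z (coneD f) (coneDeg X.1 Y.1) :=
  (dgExact_cone f).perf (perfDG_tot Y) (isDG_cone f) (perfDG_shift X.2)

/-- The shifted complex. -/
noncomputable def PerfComplex.shift (X : PerfComplex Z) : PerfComplex Z :=
  ⟨subCx _ _ (isDG_shift X.1), (perfDG_shift X.2).2⟩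

/-- The mapping cone. -/
noncomputable def PerfComplex.cone {X Y : PerfComplex Z} (f : X.1 ⟶ Y.1) : PerfComplex Z :=
  ⟨subCx _ _ (isDG_cone f), (perfDG_cone f).2⟩

lemma PerfComplex.cone_acyclic {X Y : PerfComplex Z} (f : X.1 ⟶ Y.1) [QuasiIso f] :
    IsPerfectOn ∅ (PerfComplex.cone f).1 := by
  refine isPerfectOn_of_acyclic (PerfComplex.cone f).2 fun i t ht => ?_
  obtain ⟨⟨y, x⟩, hy, hx⟩ := t
  change ((subCx _ _ (isDG_cone f)).d i (i - 1)).hom _ = 0 at ht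
  change ∃ w, ((subCx _ _ (isDG_cone f)).d (i + 1) i).hom w = _
  rw [subCx_d _ (by ring)] at ht
  rw [subCx_d _ rfl]
  have ht' : coneD f (y, x) = 0 := congrArg Subtype.val ht
  rw [coneD_apply] at ht'
  have ht1 : totD Y.1 y + totMap f x = 0 := congrArg Prod.fst ht'
  have ht2 : totD X.1 x = 0 := neg_eq_zero.1 (congrArg Prod.snd ht')
  change y ∈ totDeg Y.1 i at hy
  change x ∈ totDeg X.1 (i - 1) at hx
  obtain ⟨y, rfl⟩ := hy
  obtain ⟨x, rfl⟩ := hx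
  rw [totD_inc, totMap_inc, ← map_add, map_eq_zero_iff _ (inc_injective _)] at ht1
  rw [totD_inc, map_eq_zero_iff _ (inc_injective _)] at ht2
  -- A cycle `(y, x)` of the cone has `f x = -d y`, so `x = d x1` by injectivity on homology. Then
  -- `y + f x1` is a cycle, so by surjectivity `d w = f z - (y + f x1)` for a cycle `z`. The pair
  -- `(-w, z - x1)` bounds `(y, x)`.
  obtain ⟨x1, hx1⟩ := exists_boundary_of_quasiIso f (show i - 1 + 1 = i by ring)
    (sub_add_cancel (i - 1) 1) x ht2 (-y) (by rw [map_neg, neg_eq_iff_add_eq_zero, ht1])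
  have hcomm : (Y.1.d i (i - 1)).hom ((f.f i).hom x1) =
      (f.f (i - 1)).hom ((X.1.d i (i - 1)).hom x1) :=
    congrArg (fun φ => φ.hom x1) (f.comm i (i - 1))
  obtain ⟨z, w, hz, hw⟩ := exists_cycle_of_quasiIso f (rfl : i + 1 = i + 1)
    (sub_add_cancel i 1) (y + (f.f i).hom x1) (by rw [map_add, hcomm, hx1, ht1])
  refine ⟨⟨(inc Y.1 (i + 1) (-w), inc X.1 i (z - x1)), ⟨_, rfl⟩, ?_⟩, Subtype.ext ?_⟩
  · change _ ∈ totDeg X.1 (i + 1 - 1)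
    rw [add_sub_cancel_right]
    exact ⟨_, rfl⟩
  · change coneD f (inc Y.1 (i + 1) (-w), inc X.1 i (z - x1)) = _
    rw [coneD_apply, totD_inc' rfl, totMap_inc, totD_inc, ← map_add]
    refine Prod.ext ?_ ?_
    · change inc Y.1 i _ = inc Y.1 i y
      rw [map_neg, hw, map_sub]
      congr 1
      abel
    · change -inc X.1 (i - 1) _ = inc X.1 (i - 1) x
      rw [map_sub, hz, hx1, ← map_neg, zero_sub, neg_neg]

/-- The zero complex. -/
noncomputable def PerfComplex.zero (Z : Set (PrimeSpectrum Q)) : PerfComplex Z :=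
  ⟨subCx (0 : Q →ₗ[Q] Q) (fun _ => ⊥) (perfDG_of_eq_bot (Z := Z) fun _ => rfl).1,
    (perfDG_of_eq_bot (Z := Z) fun _ => rfl).2⟩

lemma PerfComplex.zero_subsingleton (i : ℤ) : Subsingleton ((PerfComplex.zero Z).1.X i) :=
  inferInstanceAs (Subsingleton (⊥ : Submodule Q Q))

/-- The map from the zero complex is a quasi-isomorphism. -/
lemma K0.cls_acyclic {X : PerfComplex Z} (h : IsPerfectOn ∅ X.1) : K0.cls X = 0 := by
  let O := PerfComplex.zero Z
  have hO : ∀ i, Subsingleton (O.1.X i) := PerfComplex.zero_subsingleton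
  have hq : QuasiIso (0 : O.1 ⟶ X.1) := by
    refine ⟨fun i => (quasiIsoAt_iff_isIso_homologyMap _ _).2 ?_⟩
    have h1 : Subsingleton (X.1.homology i) :=
      Module.support_eq_empty_iff.1 (Set.subset_empty_iff.1 (h.support i))
    have h2 : Subsingleton (O.1.homology i) := Module.support_eq_empty_iff.1
      (Set.subset_empty_iff.1 ((IsPerfectOn.of_subsingleton (Z := ∅) hO).support i))
    have := ModuleCat.isZero_of_subsingleton (X.1.homology i)
    have h3 := ModuleCat.isZero_of_subsingleton (O.1.homology i)
    exact Limits.isIso_of_isInitial h3.isInitial this.isInitial _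
  rw [← K0.cls_quasiIso (0 : O.1 ⟶ X.1) hq, K0.cls_eq_zero_of_subsingleton hO]

lemma K0.cls_cone {X Y : PerfComplex Z} (f : X.1 ⟶ Y.1) :
    K0.cls (PerfComplex.cone f) = K0.cls Y + K0.cls X.shift := by
  have := (dgExact_cone f).class_eq (perfDG_tot Y) (isDG_cone f) (perfDG_shift X.2)
  rw [dgClass_tot, dgClass_eq (isDG_cone f) (perfDG_cone f).2,
    dgClass_eq (isDG_shift X.1) (perfDG_shift X.2).2] at this
  exact this

/-- The cone of the identity is acyclic. -/
lemma K0.cls_shift (X : PerfComplex Z) : K0.cls X.shift = -K0.cls X := by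
  have := K0.cls_cone (𝟙 X.1)
  rw [K0.cls_acyclic (PerfComplex.cone_acyclic (𝟙 X.1))] at this
  exact (neg_eq_of_add_eq_zero_right this.symm).symm

/-- Each element of `K₀^Z(Q)` is the class of an object. -/
lemma K0.cls_surjective (a : K0 Z) : ∃ X : PerfComplex Z, K0.cls X = a := by
  obtain ⟨b, rfl⟩ := QuotientAddGroup.mk_surjective a
  induction b using FreeAbelianGroup.induction_on with
  | zero =>
    exact ⟨PerfComplex.zero Z, K0.cls_eq_zero_of_subsingleton PerfComplex.zero_subsingleton⟩
  | of X => exact ⟨X, rfl⟩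
  | neg X _ => exact ⟨X.shift, K0.cls_shift X⟩
  | add x y hx hy =>
    obtain ⟨X, hX⟩ := hx
    obtain ⟨Y, hY⟩ := hy
    exact ⟨X.biprod Y, by rw [K0.cls_biprod, hX, hY]; rfl⟩

/-- A function on objects that is additive on short exact sequences and vanishes on acyclic
complexes factors through `K₀^Z(Q)`. -/
lemma K0.exists_lift {G : Type*} [AddCommGroup G] (F : PerfComplex Z → G)
    (hex : ∀ (X' X X'' : PerfComplex Z) (f : X'.1 ⟶ X.1) (g : X.1 ⟶ X''.1) (w : f ≫ g = 0),
      (ShortComplex.mk f g w).ShortExact → F X = F X' + F X'')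
    (hac : ∀ X : PerfComplex Z, IsPerfectOn ∅ X.1 → F X = 0) :
    ∃ φ : K0 Z →+ G, ∀ X, φ (K0.cls X) = F X := by
  -- An isomorphism is a short exact sequence whose third term is the zero complex.
  have hiso : ∀ X Y : PerfComplex Z, (X.1 ≅ Y.1) → F X = F Y := by
    intro X Y e
    let O := PerfComplex.zero Z
    have hO : ∀ i, Subsingleton (O.1.X i) := PerfComplex.zero_subsingleton
    have h1 := hex X Y O e.hom 0 (by simp) (shortExact_of_elements _ _ _
      (fun i x hx => by
        have h2 := congrArg (fun φ : X.1 ⟶ X.1 => (φ.f i).hom x) e.hom_inv_id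
        have h3 : (e.inv.f i).hom ((e.hom.f i).hom x) = x := h2
        rw [← h3, hx, map_zero])
      (fun i y => ⟨0, (hO i).elim _ _⟩)
      (fun i y _ => ⟨(e.inv.f i).hom y,
        congrArg (fun φ : Y.1 ⟶ Y.1 => (φ.f i).hom y) e.inv_hom_id⟩))
    rw [h1, hac O (IsPerfectOn.of_subsingleton hO), add_zero]
  have hcone : ∀ (X Y : PerfComplex Z) (f : X.1 ⟶ Y.1),
      F (PerfComplex.cone f) = F Y + F X.shift := by
    intro X Y f
    let Y' : PerfComplex Z := ⟨subCx _ _ (isDG_tot Y.1), (perfDG_tot Y).2⟩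
    obtain ⟨w, hw⟩ := (dgExact_cone f).shortExact (isDG_tot Y.1) (isDG_cone f) (isDG_shift X.1)
    rw [hex Y' (PerfComplex.cone f) X.shift _ _ w hw, hiso Y Y' (isoSubCxTot Y.1)]
  -- The cones of `f` and of the identity of `X` are both acyclic, so `F Y` and `F X` are both
  -- inverse to `F` of the shift of `X`.
  have hqi : ∀ (X Y : PerfComplex Z) (f : X.1 ⟶ Y.1), QuasiIso f → F X = F Y := by
    intro X Y f hf
    have h1 := hcone X Y f
    have h2 := hcone X X (𝟙 X.1)
    rw [hac _ (PerfComplex.cone_acyclic _)] at h1 h2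
    rw [h1] at h2
    exact (add_right_cancel h2).symm
  refine ⟨QuotientAddGroup.lift _ (FreeAbelianGroup.lift F) ?_, fun X => ?_⟩
  · rw [AddSubgroup.closure_le]
    rintro _ (⟨X', X, X'', f, g, w, h, rfl⟩ | ⟨X, Y, f, h, rfl⟩)
    · rw [SetLike.mem_coe, AddMonoidHom.mem_ker]
      simp [hex X' X X'' f g w h]
    · rw [SetLike.mem_coe, AddMonoidHom.mem_ker]
      simp [hqi X Y f h]
  · exact FreeAbelianGroup.lift_apply_of F X

end Cones

/-! ### Conjugate permutations and the Galois symmetry of eigencomplexes -/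

section Conjugation

variable {Q : Type u} [CommRing Q] {X : ChainComplex (ModuleCat.{u} Q) ℤ} {n : ℕ}
variable {Z : Set (PrimeSpectrum Q)} {σ σ' ρ : Equiv.Perm (Fin n)} {c : Q}

/-- The degree `m` part of the `c`-eigenspace of a permutation. -/
noncomputable def permDeg (n : ℕ) (X : ChainComplex (ModuleCat.{u} Q) ℤ) (σ : Equiv.Perm (Fin n))
    (c : Q) (m : ℤ) : Submodule Q (Pow n X) :=
  powDeg n X m ⊓ LinearMap.ker (permOp n X σ - c • 1)

lemma mem_permDeg {m : ℤ} {t : Pow n X} :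
    t ∈ permDeg n X σ c m ↔ t ∈ powDeg n X m ∧ permOp n X σ t = c • t := by
  simp [permDeg, sub_eq_zero]

lemma isDG_permDeg : IsDG (powD n X) (permDeg n X σ c) where
  mem := by
    intro m k hk t ht
    obtain rfl : k = m - 1 := by omega
    rw [mem_permDeg] at ht ⊢
    exact ⟨powD_mem t ht.1, by rw [permOp_powD_apply, ht.2, map_smul]⟩
  sq m t _ := powD_powD t

lemma permOp_permOp (σ τ : Equiv.Perm (Fin n)) (t : Pow n X) :
    permOp n X σ (permOp n X τ t) = permOp n X (τ * σ) t :=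
  LinearMap.congr_fun (permOp_mul σ τ) t

lemma permOp_one_apply (t : Pow n X) : permOp n X 1 t = t := by
  rw [permOp_one]; rfl

lemma permOp_mem_permDeg (h : ρ * σ = σ' * ρ) {m : ℤ} {t : Pow n X}
    (ht : t ∈ permDeg n X σ' c m) : permOp n X ρ t ∈ permDeg n X σ c m := by
  rw [mem_permDeg] at ht ⊢
  refine ⟨permOp_mem t ht.1, ?_⟩
  rw [permOp_permOp, h, ← permOp_permOp, ht.2, map_smul]

/-- The signed action of `ρ` is an isomorphism of complexes between the two eigenspaces. As `permOp`
reverses products, it goes from the eigenspace of `σ'` to that of `σ`. -/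
lemma dgClass_permDeg_conj (h : ρ * σ = σ' * ρ) :
    dgClass Z (powD n X) (permDeg n X σ' c) = dgClass Z (powD n X) (permDeg n X σ c) := by
  refine DGIso.class_eq (φ := permOp n X ρ) (ψ := permOp n X ρ⁻¹) ⟨?_, ?_, ?_, ?_, ?_⟩ isDG_permDeg
  · exact fun m t ht => permOp_mem_permDeg h ht
  · refine fun m t ht => permOp_mem_permDeg ?_ ht
    rw [inv_mul_eq_iff_eq_mul, ← mul_assoc, h, mul_inv_cancel_right]
  · intro m t _
    rw [permOp_permOp, mul_inv_cancel, permOp_one_apply]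
  · intro m t _
    rw [permOp_permOp, inv_mul_cancel, permOp_one_apply]
  · exact fun m t _ => permOp_powD_apply ρ t

lemma permOp_pow_apply {t : Pow n X} (h : permOp n X σ t = c • t) (k : ℕ) :
    permOp n X (σ ^ k) t = c ^ k • t := by
  induction k with
  | zero => rw [pow_zero, pow_zero, permOp_one_apply, one_smul]
  | succ k ih => rw [pow_succ, ← permOp_permOp, ih, map_smul, h, smul_smul, pow_succ]

/-- The inverse of `j` modulo `N` recovers `σ` and `c` from their `j`-th powers. -/
lemma permDeg_pow {j : ℕ} {N : ℕ} (hN : 1 < N) (hj : j.Coprime N) (hσ : σ ^ N = 1)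
    (hc : c ^ N = 1) :
    permDeg n X (σ ^ j) (c ^ j) = permDeg n X σ c := by
  obtain ⟨j', -, hj'⟩ := Nat.exists_mul_mod_eq_one_of_coprime hj hN
  ext m t
  rw [mem_permDeg, mem_permDeg]
  refine and_congr_right fun _ => ⟨fun h => ?_, fun h => permOp_pow_apply h j⟩
  have := permOp_pow_apply h j'
  rwa [← pow_mul, ← pow_mul, pow_eq_pow_mod (j * j') hσ, pow_eq_pow_mod (j * j') hc, hj', pow_one,
    pow_one] at this

/-- Positions as residue classes. -/
noncomputable def finEquivZMod (n : ℕ) [NeZero n] : Fin n ≃ ZMod n where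
  toFun i := (i : ℕ)
  invFun z := ⟨z.val, z.val_lt⟩
  left_inv i := Fin.ext (ZMod.val_cast_of_lt i.2)
  right_inv z := ZMod.natCast_zmod_val z

lemma finEquivZMod_finRotate [NeZero n] (i : Fin n) :
    finEquivZMod n (finRotate n i) = finEquivZMod n i + 1 := cast_finRotate i

lemma finEquivZMod_pow [NeZero n] (i : Fin n) (k : ℕ) :
    finEquivZMod n ((finRotate n ^ k) i) = finEquivZMod n i + k := by
  induction k with
  | zero => simp
  | succ k ih =>
    rw [pow_succ', Equiv.Perm.mul_apply, finEquivZMod_finRotate, ih]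
    push_cast
    ring

/-- Multiplication by `j` on `ℤ/n` conjugates the rotation to its `j`-th power, and the `c ^
j`-eigenspace of that power is the `c`-eigenspace of the rotation. -/
lemma dgClass_eigenDeg_pow (hn : 1 < n) {j : ℕ} (hj : j.Coprime n) (hc : c ^ n = 1) :
    dgClass Z (powD n X) (eigenDeg n X (c ^ j)) = dgClass Z (powD n X) (eigenDeg n X c) := by
  have : NeZero n := ⟨by omega⟩
  let ρ : Equiv.Perm (Fin n) := (finEquivZMod n).trans
    ((Units.mulLeft (ZMod.unitOfCoprime j hj)).trans (finEquivZMod n).symm)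
  have hρ : ∀ i, finEquivZMod n (ρ i) = j * finEquivZMod n i := by
    intro i
    simp [ρ, ZMod.coe_unitOfCoprime]
  have h : ρ * finRotate n = finRotate n ^ j * ρ := by
    ext1 i
    apply (finEquivZMod n).injective
    rw [Equiv.Perm.mul_apply, Equiv.Perm.mul_apply, hρ, finEquivZMod_finRotate, finEquivZMod_pow,
      hρ]
    ring
  have h1 := dgClass_permDeg_conj (Z := Z) (X := X) (c := c ^ j) h
  rw [permDeg_pow hn hj finRotate_pow_self hc] at h1
  exact h1.symm

end Conjugation

/-! ### Coefficients in the cyclotomic integers -/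

section CyclotomicIntegers

/-- The coordinate at `1` in the power basis of `ℤ[e^(2πi/n)]`. -/
lemma exists_cycloInt_retraction (n : ℕ) [NeZero n] :
    ∃ ℓ : cycloInt n →ₗ[ℤ] ℤ, ℓ 1 = 1 := by
  have hint : IsIntegral ℤ (Complex.exp (2 * Real.pi * Complex.I / n)) :=
    (Complex.isPrimitiveRoot_exp n (NeZero.ne n)).isIntegral (NeZero.pos n)
  let B : PowerBasis ℤ (cycloInt n) := Algebra.adjoin.powerBasis' hint
  have : Nontrivial (cycloInt n) := inferInstance
  refine ⟨B.basis.coord ⟨0, B.dim_pos⟩, ?_⟩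
  have h : B.basis ⟨0, B.dim_pos⟩ = 1 := by rw [B.basis_eq_pow, pow_zero]
  rw [← h, Module.Basis.coord_apply, Module.Basis.repr_self, Finsupp.single_eq_same]

/-- A linear retraction of the inclusion of `ℤ` keeps it injective after any tensor product, torsion
or not. -/
lemma tmul_one_injective (n : ℕ) [NeZero n] {M : Type*} [AddCommGroup M] :
    Function.Injective fun a : M => a ⊗ₜ[ℤ] (1 : cycloInt n) := by
  obtain ⟨ℓ, hℓ⟩ := exists_cycloInt_retraction n
  intro a b h
  have := congrArg (fun x => TensorProduct.rid ℤ M (LinearMap.lTensor M ℓ x)) h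
  simpa [hℓ] using this

lemma isPrimitiveRoot_zetaInt (n : ℕ) [NeZero n] : IsPrimitiveRoot (zetaInt n) n := by
  have h := Complex.isPrimitiveRoot_exp n (NeZero.ne n)
  exact IsPrimitiveRoot.of_map_of_injective (f := (cycloInt n).val) h Subtype.val_injective

lemma isPrimitiveRoot_zeta (n : ℕ) [NeZero n] : IsPrimitiveRoot (zeta n) n := by
  have h := Complex.isPrimitiveRoot_exp n (NeZero.ne n)
  exact IsPrimitiveRoot.of_map_of_injective (f := (cycloRing n).val) h Subtype.val_injective

/-- This cancels every contribution to the cyclic sum that is the same for all roots of unity. -/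
lemma sum_tmul_zetaInt {n : ℕ} [NeZero n] (hn : 1 < n) {M : Type*} [AddCommGroup M] (a : M) :
    ∑ k ∈ Finset.range n, a ⊗ₜ[ℤ] (zetaInt n ^ k) = 0 := by
  rw [← TensorProduct.tmul_sum, (isPrimitiveRoot_zetaInt n).geom_sum_eq_zero hn,
    TensorProduct.tmul_zero]

end CyclotomicIntegers

/-! ### The cyclic Adams operations of prime order -/

section Operations

variable {Q : Type u} [CommRing Q] {Z : Set (PrimeSpectrum Q)} {n : ℕ} [NeZero n]
  (ρ : cycloRing n →+* Q)

lemma isUnit_natCast {Q : Type u} [CommRing Q] {n : ℕ} [NeZero n] (ρ : cycloRing n →+* Q) :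
    IsUnit (n : Q) :=
  IsUnit.of_mul_eq_one_right (ρ (invNat n)) (by
    rw [← map_natCast ρ, ← map_mul, invNat_mul, map_one])

lemma map_zeta_pow : ρ (zeta n) ^ n = 1 := by
  rw [← map_pow, zeta_pow, map_one]

lemma map_zeta_pow_pow (k : ℕ) : (ρ (zeta n) ^ k) ^ n = 1 := by
  rw [← pow_mul, mul_comm, pow_mul, map_zeta_pow, one_pow]

lemma cls_eigenObj (k : ℕ) (X : PerfComplex Z) :
    K0.cls (eigenObj ρ k X) = dgClass Z (powD n X.1) (eigenDeg n X.1 (ρ (zeta n) ^ k)) :=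
  (dgClass_eigenDeg X.2 (map_zeta_pow_pow ρ k) (isUnit_natCast ρ)).symm

lemma exists_cyclicSum_hom {p : ℕ} [Fact p.Prime] (ρ : cycloRing p →+* Q)
    (Z : Set (PrimeSpectrum Q)) :
    ∃ φ : K0 Z →+ K0 Z ⊗[ℤ] cycloInt p, ∀ X, φ (K0.cls X) = cyclicSum ρ X := by
  have hp : p.Prime := Fact.out
  refine K0.exists_lift (cyclicSum ρ) ?_ ?_
  · intro X' X X'' f g w h
    obtain ⟨N, hN⟩ := dgClass_eigenDeg_shortExact h (isUnit_natCast ρ)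
    have h1 : ∀ k, K0.cls (eigenObj ρ k X) = K0.cls (eigenObj ρ k X') +
        K0.cls (eigenObj ρ k X'') + N := by
      intro k
      rw [cls_eigenObj, cls_eigenObj, cls_eigenObj]
      exact hN _ (map_zeta_pow_pow ρ k)
    simp only [cyclicSum, h1, TensorProduct.add_tmul, Finset.sum_add_distrib,
      sum_tmul_zetaInt hp.one_lt, add_zero]
  · intro X hX
    refine Finset.sum_eq_zero fun k _ => ?_
    rw [K0.cls_acyclic, TensorProduct.zero_tmul]
    exact isPerfectOn_eigenComplex hX (map_zeta_pow_pow ρ k) (isUnit_natCast ρ)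

/-- By the Galois symmetry all nontrivial roots of unity carry the same class, and the sum of these
roots is `-1`. -/
lemma cyclicSum_eq_tmul_one {p : ℕ} [Fact p.Prime] (ρ : cycloRing p →+* Q) (X : PerfComplex Z) :
    cyclicSum ρ X =
      (K0.cls (eigenObj ρ 0 X) - K0.cls (eigenObj ρ 1 X)) ⊗ₜ[ℤ] (1 : cycloInt p) := by
  have hp : p.Prime := Fact.out
  have h1 : ∀ k ∈ Finset.Ico 1 p, K0.cls (eigenObj ρ k X) = K0.cls (eigenObj ρ 1 X) := by
    intro k hk
    rw [Finset.mem_Ico] at hk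
    rw [cls_eigenObj, cls_eigenObj, pow_one]
    exact dgClass_eigenDeg_pow hp.one_lt
      (Nat.coprime_of_lt_prime (by omega) hk.2 hp).symm (map_zeta_pow ρ)
  have h2 := sum_tmul_zetaInt hp.one_lt (K0.cls (eigenObj ρ 1 X))
  rw [Finset.range_eq_Ico, Finset.sum_eq_sum_Ico_succ_bot hp.pos] at h2
  rw [cyclicSum, Finset.range_eq_Ico, Finset.sum_eq_sum_Ico_succ_bot hp.pos,
    Finset.sum_congr rfl fun k hk => by rw [h1 k (by simpa using hk)],
    eq_neg_of_add_eq_zero_right h2,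
    pow_zero, TensorProduct.sub_tmul, sub_eq_add_neg]

/-- The cyclic Adams operation of prime order as a group endomorphism. -/
lemma exists_cyclicAdams_hom {p : ℕ} [Fact p.Prime] (ρ : cycloRing p →+* Q)
    (Z : Set (PrimeSpectrum Q)) :
    ∃ ψ : K0 Z →+ K0 Z, ∀ X, ψ (K0.cls X) ⊗ₜ[ℤ] (1 : cycloInt p) = cyclicSum ρ X := by
  obtain ⟨φ, hφ⟩ := exists_cyclicSum_hom ρ Z
  have hex : ∀ a, ∃ b : K0 Z, b ⊗ₜ[ℤ] (1 : cycloInt p) = φ a := by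
    intro a
    obtain ⟨X, rfl⟩ := K0.cls_surjective a
    exact ⟨_, (cyclicSum_eq_tmul_one ρ X).symm.trans (hφ X).symm⟩
  choose ψ hψ using hex
  refine ⟨AddMonoidHom.mk' ψ fun a b => tmul_one_injective p ?_, fun X => ?_⟩
  · simp only [hψ, map_add, TensorProduct.add_tmul]
  · exact (hψ _).trans (hφ X)

lemma isCyclicAdams_iff {ψ : K0 Z → K0 Z} (hψ : IsCyclicAdams ρ Z ψ) (Ψ : K0 Z → K0 Z) :
    IsCyclicAdams ρ Z Ψ ↔ Ψ = ψ := by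
  refine ⟨fun h => funext fun a => ?_, fun h => h ▸ hψ⟩
  obtain ⟨X, rfl⟩ := K0.cls_surjective a
  exact tmul_one_injective n ((h X).trans (hψ X).symm)

/-- The existence of `ψ` shows that the cyclic sum depends only on the class of the complex, so the
pointwise choice in `cyclicAdams` has a value to choose. -/
lemma cyclicAdams_eq {ψ : K0 Z → K0 Z} (hψ : IsCyclicAdams ρ Z ψ) : cyclicAdams ρ Z = ψ := by
  rw [← isCyclicAdams_iff ρ hψ]
  intro X
  have hex : ∃ b : K0 Z, ∀ X' : PerfComplex Z, K0.cls X' = K0.cls X →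
      b ⊗ₜ[ℤ] (1 : cycloInt n) = cyclicSum ρ X' :=
    ⟨ψ (K0.cls X), fun X' h => by rw [← h]; exact hψ X'⟩
  exact Classical.epsilon_spec hex X rfl

end Operations

/-! ### Tensor powers of tensor powers of modules -/

section NestedTensors

variable {Q : Type u} [CommRing Q] {p q : ℕ}
variable {M N : Type u} [AddCommGroup M] [Module Q M] [AddCommGroup N] [Module Q N]

/-- Grouping the factors of a tensor power into blocks. -/
noncomputable def nestMap (Q : Type u) [CommRing Q] (p q : ℕ) (M : Type u) [AddCommGroup M]
    [Module Q M] : (⨂[Q] _ : Fin (p * q), M) →ₗ[Q] ⨂[Q] _ : Fin p, ⨂[Q] _ : Fin q, M :=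
  PiTensorProduct.lift
    (((PiTensorProduct.tprod Q).compMultilinearMap fun _ : Fin p =>
      PiTensorProduct.tprod Q (s := fun _ : Fin q => M)).domDomCongr
        ((Equiv.sigmaEquivProd (Fin p) (Fin q)).trans finProdFinEquiv))

lemma nestMap_tprod (y : Fin (p * q) → M) :
    nestMap Q p q M (PiTensorProduct.tprod Q y) = PiTensorProduct.tprod Q fun i : Fin p =>
      PiTensorProduct.tprod Q fun j : Fin q => y (finProdFinEquiv (i, j)) := by
  rw [nestMap, PiTensorProduct.lift.tprod]
  rfl

lemma nestMap_map (θ : Fin (p * q) → (M →ₗ[Q] N)) :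
    nestMap Q p q N ∘ₗ PiTensorProduct.map θ =
      PiTensorProduct.map (fun i => PiTensorProduct.map fun j => θ (finProdFinEquiv (i, j))) ∘ₗ
        nestMap Q p q M := by
  refine PiTensorProduct.ext (MultilinearMap.ext fun y => ?_)
  simp only [LinearMap.compMultilinearMap_apply, LinearMap.comp_apply, PiTensorProduct.map_tprod,
    nestMap_tprod]

lemma nestMap_surjective : Function.Surjective (nestMap Q p q M) := by
  rw [← LinearMap.range_eq_top, eq_top_iff]
  have h : (LinearMap.range (nestMap Q p q M)).mkQ = 0 := by
    refine PiTensorProduct.ext_of_span_eq_top (ι := Fin p)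
      (g := fun _ => PiTensorProduct.tprod Q (s := fun _ : Fin q => M))
      (fun _ => PiTensorProduct.span_tprod_eq_top) fun y => ?_
    rw [LinearMap.zero_apply, Submodule.mkQ_apply, Submodule.Quotient.mk_eq_zero]
    refine ⟨PiTensorProduct.tprod Q fun k =>
      y (finProdFinEquiv.symm k).1 (finProdFinEquiv.symm k).2, ?_⟩
    rw [nestMap_tprod]
    simp only [Equiv.symm_apply_apply]
  rw [← Submodule.ker_mkQ (LinearMap.range (nestMap Q p q M)), h, LinearMap.ker_zero]

/-- For a free module, grouping the factors sends the tensor basis to the nested tensor basis. A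
projective module is a direct summand of a free one, and `nestMap` is natural. -/
lemma nestMap_injective [hM : Module.Projective Q M] : Function.Injective (nestMap Q p q M) := by
  obtain ⟨s, hs⟩ := hM
  have hs' : Finsupp.linearCombination Q id ∘ₗ s = LinearMap.id := LinearMap.ext hs
  have hfree : Function.Injective (nestMap Q p q (M →₀ Q)) := by
    let b : Module.Basis M Q (M →₀ Q) := Finsupp.basisSingleOne
    let B := Basis.piTensorProduct fun _ : Fin (p * q) => b
    let B' := Basis.piTensorProduct fun _ : Fin p => Basis.piTensorProduct fun _ : Fin q => b
    let L := B'.constr Q fun f => B fun k =>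
      f (finProdFinEquiv.symm k).1 (finProdFinEquiv.symm k).2
    have : L ∘ₗ nestMap Q p q (M →₀ Q) = LinearMap.id := by
      refine B.ext fun f => ?_
      have h1 : nestMap Q p q (M →₀ Q) (B f) = B' fun i j => f (finProdFinEquiv (i, j)) := by
        simp only [B, B', Basis.piTensorProduct_apply, nestMap_tprod]
      rw [LinearMap.comp_apply, h1, Module.Basis.constr_basis, LinearMap.id_apply]
      exact congrArg B (funext fun k => congrArg f (finProdFinEquiv.apply_symm_apply k))
    exact Function.LeftInverse.injective (g := L) fun x => LinearMap.congr_fun this x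
  have h1 : Function.Injective (PiTensorProduct.map fun _ : Fin (p * q) => s) := by
    refine Function.LeftInverse.injective
      (g := PiTensorProduct.map fun _ : Fin (p * q) => Finsupp.linearCombination Q id) fun x => ?_
    rw [← LinearMap.comp_apply, ← PiTensorProduct.map_comp, hs', PiTensorProduct.map_id]
    rfl
  have h2 := nestMap_map (p := p) (q := q) fun _ : Fin (p * q) => s
  have h3 : Function.Injective (nestMap Q p q (M →₀ Q) ∘ₗ
      PiTensorProduct.map fun _ : Fin (p * q) => s) := by
    rw [LinearMap.coe_comp]
    exact hfree.comp h1
  rw [h2, LinearMap.coe_comp] at h3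
  exact h3.of_comp

end NestedTensors

/-! ### The tensor power as a complex, and its total module -/

section PowerComplex

variable {Q : Type u} [CommRing Q] {X : ChainComplex (ModuleCat.{u} Q) ℤ} {n : ℕ}

lemma isDG_powDeg (n : ℕ) (X : ChainComplex (ModuleCat.{u} Q) ℤ) :
    IsDG (powD n X) (powDeg n X) where
  mem := by
    intro m k hk t ht
    obtain rfl : k = m - 1 := by omega
    exact powD_mem t ht
  sq m t _ := powD_powD t

/-- The `n`-fold tensor power of a complex. -/
noncomputable def powCx (n : ℕ) (X : ChainComplex (ModuleCat.{u} Q) ℤ) :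
    ChainComplex (ModuleCat.{u} Q) ℤ :=
  subCx (powD n X) (powDeg n X) (isDG_powDeg n X)

/-- The canonical map from the total module of the tensor power to the tensor power. -/
noncomputable def unTot (n : ℕ) (X : ChainComplex (ModuleCat.{u} Q) ℤ) :
    Tot (powCx n X) →ₗ[Q] Pow n X :=
  DirectSum.toModule Q ℤ _ fun m => (powDeg n X m).subtype

lemma unTot_inc (m : ℤ) (t : (powCx n X).X m) :
    unTot n X (inc (powCx n X) m t) = (powDeg n X m).subtype t := by
  have := DirectSum.toModule_lof (R := Q) (M := fun m => (powCx n X).X m)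
    (φ := fun m => (powDeg n X m).subtype) m t
  exact this

lemma unTot_surjective : Function.Surjective (unTot n X) := by
  rw [← LinearMap.range_eq_top, eq_top_iff]
  have h : (LinearMap.range (unTot n X)).mkQ = 0 := by
    refine pow_ext fun a x => ?_
    rw [LinearMap.zero_apply, Submodule.mkQ_apply, Submodule.Quotient.mk_eq_zero]
    exact ⟨inc (powCx n X) (∑ i, a i) ⟨_, Submodule.subset_span ⟨a, x, rfl, rfl⟩⟩, unTot_inc _ _⟩
  rw [← Submodule.ker_mkQ (LinearMap.range (unTot n X)), h, LinearMap.ker_zero]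

lemma powDegProj_of_mem {S : Finset ℤ} (hS : ∀ i ∉ S, Subsingleton (X.X i)) {m k : ℤ} {t : Pow n X}
    (ht : t ∈ powDeg n X k) : powDegProj n X S m t = if k = m then t else 0 := by
  split_ifs with h
  · subst h
    exact powDegProj_apply hS ht
  · have : powDeg n X k ≤ LinearMap.ker (powDegProj n X S m) := by
      refine Submodule.span_le.2 ?_
      rintro _ ⟨a, x, hm, rfl⟩
      rw [SetLike.mem_coe, LinearMap.mem_ker, powDegProj_tprod hS, if_neg (by rwa [hm])]
    exact this ht

lemma exists_finset_of_bounded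
    (h : ∃ a b : ℤ, ∀ i, (i < a ∨ b < i) → Subsingleton (X.X i)) :
    ∃ S : Finset ℤ, ∀ i ∉ S, Subsingleton (X.X i) := by
  obtain ⟨a, b, hab⟩ := h
  refine ⟨Finset.Icc a b, fun i hi => hab i ?_⟩
  rw [Finset.mem_Icc] at hi
  omega

/-- The degree projections of the tensor power recover the components. Boundedness enters because
`powDegProj` sums over a finite set of degrees. -/
lemma unTot_injective (h : ∃ a b : ℤ, ∀ i, (i < a ∨ b < i) → Subsingleton (X.X i)) :
    Function.Injective (unTot n X) := by
  obtain ⟨S, hS⟩ := exists_finset_of_bounded h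
  have key : ∀ m, powDegProj n X S m ∘ₗ unTot n X =
      (powDeg n X m).subtype ∘ₗ DirectSum.component Q ℤ (fun m => (powCx n X).X m) m := by
    intro m
    refine DirectSum.linearMap_ext Q fun k => LinearMap.ext fun t => ?_
    change powDegProj n X S m (unTot n X (inc (powCx n X) k t)) =
      (powDeg n X m).subtype (DirectSum.component Q ℤ _ m (inc (powCx n X) k t))
    rw [unTot_inc, DirectSum.component.of]
    refine (powDegProj_of_mem hS (Subtype.property (p := fun t => t ∈ powDeg n X k) t)).trans ?_
    split_ifs with h
    · subst h; rfl
    · exact (map_zero _).symm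
  rw [injective_iff_map_eq_zero]
  intro t ht
  refine DFinsupp.ext fun m => ?_
  have := LinearMap.congr_fun (key m) t
  rw [LinearMap.comp_apply, ht, map_zero] at this
  exact Subtype.ext this.symm

lemma unTot_totD (t : Tot (powCx n X)) :
    unTot n X (totD (powCx n X) t) = powD n X (unTot n X t) := by
  have : unTot n X ∘ₗ totD (powCx n X) = powD n X ∘ₗ unTot n X := by
    refine DirectSum.linearMap_ext Q fun m => LinearMap.ext fun t => ?_
    change unTot n X (totD (powCx n X) (inc (powCx n X) m t)) =
      powD n X (unTot n X (inc (powCx n X) m t))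
    rw [totD_inc]
    have h : (powCx n X).d m (m - 1) = ModuleCat.ofHom _ :=
      subCx_d (isDG_powDeg n X) (sub_add_cancel m 1)
    rw [h, unTot_inc, unTot_inc]
    rfl
  exact LinearMap.congr_fun this t

/-- The involution `x ↦ (-1) ^ |x| x` of the tensor power. -/
noncomputable def powEps (n : ℕ) (X : ChainComplex (ModuleCat.{u} Q) ℤ) : Pow n X →ₗ[Q] Pow n X :=
  PiTensorProduct.map fun _ => eps X

lemma powEps_of_mem {m : ℤ} {t : Pow n X} (ht : t ∈ powDeg n X m) :
    powEps n X t = (sgn (m : ZMod 2) : Q) • t := by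
  have : powDeg n X m ≤ LinearMap.ker (powEps n X - (sgn (m : ZMod 2) : Q) • 1) := by
    refine Submodule.span_le.2 ?_
    rintro _ ⟨a, x, rfl, rfl⟩
    rw [SetLike.mem_coe, LinearMap.mem_ker, LinearMap.sub_apply, sub_eq_zero, powEps,
      PiTensorProduct.map_tprod]
    simp only [eps_inc]
    rw [(PiTensorProduct.tprod Q).map_smul_univ]
    push_cast
    rw [sgn_sum]
    push_cast
    rfl
  have h := this ht
  rwa [LinearMap.mem_ker, LinearMap.sub_apply, sub_eq_zero] at h

lemma unTot_eps (t : Tot (powCx n X)) :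
    unTot n X (eps (powCx n X) t) = powEps n X (unTot n X t) := by
  have : unTot n X ∘ₗ eps (powCx n X) = powEps n X ∘ₗ unTot n X := by
    refine DirectSum.linearMap_ext Q fun m => LinearMap.ext fun t => ?_
    change unTot n X (eps (powCx n X) (inc (powCx n X) m t)) =
      powEps n X (unTot n X (inc (powCx n X) m t))
    rw [eps_inc, map_smul, unTot_inc]
    exact (powEps_of_mem (Subtype.property (p := fun t => t ∈ powDeg n X m) t)).symm
  exact LinearMap.congr_fun this t

/-- The total module of the tensor power is the tensor power. -/
noncomputable def unTotEquiv (n : ℕ) {X : ChainComplex (ModuleCat.{u} Q) ℤ}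
    (h : ∃ a b : ℤ, ∀ i, (i < a ∨ b < i) → Subsingleton (X.X i)) : Tot (powCx n X) ≃ₗ[Q] Pow n X :=
  LinearEquiv.ofBijective (unTot n X) ⟨unTot_injective h, unTot_surjective⟩

end PowerComplex

/-! ### Permutations of blocks and of letters, and their Koszul signs -/

section BlockPermutations

variable {p q : ℕ}

/-- The letter `j` of the block `i` stands at position `j + q * i`, so positions are ordered
lexicographically. -/
lemma finProdFinEquiv_lt {i i' : Fin p} {j j' : Fin q} :
    finProdFinEquiv (i, j) < finProdFinEquiv (i', j') ↔ i < i' ∨ i = i' ∧ j < j' := by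
  have hj := j.2
  have hj' := j'.2
  rw [Fin.lt_def, Fin.lt_def, Fin.lt_def, Fin.ext_iff, finProdFinEquiv_apply_val,
    finProdFinEquiv_apply_val]
  dsimp only
  rcases lt_trichotomy (i : ℕ) i' with h | h | h
  · have : q * ((i : ℕ) + 1) ≤ q * i' := Nat.mul_le_mul_left q h
    rw [mul_add, mul_one] at this
    omega
  · rw [h]; omega
  · have : q * ((i' : ℕ) + 1) ≤ q * i := Nat.mul_le_mul_left q h
    rw [mul_add, mul_one] at this
    omega

/-- The permutation of `p` blocks of `q` letters which permutes the blocks by `τ` and the letters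
of each block by `g`. -/
def blockPerm (τ : Equiv.Perm (Fin p)) (g : Equiv.Perm (Fin q)) : Equiv.Perm (Fin (p * q)) :=
  finProdFinEquiv.symm.trans ((Equiv.prodCongr τ g).trans finProdFinEquiv)

lemma blockPerm_apply (τ : Equiv.Perm (Fin p)) (g : Equiv.Perm (Fin q)) (i : Fin p) (j : Fin q) :
    blockPerm τ g (finProdFinEquiv (i, j)) = finProdFinEquiv (τ i, g j) := by
  simp [blockPerm]

lemma sum_blocks {M : Type*} [AddCommMonoid M] (f : Fin (p * q) → M) :
    ∑ k, f k = ∑ i : Fin p, ∑ j : Fin q, f (finProdFinEquiv (i, j)) := by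
  rw [← Equiv.sum_comp finProdFinEquiv, Fintype.sum_prod_type]

/-- The inversions are all pairs of letters from two inverted blocks, and the sum of their products
of parities factors into the product of the parities of the blocks. -/
lemma koszulSign_blockPerm_one (τ : Equiv.Perm (Fin p)) (s : Fin (p * q) → ZMod 2) :
    koszulSign (blockPerm τ 1) s = koszulSign τ fun i => ∑ j, s (finProdFinEquiv (i, j)) := by
  have h : ∀ (i i' : Fin p) (j j' : Fin q), ((i < i' ∨ i = i' ∧ j < j') ∧
      (τ i' < τ i ∨ τ i' = τ i ∧ j' < j)) ↔ i < i' ∧ τ i' < τ i := by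
    intro i i' j j'
    constructor
    · rintro ⟨h1 | ⟨rfl, h1⟩, h2 | ⟨h2, h3⟩⟩
      · exact ⟨h1, h2⟩
      · exact absurd (τ.injective h2) h1.ne'
      · exact absurd h2 (lt_irrefl _)
      · exact absurd h1 h3.not_gt
    · exact fun h => ⟨.inl h.1, .inl h.2⟩
  rw [koszulSign, koszulSign]
  congr 1
  simp only [sum_blocks, blockPerm_apply, finProdFinEquiv_lt, Equiv.Perm.one_apply, h]
  refine Finset.sum_congr rfl fun i _ => ?_
  rw [Finset.sum_comm]
  refine Finset.sum_congr rfl fun i' _ => ?_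
  split_ifs
  · rw [Finset.sum_mul_sum]
  · simp

/-- Here inversions occur only between letters of the same block. -/
lemma koszulSign_one_blockPerm (g : Equiv.Perm (Fin q)) (s : Fin (p * q) → ZMod 2) :
    koszulSign (blockPerm 1 g) s = ∏ i, koszulSign g fun j => s (finProdFinEquiv (i, j)) := by
  have h : ∀ (i i' : Fin p) (j j' : Fin q), ((i < i' ∨ i = i' ∧ j < j') ∧
      (i' < i ∨ i' = i ∧ g j' < g j)) ↔ i' = i ∧ (j < j' ∧ g j' < g j) := by
    intro i i' j j'
    constructor
    · rintro ⟨h1 | ⟨rfl, h1⟩, h2 | ⟨h2, h3⟩⟩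
      · exact absurd h1 h2.not_gt
      · exact absurd h2 h1.ne'
      · exact absurd h2 (lt_irrefl _)
      · exact ⟨rfl, h1, h3⟩
    · exact fun h => ⟨.inr ⟨h.1.symm, h.2.1⟩, .inr ⟨h.1, h.2.2⟩⟩
  simp only [koszulSign]
  rw [← sgn_sum]
  congr 1
  simp only [sum_blocks, blockPerm_apply, finProdFinEquiv_lt, Equiv.Perm.one_apply, h]
  refine Finset.sum_congr rfl fun i _ => Finset.sum_congr rfl fun j _ => ?_
  rw [Finset.sum_eq_single i]
  · simp
  · intro i' _ hi
    simp [hi]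
  · simp

end BlockPermutations

/-! ### The isomorphism between `T^(pq)` and `T^p` of `T^q`, with differential and permutations -/

section NestedPowers

variable {Q : Type u} [CommRing Q] {X : ChainComplex (ModuleCat.{u} Q) ℤ} {p q : ℕ}
variable {Z : Set (PrimeSpectrum Q)}

/-- The power `T^(pq)` as a power of a power. -/
noncomputable def nestEquiv (p q : ℕ) (hX : IsPerfectOn Z X) :
    Pow (p * q) X ≃ₗ[Q] Pow p (powCx q X) :=
  have := hX.projective
  (LinearEquiv.ofBijective (nestMap Q p q (Tot X)) ⟨nestMap_injective, nestMap_surjective⟩).trans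
    (PiTensorProduct.congr fun _ => unTotEquiv q hX.bounded).symm

variable (hX : IsPerfectOn Z X)

lemma map_unTot_nestEquiv (t : Pow (p * q) X) :
    PiTensorProduct.map (fun _ => unTot q X) (nestEquiv p q hX t) = nestMap Q p q (Tot X) t :=
  (PiTensorProduct.congr fun _ => unTotEquiv q hX.bounded).apply_symm_apply _

lemma map_unTot_injective (hX : IsPerfectOn Z X) : Function.Injective
    (PiTensorProduct.map (R := Q) fun _ : Fin p => unTot q X) :=
  (PiTensorProduct.congr fun _ : Fin p => unTotEquiv q hX.bounded).injective

lemma nestEquiv_tprod {y : Fin (p * q) → Tot X} {z : Fin p → Tot (powCx q X)}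
    (h : ∀ i, unTot q X (z i) = PiTensorProduct.tprod Q fun j => y (finProdFinEquiv (i, j))) :
    nestEquiv p q hX (PiTensorProduct.tprod Q y) = PiTensorProduct.tprod Q z := by
  refine map_unTot_injective hX ?_
  rw [map_unTot_nestEquiv, nestMap_tprod, PiTensorProduct.map_tprod]
  exact congrArg _ (funext fun i => (h i).symm)

lemma exists_blocks (a : Fin (p * q) → ℤ) (x : ∀ k, X.X (a k)) :
    ∃ z : ∀ i : Fin p, (powCx q X).X (∑ j, a (finProdFinEquiv (i, j))),
      ∀ i, unTot q X (inc _ _ (z i)) = PiTensorProduct.tprod Q fun j =>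
        inc X (a (finProdFinEquiv (i, j))) (x (finProdFinEquiv (i, j))) :=
  ⟨fun i => ⟨PiTensorProduct.tprod Q fun j =>
        inc X (a (finProdFinEquiv (i, j))) (x (finProdFinEquiv (i, j))),
      Submodule.subset_span ⟨_, _, rfl, rfl⟩⟩, fun _ => unTot_inc _ _⟩

lemma subsingleton_powCx {n : ℕ} {S : Finset ℤ} (hS : ∀ i ∉ S, Subsingleton (X.X i)) {m : ℤ}
    (hm : m ∉ (Fintype.piFinset fun _ : Fin n => S).image fun a => ∑ i, a i) :
    Subsingleton ((powCx n X).X m) := by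
  have h0 : powDeg n X m = ⊥ := by
    refine Submodule.span_eq_bot.2 ?_
    rintro _ ⟨a, x, ha, rfl⟩
    by_cases hk : ∀ k, a k ∈ S
    · exact (hm (Finset.mem_image.2 ⟨a, Fintype.mem_piFinset.2 hk, ha⟩)).elim
    · push Not at hk
      obtain ⟨k, hk⟩ := hk
      have := hS _ hk
      exact (PiTensorProduct.tprod Q).map_coord_zero k (by rw [Subsingleton.elim (x k) 0, map_zero])
  change Subsingleton (powDeg n X m)
  rw [h0]
  infer_instance

/-- Compatibility with the degree projections, rather than with the degree submodules, yields both
directions of `nestEquiv_mem_iff` at once. -/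
lemma nestEquiv_powDegProj {S T : Finset ℤ} (hS : ∀ i ∉ S, Subsingleton (X.X i))
    (hT : ∀ i ∉ T, Subsingleton ((powCx q X).X i)) (m : ℤ) (t : Pow (p * q) X) :
    nestEquiv p q hX (powDegProj (p * q) X S m t) =
      powDegProj p (powCx q X) T m (nestEquiv p q hX t) := by
  have : (nestEquiv p q hX).toLinearMap ∘ₗ powDegProj (p * q) X S m =
      powDegProj p (powCx q X) T m ∘ₗ (nestEquiv p q hX).toLinearMap := by
    refine pow_ext fun a x => ?_
    obtain ⟨z, hz⟩ := exists_blocks a x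
    rw [LinearMap.comp_apply, LinearMap.comp_apply, powDegProj_tprod hS, LinearEquiv.coe_coe,
      apply_ite (nestEquiv p q hX), map_zero, nestEquiv_tprod hX hz, powDegProj_tprod hT,
      sum_blocks]
  exact LinearMap.congr_fun this t

lemma nestEquiv_mem_iff {m : ℤ} {t : Pow (p * q) X} :
    nestEquiv p q hX t ∈ powDeg p (powCx q X) m ↔ t ∈ powDeg (p * q) X m := by
  obtain ⟨S, hS⟩ := exists_finset_of_bounded hX.bounded
  have hT := fun m => subsingleton_powCx (n := q) hS (m := m)
  constructor <;> intro h
  · have h1 := powDegProj_apply hT h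
    rw [← nestEquiv_powDegProj hX hS hT] at h1
    rw [← (nestEquiv p q hX).injective h1]
    exact powDegProj_mem hS m t
  · have h1 := powDegProj_apply hS h
    rw [← h1, nestEquiv_powDegProj hX hS hT]
    exact powDegProj_mem hT m _

lemma nestEquiv_permOp_blocks (τ : Equiv.Perm (Fin p)) (t : Pow (p * q) X) :
    nestEquiv p q hX (permOp (p * q) X (blockPerm τ 1) t) =
      permOp p (powCx q X) τ (nestEquiv p q hX t) := by
  have : (nestEquiv p q hX).toLinearMap ∘ₗ permOp (p * q) X (blockPerm τ 1) =
      permOp p (powCx q X) τ ∘ₗ (nestEquiv p q hX).toLinearMap := by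
    refine pow_ext fun a x => ?_
    obtain ⟨z, hz⟩ := exists_blocks a x
    rw [LinearMap.comp_apply, LinearMap.comp_apply, permOp_tprod _ (isPar_inc a x), map_smul,
      LinearEquiv.coe_coe, nestEquiv_tprod (y := fun k => inc X (a k) (x k)) hX hz,
      permOp_tprod _ (isPar_inc _ z),
      koszulSign_blockPerm_one]
    congr 1
    · push_cast
      rfl
    · refine nestEquiv_tprod hX fun i => (hz (τ i)).trans ?_
      exact congrArg (PiTensorProduct.tprod Q) (funext fun j =>
        congrArg (fun k => inc X (a k) (x k)) (blockPerm_apply τ 1 i j).symm)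
  exact LinearMap.congr_fun this t

lemma nestMap_permOp_letters (g : Equiv.Perm (Fin q)) (t : Pow (p * q) X) :
    nestMap Q p q (Tot X) (permOp (p * q) X (blockPerm 1 g) t) =
      PiTensorProduct.map (fun _ => permOp q X g) (nestMap Q p q (Tot X) t) := by
  have : nestMap Q p q (Tot X) ∘ₗ permOp (p * q) X (blockPerm 1 g) =
      PiTensorProduct.map (fun _ => permOp q X g) ∘ₗ nestMap Q p q (Tot X) := by
    refine pow_ext fun a x => ?_
    have h : ∀ i : Fin p, IsPar (fun j => (a (finProdFinEquiv (i, j)) : ZMod 2))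
        fun j : Fin q => inc X (a (finProdFinEquiv (i, j))) (x (finProdFinEquiv (i, j))) :=
      fun i => isPar_inc _ _
    rw [LinearMap.comp_apply, LinearMap.comp_apply, permOp_tprod _ (isPar_inc a x), map_smul,
      nestMap_tprod, nestMap_tprod, PiTensorProduct.map_tprod]
    refine Eq.trans ?_ (congrArg (PiTensorProduct.tprod Q)
      (funext fun i => (permOp_tprod g (h i)).symm))
    rw [(PiTensorProduct.tprod Q).map_smul_univ, koszulSign_one_blockPerm]
    congr 1
    · push_cast
      rfl
    · exact congrArg (PiTensorProduct.tprod Q) (funext fun i =>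
        congrArg (PiTensorProduct.tprod Q) (funext fun j =>
          congrArg (fun k => inc X (a k) (x k)) (blockPerm_apply 1 g i j)))
  exact LinearMap.congr_fun this t

/-- The differential at letter `j` of block `i` puts the sign involution on every letter of the
earlier blocks, hence `powEps` on those blocks, and on the earlier letters of block `i`. Summing
over `j` assembles the differential of `T^q` in block `i`. -/
lemma nestMap_powD (t : Pow (p * q) X) :
    nestMap Q p q (Tot X) (powD (p * q) X t) = ∑ i, PiTensorProduct.map
      (fun k => if k < i then powEps q X else if k = i then powD q X else LinearMap.id)
      (nestMap Q p q (Tot X) t) := by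
  rw [powD, LinearMap.sum_apply, map_sum, sum_blocks]
  refine Finset.sum_congr rfl fun i _ => ?_
  have h1 : ∀ j : Fin q, nestMap Q p q (Tot X) (powDAt (p * q) X (finProdFinEquiv (i, j)) t) =
      PiTensorProduct.map (Function.update (fun k => if k < i then powEps q X else LinearMap.id) i
        (powDAt q X j)) (nestMap Q p q (Tot X) t) := by
    intro j
    rw [← LinearMap.comp_apply, powDAt, nestMap_map, LinearMap.comp_apply]
    congr 2
    ext1 k
    simp only [finProdFinEquiv_lt, finProdFinEquiv.injective.eq_iff, Prod.mk.injEq]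
    rcases lt_trichotomy k i with h | h | h
    · rw [Function.update_of_ne h.ne]
      simp only [h, true_or, if_true]
      rfl
    · subst h
      simp only [lt_irrefl, false_or, true_and, Function.update_self]
      rfl
    · rw [Function.update_of_ne h.ne']
      simp only [h.not_gt, h.ne', false_or, false_and, if_false]
      exact PiTensorProduct.map_id
  have h2 := (PiTensorProduct.mapMultilinear Q (fun _ : Fin p => Pow q X) fun _ => Pow q X
    ).map_update_sum Finset.univ i (fun j => powDAt q X j)
    (fun k => if k < i then powEps q X else LinearMap.id)
  simp only [h1]
  rw [← LinearMap.sum_apply]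
  refine LinearMap.congr_fun (h2.symm.trans (congrArg PiTensorProduct.map (funext fun k => ?_))) _
  by_cases h : k = i
  · subst h
    simp [powD]
  · simp [h]

lemma nestEquiv_powD (t : Pow (p * q) X) :
    nestEquiv p q hX (powD (p * q) X t) = powD p (powCx q X) (nestEquiv p q hX t) := by
  refine map_unTot_injective hX ?_
  have h : powD p (powCx q X) (nestEquiv p q hX t) =
      ∑ i, powDAt p (powCx q X) i (nestEquiv p q hX t) := LinearMap.sum_apply _ _ _
  rw [map_unTot_nestEquiv, nestMap_powD, h, map_sum]
  refine Finset.sum_congr rfl fun i _ => ?_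
  rw [← map_unTot_nestEquiv hX, ← LinearMap.comp_apply, ← LinearMap.comp_apply, powDAt,
    ← PiTensorProduct.map_comp, ← PiTensorProduct.map_comp]
  congr 2
  ext1 k
  refine LinearMap.ext fun y => ?_
  rw [LinearMap.comp_apply, LinearMap.comp_apply]
  split_ifs
  · exact (unTot_eps y).symm
  · exact (unTot_totD y).symm
  · rfl

end NestedPowers

/-! ### Roots of unity that separate eigenvalues -/

section SplittingRoots

variable {Q : Type u} [CommRing Q] {q : ℕ}

/-- A `q`-th root of unity that behaves like a primitive one in each residue field of a ring in
which `q` is invertible. -/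
structure IsSplittingRoot (q : ℕ) (ξ r : Q) : Prop where
  pow_eq : ξ ^ q = 1
  sum_eq : ∀ m, ¬ q ∣ m → ∑ k ∈ Finset.range q, (ξ ^ m) ^ k = 0
  mul_eq : r * q = 1

variable {ξ r : Q}

lemma IsSplittingRoot.pow_pow (h : IsSplittingRoot q ξ r) (k : ℕ) : (ξ ^ k) ^ q = 1 := by
  rw [← pow_mul, mul_comm, pow_mul, h.pow_eq, one_pow]

/-- This replaces the domain argument for distinct eigenvalues, as `Q` may have zero divisors. The
powers of `ξ ^ (a - b)` all fix `v`, so their vanishing sum acts on `v` as the unit `q`. -/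
lemma IsSplittingRoot.eq_zero [NeZero q] (h : IsSplittingRoot q ξ r) {M : Type*} [AddCommGroup M]
    [Module Q M] {a b : ZMod q} (hab : a ≠ b) {v : M} (hv : ξ ^ a.val • v = ξ ^ b.val • v) :
    v = 0 := by
  have h1 : ξ ^ (a - b).val • v = v := by
    have h2 := congrArg (fun w => ξ ^ (-b).val • w) hv
    simp only [smul_smul, ← pow_val_add h.pow_eq, neg_add_cancel, ZMod.val_zero, pow_zero,
      one_smul] at h2
    rwa [neg_add_eq_sub] at h2
  have h3 : ∀ k : ℕ, (ξ ^ (a - b).val) ^ k • v = v := by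
    intro k
    induction k with
    | zero => rw [pow_zero, one_smul]
    | succ k ih => rw [pow_succ, mul_smul, h1, ih]
  have h4 : ¬ q ∣ (a - b).val := by
    refine Nat.not_dvd_of_pos_of_lt (Nat.pos_of_ne_zero ?_) (ZMod.val_lt _)
    rwa [Ne, ZMod.val_eq_zero, sub_eq_zero]
  have h5 : (∑ k ∈ Finset.range q, (ξ ^ (a - b).val) ^ k) • v = (q : Q) • v := by
    rw [Finset.sum_smul, Finset.sum_congr rfl fun k _ => h3 k, Finset.sum_const, Finset.card_range,
      Nat.cast_smul_eq_nsmul]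
  rw [h.sum_eq _ h4, zero_smul] at h5
  rw [← one_smul Q v, ← h.mul_eq, mul_smul, ← h5, smul_zero]

lemma sum_zmod_eq_sum_range [NeZero q] {M : Type*} [AddCommMonoid M] (f : ℕ → M) :
    ∑ j : ZMod q, f j.val = ∑ k ∈ Finset.range q, f k := by
  rw [Finset.sum_range, ← Equiv.sum_comp (finEquivZMod q)]
  exact Finset.sum_congr rfl fun i _ => congrArg f (ZMod.val_cast_of_lt i.2)

end SplittingRoots

/-! ### Decomposing `T^q` into eigencomplexes, and joint eigenspaces of blocks and letters -/

section EigenDecomposition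

variable {Q : Type u} [CommRing Q] {X : ChainComplex (ModuleCat.{u} Q) ℤ} {p q : ℕ} [NeZero q]
variable {Z : Set (PrimeSpectrum Q)} {c c' ξ r : Q}

lemma eigenProj_of_eigen {t : Pow q X} (h : permOp q X (finRotate q) t = c' • t) :
    eigenProj q X c r t = (r * ∑ k ∈ Finset.range q, (c ^ (q - 1) * c') ^ k) • t := by
  have h1 : (c ^ (q - 1) • permOp q X (finRotate q)) t = (c ^ (q - 1) * c') • t := by
    rw [LinearMap.smul_apply, h, smul_smul]
  have h2 : ∀ k : ℕ, ((c ^ (q - 1) • permOp q X (finRotate q)) ^ k) t =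
      (c ^ (q - 1) * c') ^ k • t := by
    intro k
    induction k with
    | zero => rw [pow_zero, pow_zero, one_smul]; rfl
    | succ k ih => rw [pow_succ, Module.End.mul_apply, h1, map_smul, ih, smul_smul, pow_succ']
  rw [eigenProj, LinearMap.smul_apply, LinearMap.sum_apply]
  simp only [h2]
  rw [← Finset.sum_smul, smul_smul]

lemma eigenProj_eigenProj (hξ : IsSplittingRoot q ξ r) (i j : ZMod q) (t : Pow q X) :
    eigenProj q X (ξ ^ i.val) r (eigenProj q X (ξ ^ j.val) r t) =
      if i = j then eigenProj q X (ξ ^ i.val) r t else 0 := by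
  have hj := permOp_eigenProj (r := r) (hξ.pow_pow j.val) t
  have h := eigenProj_of_eigen (c := ξ ^ i.val) (r := r) hj
  split_ifs with hij
  · subst hij
    rw [h, ← pow_succ, Nat.sub_add_cancel NeZero.one_le, hξ.pow_pow]
    simp [hξ.mul_eq]
  · refine hξ.eq_zero hij ?_
    rw [← permOp_eigenProj (hξ.pow_pow i.val), h, map_smul, hj, smul_comm]

/-- After exchanging the sums, the coefficient of the `k`-th power of the rotation is a full sum of
powers of `ξ ^ ((q - 1) * k)`. It vanishes unless `k = 0`, because `q - 1` is prime to `q`. -/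
lemma sum_eigenProj (hξ : IsSplittingRoot q ξ r) (t : Pow q X) :
    ∑ j : ZMod q, eigenProj q X (ξ ^ j.val) r t = t := by
  have h1 : ∀ j : ZMod q, eigenProj q X (ξ ^ j.val) r t = ∑ k ∈ Finset.range q,
      (r * (ξ ^ ((q - 1) * k)) ^ j.val) • (permOp q X (finRotate q) ^ k) t := by
    intro j
    rw [eigenProj, LinearMap.smul_apply, LinearMap.sum_apply, Finset.smul_sum]
    refine Finset.sum_congr rfl fun k _ => ?_
    rw [smul_pow, LinearMap.smul_apply, smul_smul, ← pow_mul, ← pow_mul, ← pow_mul]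
    congr 3
    ring
  have h2 : ∀ k ∈ Finset.range q, k ≠ 0 → ¬ q ∣ (q - 1) * k := by
    intro k hk hk0 h
    rw [Finset.mem_range] at hk
    have h3 : (q - 1).Coprime q := by
      have := Nat.coprime_self_add_right (m := q - 1) (n := 1)
      rw [Nat.sub_add_cancel NeZero.one_le] at this
      exact this.2 (Nat.coprime_one_right _)
    exact Nat.not_dvd_of_pos_of_lt (Nat.pos_of_ne_zero hk0) hk (h3.symm.dvd_of_dvd_mul_left h)
  simp only [h1]
  rw [Finset.sum_comm, Finset.sum_eq_single 0]
  · rw [← Finset.sum_smul, ← Finset.mul_sum]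
    simp [hξ.mul_eq]
  · intro k hk hk0
    rw [← Finset.sum_smul, ← Finset.mul_sum,
      sum_zmod_eq_sum_range fun i => (ξ ^ ((q - 1) * k)) ^ i, hξ.sum_eq _ (h2 k hk hk0), mul_zero,
      zero_smul]
  · intro h
    exact absurd (Finset.mem_range.2 (NeZero.pos q)) h

/-- The inclusion of an eigencomplex. -/
noncomputable def eigenIncl (q : ℕ) (X : ChainComplex (ModuleCat.{u} Q) ℤ) (c : Q) :
    eigenComplex q X c ⟶ powCx q X :=
  subCxMap (isDG_eigenDeg c) (isDG_powDeg q X) LinearMap.id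
    (fun _ _ ht => (mem_eigenDeg.1 ht).1) fun _ _ _ => rfl

/-- The projection to an eigencomplex. -/
noncomputable def eigenRetr (X : ChainComplex (ModuleCat.{u} Q) ℤ) (hc : c ^ q = 1) (r : Q) :
    powCx q X ⟶ eigenComplex q X c :=
  subCxMap (isDG_powDeg q X) (isDG_eigenDeg c) (eigenProj q X c r)
    (fun _ _ ht => eigenProj_mem hc ht) fun _ t _ =>
      (LinearMap.congr_fun (powD_eigenProj c r) t).symm

lemma eigenIncl_eigenRetr (hc : c ^ q = 1) (hr : r * q = 1) :
    eigenIncl q X c ≫ eigenRetr X hc r = 𝟙 (eigenComplex q X c) :=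
  HomologicalComplex.hom_ext _ _ fun m => ModuleCat.hom_ext (LinearMap.ext fun t =>
    Subtype.ext (eigenProj_apply hc hr (Subtype.property (p := fun t => t ∈ eigenDeg q X c m) t)))

/-- The projector of the power complex onto an eigencomplex. -/
noncomputable def eigenIdem (X : ChainComplex (ModuleCat.{u} Q) ℤ) (hξ : IsSplittingRoot q ξ r)
    (j : ZMod q) : Tot (powCx q X) →ₗ[Q] Tot (powCx q X) :=
  totMap (eigenRetr X (hξ.pow_pow j.val) r ≫ eigenIncl q X _)

variable (hξ : IsSplittingRoot q ξ r)

lemma unTot_eigenIdem (j : ZMod q) (t : Tot (powCx q X)) :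
    unTot q X (eigenIdem X hξ j t) = eigenProj q X (ξ ^ j.val) r (unTot q X t) := by
  have : unTot q X ∘ₗ eigenIdem X hξ j = eigenProj q X (ξ ^ j.val) r ∘ₗ unTot q X := by
    refine DirectSum.linearMap_ext Q fun m => LinearMap.ext fun t => ?_
    change unTot q X (eigenIdem X hξ j (inc (powCx q X) m t)) =
      eigenProj q X (ξ ^ j.val) r (unTot q X (inc (powCx q X) m t))
    rw [eigenIdem, totMap_inc, unTot_inc, unTot_inc]
    rfl
  exact LinearMap.congr_fun this t

lemma isDecomp_eigenIdem (hX : IsPerfectOn Z X) : IsDecomp (eigenIdem X hξ) where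
  deg _ := isDeg_totMap _
  comm _ := totD_totMap _
  orth i j := by
    refine LinearMap.ext fun t => unTot_injective hX.bounded ?_
    rw [Module.End.mul_apply, unTot_eigenIdem, unTot_eigenIdem, eigenProj_eigenProj hξ]
    split_ifs
    · rw [unTot_eigenIdem]
    · exact (map_zero _).symm
  sum := by
    refine LinearMap.ext fun t => unTot_injective hX.bounded ?_
    rw [LinearMap.sum_apply, map_sum]
    simp only [unTot_eigenIdem]
    exact sum_eigenProj hξ _

lemma totMap_injective {Y Y' : ChainComplex (ModuleCat.{u} Q) ℤ} :
    Function.Injective (totMap : (Y ⟶ Y') → _) := by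
  intro f g h
  refine HomologicalComplex.hom_ext _ _ fun m => ModuleCat.hom_ext (LinearMap.ext fun t => ?_)
  have := LinearMap.congr_fun h (inc Y m t)
  rw [totMap_inc, totMap_inc] at this
  exact DirectSum.of_injective (β := fun i => Y'.X i) m this

/-- The power is the direct sum of its eigencomplexes, already known to be perfect. -/
lemma isPerfectOn_powCx (hξ : IsSplittingRoot q ξ r) (hX : IsPerfectOn Z X) :
    IsPerfectOn Z (powCx q X) := by
  have hq : IsUnit (q : Q) := IsUnit.of_mul_eq_one_right r hξ.mul_eq
  refine IsPerfectOn.of_sum_eq_id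
    (fun j : ZMod q => isPerfectOn_eigenComplex hX (hξ.pow_pow j.val) hq)
    (fun j => eigenIncl q X _) (fun j => eigenRetr X (hξ.pow_pow j.val) r) (totMap_injective ?_)
  rw [totMap_sum, totMap_id]
  exact (isDecomp_eigenIdem hξ hX).sum

/-- A permutation, acting on the total module of the power complex. -/
noncomputable def letterOp (hX : IsPerfectOn Z X) (g : Equiv.Perm (Fin q)) :
    Tot (powCx q X) →ₗ[Q] Tot (powCx q X) :=
  (unTotEquiv q hX.bounded).symm.toLinearMap ∘ₗ permOp q X g ∘ₗ unTot q X

lemma unTot_letterOp (hX : IsPerfectOn Z X) (g : Equiv.Perm (Fin q)) (t : Tot (powCx q X)) :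
    unTot q X (letterOp hX g t) = permOp q X g (unTot q X t) :=
  (unTotEquiv q hX.bounded).apply_symm_apply _

lemma nestEquiv_permOp_letters (hX : IsPerfectOn Z X) (g : Equiv.Perm (Fin q))
    (t : Pow (p * q) X) :
    nestEquiv p q hX (permOp (p * q) X (blockPerm 1 g) t) =
      PiTensorProduct.map (fun _ => letterOp hX g) (nestEquiv p q hX t) := by
  refine map_unTot_injective hX ?_
  rw [map_unTot_nestEquiv, nestMap_permOp_letters, ← map_unTot_nestEquiv hX,
    ← LinearMap.comp_apply, ← LinearMap.comp_apply, ← PiTensorProduct.map_comp,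
    ← PiTensorProduct.map_comp]
  congr 2
  ext1 i
  exact LinearMap.ext fun y => (unTot_letterOp hX g y).symm

lemma letterOp_eigenIdem (hX : IsPerfectOn Z X) (j : ZMod q) :
    letterOp hX (finRotate q) ∘ₗ eigenIdem X hξ j = ξ ^ j.val • eigenIdem X hξ j := by
  refine LinearMap.ext fun t => unTot_injective hX.bounded ?_
  rw [LinearMap.comp_apply, unTot_letterOp, LinearMap.smul_apply, map_smul, unTot_eigenIdem,
    permOp_eigenProj (hξ.pow_pow j.val)]

/-- The functions with sum `b`. -/
def sumFinset (p : ℕ) (b : ZMod q) : Finset (Fin p → ZMod q) :=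
  Finset.univ.filter fun f => ∑ i, f i = b

lemma mem_sumFinset {b : ZMod q} {f : Fin p → ZMod q} : f ∈ sumFinset p b ↔ ∑ i, f i = b := by
  simp [sumFinset]

lemma pow_val_sum (hξ : ξ ^ q = 1) {ι : Type*} (s : Finset ι) (f : ι → ZMod q) :
    ξ ^ (∑ i ∈ s, f i).val = ∏ i ∈ s, ξ ^ (f i).val := by
  classical
  induction s using Finset.induction_on with
  | empty => simp
  | insert i s hi ih => rw [Finset.sum_insert hi, Finset.prod_insert hi, pow_val_add hξ, ih]

/-- On the summand `f`, rotating the letters in every block multiplies by the product of the `ξ ^ f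
i`, which depends only on the sum of `f`. -/
lemma map_letterOp_setIdem (hX : IsPerfectOn Z X) (b : ZMod q) (t : Pow p (powCx q X)) :
    PiTensorProduct.map (fun _ => letterOp hX (finRotate q))
      (setIdem (eigenIdem X hξ) (sumFinset p b) t) =
      ξ ^ b.val • setIdem (eigenIdem X hξ) (sumFinset p b) t := by
  rw [setIdem, LinearMap.sum_apply, map_sum, Finset.smul_sum]
  refine Finset.sum_congr rfl fun f hf => ?_
  rw [← LinearMap.comp_apply, powIdem, ← PiTensorProduct.map_comp, ← mem_sumFinset.1 hf,
    pow_val_sum hξ.pow_eq]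
  simp only [letterOp_eigenIdem hξ]
  have := (PiTensorProduct.mapMultilinear Q (fun _ : Fin p => Tot (powCx q X))
    fun _ => Tot (powCx q X)).map_smul_univ (fun i => ξ ^ (f i).val) fun i => eigenIdem X hξ (f i)
  exact LinearMap.congr_fun this t

lemma sum_setIdem_sumFinset (hX : IsPerfectOn Z X) (t : Pow p (powCx q X)) :
    ∑ b : ZMod q, setIdem (eigenIdem X hξ) (sumFinset p b) t = t := by
  have h1 := LinearMap.congr_fun (setIdem_univ (n := p) (isDecomp_eigenIdem hξ hX)) t
  rw [Module.End.one_apply] at h1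
  nth_rw 2 [← h1]
  simp only [setIdem, sumFinset, ← LinearMap.sum_apply]
  rw [Finset.sum_fiberwise]

lemma map_letterOp_eq_iff (hX : IsPerfectOn Z X) (b : ZMod q) (t : Pow p (powCx q X)) :
    PiTensorProduct.map (fun _ => letterOp hX (finRotate q)) t = ξ ^ b.val • t ↔
      setIdem (eigenIdem X hξ) (sumFinset p b) t = t := by
  have he := isDecomp_eigenIdem hξ hX
  constructor
  · intro h
    have h1 : ∀ a, a ≠ b → setIdem (eigenIdem X hξ) (sumFinset p a) t = 0 := by
      intro a hab
      -- On the component of sum `a` the operator acts by `ξ ^ a`, but on `t` by `ξ ^ b`; so this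
      -- component of `t` vanishes.
      refine hξ.eq_zero hab (Eq.symm ?_)
      rw [← map_smul, ← h]
      nth_rw 1 [← sum_setIdem_sumFinset hξ hX t]
      simp only [map_sum, map_letterOp_setIdem, map_smul]
      rw [Finset.sum_eq_single a]
      · rw [setIdem_setIdem_apply he, Finset.inter_self]
      · intro a' _ ha'
        have : sumFinset p a ∩ sumFinset p a' = ∅ := by
          refine Finset.eq_empty_of_forall_notMem fun f hf => ?_
          rw [Finset.mem_inter, mem_sumFinset, mem_sumFinset] at hf
          exact ha' (hf.2.symm.trans hf.1)
        rw [setIdem_setIdem_apply he, this, setIdem_empty, LinearMap.zero_apply, smul_zero]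
      · simp
    have h2 := sum_setIdem_sumFinset hξ hX t
    rwa [Finset.sum_eq_single b (fun a _ hab => h1 a hab) (by simp)] at h2
  · intro h
    rw [← h, map_letterOp_setIdem, h]

/-- The joint eigenspaces of the rotation of the blocks and the rotation within each block. -/
noncomputable def pairDeg (p q : ℕ) (X : ChainComplex (ModuleCat.{u} Q) ℤ) (c d : Q) (m : ℤ) :
    Submodule Q (Pow (p * q) X) :=
  permDeg (p * q) X (blockPerm (finRotate p) 1) c m ⊓
    permDeg (p * q) X (blockPerm 1 (finRotate q)) d m

lemma mem_pairDeg {d : Q} {m : ℤ} {t : Pow (p * q) X} : t ∈ pairDeg p q X c d m ↔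
    t ∈ powDeg (p * q) X m ∧ permOp (p * q) X (blockPerm (finRotate p) 1) t = c • t ∧
      permOp (p * q) X (blockPerm 1 (finRotate q)) t = d • t := by
  rw [pairDeg, Submodule.mem_inf, mem_permDeg, mem_permDeg]
  tauto

lemma isDG_pairDeg (d : Q) : IsDG (powD (p * q) X) (pairDeg p q X c d) where
  mem hk t ht := ⟨isDG_permDeg.mem hk t ht.1, isDG_permDeg.mem hk t ht.2⟩
  sq _ t _ := powD_powD t

lemma nestEquiv_mem_weightDeg_iff (hX : IsPerfectOn Z X) (b : ZMod q) {m : ℤ}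
    {t : Pow (p * q) X} : nestEquiv p q hX t ∈
      weightDeg (eigenIdem X hξ) (finRotate p) (sumFinset p b) c m ↔
      t ∈ pairDeg p q X c (ξ ^ b.val) m := by
  rw [mem_pairDeg, mem_weightDeg, nestEquiv_mem_iff, ← map_letterOp_eq_iff hξ hX,
    ← nestEquiv_permOp_blocks, ← nestEquiv_permOp_letters, ← map_smul, ← map_smul,
    (nestEquiv p q hX).injective.eq_iff, (nestEquiv p q hX).injective.eq_iff]

lemma dgClass_pairDeg (hX : IsPerfectOn Z X) (b : ZMod q) :
    dgClass Z (powD (p * q) X) (pairDeg p q X c (ξ ^ b.val)) =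
      dgClass Z (powD p (powCx q X))
        (weightDeg (eigenIdem X hξ) (finRotate p) (sumFinset p b) c) := by
  refine DGIso.class_eq (φ := (nestEquiv p q hX).toLinearMap)
    (ψ := (nestEquiv p q hX).symm.toLinearMap) ⟨?_, ?_, ?_, ?_, ?_⟩ (isDG_pairDeg _)
  · exact fun m t ht => (nestEquiv_mem_weightDeg_iff hξ hX b).2 ht
  · intro m t ht
    refine (nestEquiv_mem_weightDeg_iff hξ hX b).1 ?_
    rwa [LinearEquiv.coe_coe, LinearEquiv.apply_symm_apply]
  · exact fun m t _ => (nestEquiv p q hX).symm_apply_apply t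
  · exact fun m t _ => (nestEquiv p q hX).apply_symm_apply t
  · exact fun m t _ => nestEquiv_powD hX t

/-- The joint eigencomplexes of blocks and letters, in terms of the eigencomplexes of an
eigencomplex. -/
lemma exists_dgClass_pairDeg [Fact p.Prime] (hξ : IsSplittingRoot q ξ r) (hpq : p.Coprime q)
    (hp : IsUnit (p : Q)) (hX : IsPerfectOn Z X) (j : ZMod q) :
    ∃ N : K0 Z, ∀ c : Q, c ^ p = 1 →
      dgClass Z (powD (p * q) X) (pairDeg p q X c (ξ ^ (p * j).val)) =
      dgClass Z (powD p (eigenComplex q X (ξ ^ j.val)))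
        (eigenDeg p (eigenComplex q X (ξ ^ j.val)) c) + N := by
  have he := isDecomp_eigenIdem hξ hX
  have hY := isPerfectOn_powCx hξ hX
  have hpu : IsUnit (p : ZMod q) := (ZMod.unitOfCoprime p hpq).isUnit
  -- A constant function `i` has sum `p * i`, and `p` is invertible modulo `q`.
  have hc0 : ∀ i : ZMod q, Function.const (Fin p) i ∈ sumFinset p ((p : ZMod q) * j) ↔ i = j := by
    intro i
    rw [mem_sumFinset]
    simp only [Function.const_apply, Finset.sum_const, Finset.card_univ, Fintype.card_fin,
      nsmul_eq_mul]
    exact hpu.mul_right_inj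
  have hA : ∀ f : Fin p → ZMod q, f ∘ finRotate p ∈ sumFinset p ((p : ZMod q) * j) ↔
      f ∈ sumFinset p ((p : ZMod q) * j) := by
    intro f
    rw [mem_sumFinset, mem_sumFinset]
    exact Eq.congr_left (Equiv.sum_comp (finRotate p) f)
  have hB : ∀ f : Fin p → ZMod q, f ∘ finRotate p ∈ ({Function.const _ j} : Finset _) ↔
      f ∈ ({Function.const _ j} : Finset _) := by
    intro f
    rw [Finset.mem_singleton, Finset.mem_singleton]
    constructor
    · intro h
      ext1 i
      have := congrFun h ((finRotate p).symm i)
      simpa using this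
    · rintro rfl
      rfl
  have hu : sumFinset p ((p : ZMod q) * j) = {Function.const _ j} ∪
      (sumFinset p ((p : ZMod q) * j) \ {Function.const _ j}) := by
    rw [Finset.union_sdiff_of_subset]
    rw [Finset.singleton_subset_iff, hc0]
  have hC : ∀ f : Fin p → ZMod q, f ∘ finRotate p ∈
      sumFinset p ((p : ZMod q) * j) \ {Function.const _ j} ↔
      f ∈ sumFinset p ((p : ZMod q) * j) \ {Function.const _ j} := by
    intro f
    rw [Finset.mem_sdiff, Finset.mem_sdiff, hA, hB]
  -- The nonconstant functions contribute equally for every `c`, so `c = 1` represents them all.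
  refine ⟨dgClass Z (powD p (powCx q X)) (weightDeg (eigenIdem X hξ) (finRotate p)
    (sumFinset p ((p : ZMod q) * j) \ {Function.const _ j}) 1), fun c hc => ?_⟩
  rw [dgClass_pairDeg hξ hX, ← dgClass_weightDeg_nonconst he hC _ hc,
    ← dgClass_weightDeg_const (e := eigenIdem X hξ) j (eigenIncl q X _)
      (eigenRetr X (hξ.pow_pow j.val) r) (eigenIncl_eigenRetr _ hξ.mul_eq) rfl,
    ← dgClass_weightDeg_union he hY hc hp hB hC Finset.disjoint_sdiff, ← hu]
  intro i hi
  rw [Finset.mem_sdiff, hc0] at hi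
  exact hi.2 (by rw [hi.1, Finset.mem_singleton])

end EigenDecomposition

/-! ### The `pq`-cycle as a product of commuting rotations -/

section ProductOfCycles

variable {Q : Type u} [CommRing Q] {X : ChainComplex (ModuleCat.{u} Q) ℤ} {p q : ℕ}
variable {Z : Set (PrimeSpectrum Q)} {c d : Q}

lemma blockPerm_mul (τ τ' : Equiv.Perm (Fin p)) (g g' : Equiv.Perm (Fin q)) :
    blockPerm τ g * blockPerm τ' g' = blockPerm (τ * τ') (g * g') := by
  refine Equiv.ext fun k => ?_
  obtain ⟨⟨i, j⟩, rfl⟩ := finProdFinEquiv.surjective k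
  simp only [Equiv.Perm.mul_apply, blockPerm_apply]

lemma blockPerm_one_one : blockPerm (1 : Equiv.Perm (Fin p)) (1 : Equiv.Perm (Fin q)) = 1 := by
  refine Equiv.ext fun k => ?_
  obtain ⟨⟨i, j⟩, rfl⟩ := finProdFinEquiv.surjective k
  rw [blockPerm_apply]
  rfl

lemma blockPerm_pow (τ : Equiv.Perm (Fin p)) (g : Equiv.Perm (Fin q)) (k : ℕ) :
    blockPerm τ g ^ k = blockPerm (τ ^ k) (g ^ k) := by
  induction k with
  | zero => rw [pow_zero, pow_zero, pow_zero, blockPerm_one_one]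
  | succ k ih => rw [pow_succ, ih, blockPerm_mul, pow_succ, pow_succ]

/-- The rotation of `p * q` letters is conjugate to the product of the rotations. -/
lemma exists_conj_blockPerm [NeZero p] [NeZero q] (h : p.Coprime q) :
    ∃ ρ : Equiv.Perm (Fin (p * q)),
      ρ * finRotate (p * q) = blockPerm (finRotate p) (finRotate q) * ρ := by
  -- Being a ring map, the Chinese remainder isomorphism turns adding `1` into adding `1` in both
  -- coordinates.
  let e : Fin (p * q) ≃ ZMod p × ZMod q :=
    (finEquivZMod (p * q)).trans (ZMod.chineseRemainder h).toEquiv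
  let e' : ZMod p × ZMod q ≃ Fin p × Fin q :=
    (Equiv.prodCongr (finEquivZMod p) (finEquivZMod q)).symm
  refine ⟨e.trans (e'.trans finProdFinEquiv), Equiv.ext fun k => ?_⟩
  have h1 : e (finRotate (p * q) k) = e k + 1 := by
    simp only [e, Equiv.trans_apply, finEquivZMod_finRotate]
    change ZMod.chineseRemainder h _ = ZMod.chineseRemainder h _ + 1
    rw [map_add, map_one]
  have h2 : ∀ x, e' (x + 1) = (finRotate p (e' x).1, finRotate q (e' x).2) := by
    intro x
    obtain ⟨⟨i, j⟩, rfl⟩ := e'.symm.surjective x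
    rw [Equiv.apply_symm_apply]
    refine ((Equiv.eq_symm_apply e').1 ?_)
    exact Prod.ext (finEquivZMod_finRotate i).symm (finEquivZMod_finRotate j).symm
  simp only [Equiv.Perm.mul_apply, Equiv.trans_apply, h1, h2]
  exact (blockPerm_apply _ _ _ _).symm

lemma permDeg_blockPerm [NeZero q] (h : p.Coprime q) (hc : c ^ p = 1) (hd : d ^ q = 1) :
    permDeg (p * q) X (blockPerm (finRotate p) (finRotate q)) (c * d) = pairDeg p q X c d := by
  -- The powers with exponents `u` and `v` extract the block part with `c` and the letter part with
  -- `d` from the product.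
  obtain ⟨u, hup, huq⟩ := Nat.chineseRemainder h 1 0
  obtain ⟨v, hvp, hvq⟩ := Nat.chineseRemainder h 0 1
  have key : ∀ {M : Type u} [Monoid M] {x : M} {N k l : ℕ}, x ^ N = 1 → k ≡ l [MOD N] →
      x ^ k = x ^ l := by
    intro M _ x N k l hx hkl
    rw [pow_eq_pow_mod k hx, hkl, ← pow_eq_pow_mod l hx]
  have key' : ∀ {M : Type} [Monoid M] {x : M} {N k l : ℕ}, x ^ N = 1 → k ≡ l [MOD N] →
      x ^ k = x ^ l := by
    intro M _ x N k l hx hkl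
    rw [pow_eq_pow_mod k hx, hkl, ← pow_eq_pow_mod l hx]
  ext m t
  rw [mem_permDeg, mem_pairDeg]
  refine and_congr_right fun _ => ⟨fun ht => ⟨?_, ?_⟩, fun ht => ?_⟩
  · have h1 := permOp_pow_apply ht u
    rwa [blockPerm_pow, mul_pow, key' finRotate_pow_self hup, key' finRotate_pow_self huq,
      key hc hup, key hd huq, pow_one, pow_zero, pow_one, pow_zero, mul_one] at h1
  · have h1 := permOp_pow_apply ht v
    rwa [blockPerm_pow, mul_pow, key' finRotate_pow_self hvp, key' finRotate_pow_self hvq,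
      key hc hvp, key hd hvq, pow_one, pow_zero, pow_one, pow_zero, one_mul] at h1
  · have h1 : blockPerm (finRotate p) (finRotate q) =
        blockPerm (finRotate p) 1 * blockPerm 1 (finRotate q) := by
      rw [blockPerm_mul, mul_one, one_mul]
    rw [h1, ← permOp_permOp, ht.1, map_smul, ht.2, smul_smul]

lemma dgClass_eigenDeg_mul [NeZero p] [NeZero q] (h : p.Coprime q) (hc : c ^ p = 1)
    (hd : d ^ q = 1) :
    dgClass Z (powD (p * q) X) (eigenDeg (p * q) X (c * d)) =
      dgClass Z (powD (p * q) X) (pairDeg p q X c d) := by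
  obtain ⟨ρ, hρ⟩ := exists_conj_blockPerm h
  rw [← permDeg_blockPerm h hc hd]
  exact (dgClass_permDeg_conj hρ).symm

/-- Residues modulo `p * q` as sums of multiples of `q` and `p`. -/
lemma sum_range_mul_eq_sum [NeZero p] [NeZero q] (h : p.Coprime q) {M : Type*} [AddCommMonoid M]
    (F : ℕ → M) (hF : ∀ k l, k ≡ l [MOD p * q] → F k = F l) :
    ∑ k ∈ Finset.range (p * q), F k =
      ∑ b : ZMod q, ∑ a : ZMod p, F (q * a.val + p * b.val) := by
  rw [← sum_zmod_eq_sum_range, ← Fintype.sum_prod_type']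
  symm
  -- Modulo `p` the value is `q` times the second coordinate, modulo `q` it is `p` times the first;
  -- both multipliers are invertible.
  let f : ZMod q × ZMod p → ZMod (p * q) :=
    fun x => ((q * x.2.val + p * x.1.val : ℕ) : ZMod (p * q))
  have hf : Function.Bijective f := by
    rw [Fintype.bijective_iff_injective_and_card]
    refine ⟨fun x y hxy => ?_, by simp [mul_comm]⟩
    have hxy' := (ZMod.natCast_eq_natCast_iff _ _ _).1 hxy
    have h1 := (ZMod.natCast_eq_natCast_iff _ _ _).2 (hxy'.of_mul_right q)
    have h2 := (ZMod.natCast_eq_natCast_iff _ _ _).2 (hxy'.of_mul_left p)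
    push_cast at h1 h2
    simp only [ZMod.natCast_zmod_val, ZMod.natCast_self, zero_mul, add_zero, zero_add] at h1 h2
    exact Prod.ext ((ZMod.unitOfCoprime p h).isUnit.mul_left_cancel h2)
      ((ZMod.unitOfCoprime q h.symm).isUnit.mul_left_cancel h1)
  refine Function.Bijective.sum_comp hf (fun z => F z.val) |>.symm ▸ ?_
  refine Finset.sum_congr rfl fun x _ => hF _ _ ?_
  rw [ZMod.val_natCast]
  exact (Nat.mod_modEq _ _).symm

end ProductOfCycles

/-! ### Comparing cyclotomic rings along a divisor -/

section CyclotomicRestriction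

variable {m n k : ℕ} [NeZero n]

lemma exp_eq_pow (h : n = m * k) : Complex.exp (2 * Real.pi * Complex.I / m) =
    Complex.exp (2 * Real.pi * Complex.I / n) ^ k := by
  have hn : (n : ℂ) ≠ 0 := Nat.cast_ne_zero.2 (NeZero.ne n)
  have hn' : (n : ℂ) = m * k := by rw [h]; push_cast; rfl
  have hm : (m : ℂ) ≠ 0 := fun h => hn (by rw [hn', h, zero_mul])
  have hk : (k : ℂ) ≠ 0 := fun h => hn (by rw [hn', h, mul_zero])
  rw [← Complex.exp_nat_mul, hn']
  congr 1
  field_simp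

lemma exists_cycloInt_hom (h : n = m * k) :
    ∃ f : cycloInt m →+* cycloInt n, f (zetaInt m) = zetaInt n ^ k := by
  have hle : cycloInt m ≤ cycloInt n := by
    refine Algebra.adjoin_le ?_
    rintro x rfl
    rw [exp_eq_pow h]
    exact Subtype.property (zetaInt n ^ k)
  exact ⟨(Subalgebra.inclusion hle).toRingHom, Subtype.ext (exp_eq_pow h)⟩

lemma restrictCyclo_zeta {Q : Type u} [CommRing Q] [Algebra (cycloRing n) Q] (h : n = m * k)
    (h' : m ∣ n) : restrictCyclo Q h' (zeta m) = algebraMap (cycloRing n) Q (zeta n) ^ k := by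
  rw [← map_pow]
  exact congrArg (algebraMap (cycloRing n) Q) (Subtype.ext (exp_eq_pow h))

/-- The geometric sums vanish already in the cyclotomic ring, a domain in which the root is
primitive, and the identity is mapped to `Q`. In `Q` itself the root need not behave well a priori.
-/
lemma isSplittingRoot_zeta {Q : Type u} [CommRing Q] (ρ : cycloRing n →+* Q) (h : n = m * k) :
    IsSplittingRoot m (ρ (zeta n) ^ k) (ρ (invNat n) * k) where
  pow_eq := by rw [← pow_mul, mul_comm k, ← h, map_zeta_pow]
  sum_eq l hl := by
    have h0 : ∑ i ∈ Finset.range m, ((zeta n ^ k) ^ l) ^ i = 0 := by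
      have h1 := mul_geom_sum ((zeta n ^ k) ^ l) m
      have h2 : (zeta n ^ k) ^ m = 1 := by rw [← pow_mul, mul_comm k, ← h, zeta_pow]
      rw [← pow_mul (zeta n ^ k), mul_comm l, pow_mul, h2, one_pow, sub_self] at h1
      refine (mul_eq_zero.1 h1).resolve_left fun h3 => hl ?_
      rw [sub_eq_zero, ← pow_mul] at h3
      have h4 := (isPrimitiveRoot_zeta n).dvd_of_pow_eq_one _ h3
      rw [h, mul_comm m] at h4
      refine Nat.dvd_of_mul_dvd_mul_left (Nat.pos_of_ne_zero ?_) h4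
      rintro rfl
      exact NeZero.ne n (by rw [h, mul_zero])
    simpa using congrArg ρ h0
  mul_eq := by
    rw [mul_assoc, ← Nat.cast_mul, mul_comm k, ← h, ← map_natCast ρ, ← map_mul, invNat_mul, map_one]

/-- The defining formula of a cyclic Adams operation, with larger coefficients. -/
lemma tmul_one_eq_sum {Q : Type u} [CommRing Q] {Z : Set (PrimeSpectrum Q)} [NeZero m]
    [Algebra (cycloRing n) Q] (h : n = m * k) (h' : m ∣ n) {ψ : K0 Z → K0 Z}
    (hψ : IsCyclicAdams (restrictCyclo Q h' : cycloRing m →+* Q) Z ψ) (X : PerfComplex Z) :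
    ψ (K0.cls X) ⊗ₜ[ℤ] (1 : cycloInt n) = ∑ a : ZMod m, dgClass Z (powD m X.1)
      (eigenDeg m X.1 ((algebraMap (cycloRing n) Q (zeta n) ^ k) ^ a.val)) ⊗ₜ[ℤ]
        ((zetaInt n ^ k) ^ a.val) := by
  obtain ⟨f, hf⟩ := exists_cycloInt_hom h
  have h1 := congrArg (LinearMap.lTensor (K0 Z) f.toAddMonoidHom.toIntLinearMap) (hψ X)
  rw [cyclicSum, map_sum] at h1
  simp only [LinearMap.lTensor_tmul, AddMonoidHom.coe_toIntLinearMap, RingHom.toAddMonoidHom_eq_coe,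
    AddMonoidHom.coe_coe, map_one, map_pow, hf, cls_eigenObj, restrictCyclo_zeta h] at h1
  rw [h1, sum_zmod_eq_sum_range fun a => dgClass Z (powD m X.1)
      (eigenDeg m X.1 ((algebraMap (cycloRing n) Q (zeta n) ^ k) ^ a)) ⊗ₜ[ℤ] ((zetaInt n ^ k) ^ a)]

end CyclotomicRestriction

/-! ### Composition of two operations -/

section Composite

variable {Q : Type u} [CommRing Q] {Z : Set (PrimeSpectrum Q)} {p q n : ℕ}

/-- The composite of the cyclic Adams operations of two distinct prime orders. -/
lemma cyclicSum_eq_comp [Fact p.Prime] [Fact q.Prime] [NeZero n] (hpq : p ≠ q) (hn : n = p * q)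
    (ρ : cycloRing n →+* Q) {ψp ψq : K0 Z →+ K0 Z}
    (Hp : ∀ X : PerfComplex Z, ψp (K0.cls X) ⊗ₜ[ℤ] (1 : cycloInt n) = ∑ a : ZMod p,
      dgClass Z (powD p X.1) (eigenDeg p X.1 ((ρ (zeta n) ^ q) ^ a.val)) ⊗ₜ[ℤ]
        ((zetaInt n ^ q) ^ a.val))
    (Hq : ∀ X : PerfComplex Z, ψq (K0.cls X) ⊗ₜ[ℤ] (1 : cycloInt n) = ∑ b : ZMod q,
      dgClass Z (powD q X.1) (eigenDeg q X.1 ((ρ (zeta n) ^ p) ^ b.val)) ⊗ₜ[ℤ]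
        ((zetaInt n ^ p) ^ b.val))
    (X : PerfComplex Z) :
    ψp (ψq (K0.cls X)) ⊗ₜ[ℤ] (1 : cycloInt n) = cyclicSum ρ X := by
  have hp : p.Prime := Fact.out
  have hq : q.Prime := Fact.out
  have hcop : p.Coprime q := (Nat.coprime_primes hp hq).2 hpq
  have hξ : IsSplittingRoot q (ρ (zeta n) ^ p) _ := isSplittingRoot_zeta ρ (hn.trans (mul_comm p q))
  have hξp : IsSplittingRoot p (ρ (zeta n) ^ q) _ := isSplittingRoot_zeta ρ hn
  have hζp : IsPrimitiveRoot (zetaInt n ^ q) p :=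
    (isPrimitiveRoot_zetaInt n).pow (NeZero.pos n) (hn.trans (mul_comm p q))
  have hunit : IsUnit ((p : Q) * q) := by
    have := isUnit_natCast ρ
    rwa [hn, Nat.cast_mul] at this
  have hpu : IsUnit (p : Q) := isUnit_of_mul_isUnit_left hunit
  have hqu : IsUnit (q : Q) := isUnit_of_mul_isUnit_right hunit
  -- The power `T^p` of the `ξ ^ j`-part of `T^q` has letter eigenvalue `ξ ^ (p * j)`, so the sum
  -- over `q`-th roots of unity is reindexed by multiplication by `p`.
  let mulp : Equiv.Perm (ZMod q) := Units.mulLeft (ZMod.unitOfCoprime p hcop)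
  have hval : ∀ (j : ZMod q), (ρ (zeta n) ^ p) ^ (p * j).val = ((ρ (zeta n) ^ p) ^ j.val) ^ p := by
    intro j
    have h1 := pow_val_eq hξ.pow_eq (j.val * p)
    push_cast at h1
    rwa [ZMod.natCast_zmod_val, mul_comm, pow_mul _ j.val] at h1
  let Y (j : ZMod q) : PerfComplex Z := ⟨eigenComplex q X.1 ((ρ (zeta n) ^ p) ^ j.val),
    isPerfectOn_eigenComplex X.2 (hξ.pow_pow j.val) hqu⟩
  -- The Galois symmetry compensates for the reindexing: the exponents `j` and `p * j` give the same
  -- class.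
  have hY : ∀ j, K0.cls (Y j) = dgClass Z (powD q X.1)
      (eigenDeg q X.1 ((ρ (zeta n) ^ p) ^ (p * j).val)) := by
    intro j
    rw [hval, dgClass_eigenDeg_pow hq.one_lt hcop (hξ.pow_pow j.val),
      dgClass_eigenDeg X.2 (hξ.pow_pow j.val) hqu]
  have hL : ψp (ψq (K0.cls X)) ⊗ₜ[ℤ] (1 : cycloInt n) =
      ∑ j : ZMod q, ψp (K0.cls (Y j)) ⊗ₜ[ℤ] ((zetaInt n ^ p) ^ (p * j).val) := by
    have h1 := congrArg (LinearMap.rTensor (cycloInt n) ψp.toIntLinearMap) (Hq X)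
    rw [map_sum] at h1
    simp only [LinearMap.rTensor_tmul, AddMonoidHom.coe_toIntLinearMap] at h1
    rw [h1, ← Equiv.sum_comp mulp]
    simp only [hY]
    rfl
  -- For fixed `j`, the sum over `p`-th roots of unity removes the term `N` and leaves the formula
  -- for `ψp` on the eigencomplex `Y j`.
  have hsummand : ∀ j : ZMod q, ∑ a : ZMod p, dgClass Z (powD (p * q) X.1)
      (pairDeg p q X.1 ((ρ (zeta n) ^ q) ^ a.val) ((ρ (zeta n) ^ p) ^ (p * j).val)) ⊗ₜ[ℤ]
        ((zetaInt n ^ q) ^ a.val * (zetaInt n ^ p) ^ (p * j).val) =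
      ψp (K0.cls (Y j)) ⊗ₜ[ℤ] ((zetaInt n ^ p) ^ (p * j).val) := by
    intro j
    obtain ⟨N, hN⟩ := exists_dgClass_pairDeg hξ hcop hpu X.2 j
    have h1 := congrArg (LinearMap.lTensor (K0 Z)
      (LinearMap.mulRight ℤ ((zetaInt n ^ p) ^ (p * j).val))) (Hp (Y j))
    rw [map_sum] at h1
    simp only [LinearMap.lTensor_tmul, LinearMap.mulRight_apply, one_mul] at h1
    have h2 : ∑ a : ZMod p, N ⊗ₜ[ℤ]
        ((zetaInt n ^ q) ^ a.val * (zetaInt n ^ p) ^ (p * j).val) = 0 := by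
      rw [← TensorProduct.tmul_sum, ← Finset.sum_mul,
        sum_zmod_eq_sum_range fun a => (zetaInt n ^ q) ^ a, hζp.geom_sum_eq_zero hp.one_lt,
        zero_mul, TensorProduct.tmul_zero]
    simp only [fun a : ZMod p => hN _ (hξp.pow_pow a.val), TensorProduct.add_tmul,
      Finset.sum_add_distrib, h2, add_zero]
    exact h1.symm
  -- Each `pq`-th root of unity is uniquely a `p`-th root times a `q`-th root, and the corresponding
  -- eigenspace is the joint eigenspace of the two rotations.
  have hR : cyclicSum ρ X = ∑ b : ZMod q, ∑ a : ZMod p, dgClass Z (powD (p * q) X.1)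
      (pairDeg p q X.1 ((ρ (zeta n) ^ q) ^ a.val) ((ρ (zeta n) ^ p) ^ b.val)) ⊗ₜ[ℤ]
        ((zetaInt n ^ q) ^ a.val * (zetaInt n ^ p) ^ b.val) := by
    subst hn
    simp only [cyclicSum, cls_eigenObj]
    rw [sum_range_mul_eq_sum hcop fun k => dgClass Z (powD (p * q) X.1)
      (eigenDeg (p * q) X.1 (ρ (zeta (p * q)) ^ k)) ⊗ₜ[ℤ] (zetaInt (p * q) ^ k)]
    · refine Finset.sum_congr rfl fun b _ => Finset.sum_congr rfl fun a _ => ?_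
      rw [pow_add, pow_add, pow_mul, pow_mul, pow_mul, pow_mul, dgClass_eigenDeg_mul hcop]
      · exact hξp.pow_pow _
      · exact hξ.pow_pow _
    · intro k l hkl
      have h1 : ρ (zeta (p * q)) ^ k = ρ (zeta (p * q)) ^ l := by
        rw [pow_eq_pow_mod k (map_zeta_pow ρ), hkl, ← pow_eq_pow_mod l (map_zeta_pow ρ)]
      have h2 : zetaInt (p * q) ^ k = zetaInt (p * q) ^ l := by
        have h3 := (isPrimitiveRoot_zetaInt (p * q)).pow_eq_one
        rw [pow_eq_pow_mod k h3, hkl, ← pow_eq_pow_mod l h3]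
      rw [h1, h2]
  rw [hL, hR]
  refine Eq.trans ?_ (Equiv.sum_comp mulp _)
  exact Finset.sum_congr rfl fun j _ => (hsummand j).symm

end Composite

end CyclicAdams

/-! ### The main theorem -/

theorem mainTheorem8 {Q : Type*} [CommRing Q] [IsNoetherianRing Q] (p q : ℕ)
    [Fact p.Prime] [Fact q.Prime] (hpq : p ≠ q) [Algebra (CyclicAdams.cycloRing (p * q)) Q]
    (Z : Set (PrimeSpectrum Q)) (hZ : IsClosed Z) :
    let ρp : CyclicAdams.cycloRing p →+* Q := CyclicAdams.restrictCyclo Q (Dvd.intro q rfl)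
    let ρq : CyclicAdams.cycloRing q →+* Q := CyclicAdams.restrictCyclo Q (Dvd.intro_left p rfl)
    let Ψp : CyclicAdams.K0 Z → CyclicAdams.K0 Z := CyclicAdams.cyclicAdams ρp Z
    let Ψq : CyclicAdams.K0 Z → CyclicAdams.K0 Z := CyclicAdams.cyclicAdams ρq Z
    -- `Ψp` and `Ψq` are well defined, uniquely characterized group endomorphisms
    ((∀ Ψ, CyclicAdams.IsCyclicAdams ρp Z Ψ ↔ Ψ = Ψp) ∧ ∀ a b, Ψp (a + b) = Ψp a + Ψp b) ∧
    ((∀ Ψ, CyclicAdams.IsCyclicAdams ρq Z Ψ ↔ Ψ = Ψq) ∧ ∀ a b, Ψq (a + b) = Ψq a + Ψq b) ∧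
    -- they commute
    Ψp ∘ Ψq = Ψq ∘ Ψp ∧
    -- and both composites are given by the sum over all `pq`-th roots of unity
    ∀ X : CyclicAdams.PerfComplex Z,
      Ψp (Ψq (CyclicAdams.K0.cls X)) ⊗ₜ[ℤ] (1 : CyclicAdams.cycloInt (p * q)) =
          CyclicAdams.cyclicSum (algebraMap (CyclicAdams.cycloRing (p * q)) Q) X ∧
      Ψq (Ψp (CyclicAdams.K0.cls X)) ⊗ₜ[ℤ] (1 : CyclicAdams.cycloInt (p * q)) =
          CyclicAdams.cyclicSum (algebraMap (CyclicAdams.cycloRing (p * q)) Q) X := by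
  intro ρp ρq Ψp Ψq
  obtain ⟨ψp, hp⟩ := CyclicAdams.exists_cyclicAdams_hom ρp Z
  obtain ⟨ψq, hq⟩ := CyclicAdams.exists_cyclicAdams_hom ρq Z
  have hΨp : Ψp = ψp := CyclicAdams.cyclicAdams_eq ρp hp
  have hΨq : Ψq = ψq := CyclicAdams.cyclicAdams_eq ρq hq
  have Hp := CyclicAdams.tmul_one_eq_sum (k := q) rfl _ hp
  have Hq := CyclicAdams.tmul_one_eq_sum (k := p) (mul_comm p q) _ hq
  have h1 := CyclicAdams.cyclicSum_eq_comp hpq rfl _ Hp Hq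
  -- The roles of the primes are exchanged while the ring of coefficients stays that of `p * q`;
  -- both composites thus equal the same sum.
  have h2 := CyclicAdams.cyclicSum_eq_comp hpq.symm (mul_comm p q) _ Hq Hp
  rw [hΨp, hΨq]
  refine ⟨⟨CyclicAdams.isCyclicAdams_iff ρp hp, map_add ψp⟩,
    ⟨CyclicAdams.isCyclicAdams_iff ρq hq, map_add ψq⟩, funext fun a => ?_, fun X => ⟨h1 X, h2 X⟩⟩
  obtain ⟨X, rfl⟩ := CyclicAdams.K0.cls_surjective a
  exact CyclicAdams.tmul_one_injective (p * q) ((h1 X).trans (h2 X).symm)
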